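/- Consider $N$ players, player $i$ choosing $a^i\in\mathbb R^{d_i}$, $D=\sum_i d_i$, with costs $J^i:\mathbb R^D\to\mathbb R$ and the shared constraint set $C=\{a\in\mathbb R^D: g(a)=Ka-l\le 0\}$, where $K\in\mathbb R^{n\times D}$, $l\in\mathbb R^n$. The pseudo-gradient is $M=[M^1,\dots,M^N]$, $M^{i,j}(a)=\partial J^i(a)/\partial a^{i,j}$. A variational generalized Nash equilibrium (v-GNE) is a point $a^*\in C$ with $\langle M(a^*),a-a^*\rangle\ge 0$ for all $a\in C$. Assume: 1. each $J^i$ is continuously differentiable on $\mathbb R^D$ and convex in $a^i$ for fixed $a^{-i}$; 2. $M$ is strongly monotone: for some $\nu>0$, $\langle M(a)-M(b),a-b\rangle\ge\nu\|a-b\|^2$ for all $a,b\in\mathbb R^D$; 3. Slater's condition: there is $\bar a$ with $K\bar a-l<0$ componentwise; 4. for each $i$, $J^i(x)=O(\|x\|^2)$ and $\nabla J^i(x)=O(\|x\|)$ as $\|x\|\to\infty$ (full gradient), and $M$ is Lipschitz continuous on $\mathbb R^D$. Then there exists a unique v-GNE $a^*$. Let $U^i(a,\lambda)=J^i(a)+\langle\lambda,Ka-l\rangle$.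 For arbitrary $\mu(0)\in\mathbb R^D$, $\lambda(0)\in\mathbb R^n_{+}$ and $t=0,1,2,\dots$, let each player $i$ draw, given the past, $a^i(t)$ from the normal distribution with mean $\mu^i(t)$ and covariance $\sigma_t^2 I$, independently of the other players, and put $$m^i(t)=\bigl(U^i(a(t),\lambda(t))-U^i(\mu(t),\lambda(t))\bigr)\frac{a^i(t)-\mu^i(t)}{\sigma_t^2},$$ $$\mu^i(t+1)=\mu^i(t)-\gamma_t m^i(t),\qquad \lambda(t+1)=\Pi_{\mathbb R^n_+}\bigl[\lambda(t)-\gamma_t\bigl(-(Ka(t)-l)+\varepsilon_t\lambda(t)\bigr)\bigr],$$ where $\gamma_t=G/t^g$, $\varepsilon_t=E/t^e$, $\sigma_t=S/t^s$ for $t\ge1$ with $G,E,S>0$ and $g,e,s>0$, and $\gamma_0,\varepsilon_0,\sigma_0>0$ are arbitrary. Suppose $s+g>1$, $g+e<1$ and $g>1/2$, and let $h=\min\{2-g-e,\;g+s,\;2g\}$. Then $\mathrm E\|\mu(t)-a^*\|^2$ is finite for every $t$ and $$\mathrm E\|\mu(t)-a^*\|^2=O\!\left(\frac1{t^{\min\{2e,\,h-g\}}}\right)\qquad(t\to\infty).$$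 -/

import Mathlib

open MeasureTheory ProbabilityTheory Filter Asymptotics
open scoped NNReal RealInnerProductSpace

noncomputable section

namespace GNEP

/-- Joint actions of `N` players, player `i` having `d i` real coordinates; the coordinate `j` of
player `i` is indexed by the pair `⟨i, j⟩`, and the norm is the Euclidean one. -/
abbrev Joint {N : ℕ} (d : Fin N → ℕ) : Type :=
  EuclideanSpace ℝ (Σ i : Fin N, Fin (d i))

/-- The data of a game with cost functions `J i` and the shared constraint `K a - l ≤ 0`,
consisting of `n` linear inequalities. -/
structure Game (N n : ℕ) (d : Fin N → ℕ) where
  J : Fin N → Joint d → ℝ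
  K : Matrix (Fin n) (Σ i : Fin N, Fin (d i)) ℝ
  l : EuclideanSpace ℝ (Fin n)

/-- The joint action in which player `i` plays as in `x` and all other players play as in `a`. -/
def deviate {N : ℕ} {d : Fin N → ℕ} (i : Fin N) (x a : Joint d) : Joint d :=
  WithLp.toLp 2 (fun p => if p.1 = i then x p else a p)

namespace Game

variable {N n : ℕ} {d : Fin N → ℕ} (Γ : Game N n d)

/-- The constraint function `g(a) = K a - l`. -/
def constraint (a : Joint d) : EuclideanSpace ℝ (Fin n) :=
  WithLp.toLp 2 (Γ.K.mulVec a.ofLp - Γ.l.ofLp)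

/-- The coupling constraint set `C = {a : K a - l ≤ 0}`. -/
def feasible : Set (Joint d) :=
  {a | ∀ k, Γ.constraint a k ≤ 0}

/-- Slater's constraint qualification for `C`. -/
def Slater : Prop :=
  ∃ a : Joint d, ∀ k, Γ.constraint a k < 0

/-- The game is convex: each cost is continuously differentiable on the whole space and convex in
the player's own action when the actions of the other players are fixed. -/
def IsConvex : Prop :=
  ∀ i, ContDiff ℝ 1 (Γ.J i) ∧
    ∀ a : Joint d, ConvexOn ℝ Set.univ (fun x : Joint d => Γ.J i (deviate i x a))

/-- The pseudo-gradient `M`, whose coordinate `⟨i, j⟩` at `a` is `∂ J i / ∂ a^{i,j}`. -/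
def pseudoGradient (a : Joint d) : Joint d :=
  WithLp.toLp 2 (fun p => fderiv ℝ (Γ.J p.1) a (EuclideanSpace.single p 1))

/-- The pseudo-gradient is strongly monotone on the whole space. -/
def IsStronglyMonotone : Prop :=
  ∃ ν : ℝ, 0 < ν ∧ ∀ a b : Joint d,
    ν * ‖a - b‖ ^ 2 ≤ ⟪Γ.pseudoGradient a - Γ.pseudoGradient b, a - b⟫

/-- At most quadratic growth of the costs at infinity, for functions and for gradients:
`J i (x) = O(‖x‖²)` and `∇ J i (x) = O(‖x‖)` as `‖x‖ → ∞`. -/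
def HasQuadraticGrowth : Prop :=
  ∀ i, (Γ.J i =O[Bornology.cobounded (Joint d)] fun x => ‖x‖ ^ 2) ∧
    (fderiv ℝ (Γ.J i) =O[Bornology.cobounded (Joint d)] fun x => ‖x‖)

/-- Variational generalized Nash equilibria: the solutions of the variational inequality defined
by the pseudo-gradient on the coupling constraint set. -/
def IsVGNE (a : Joint d) : Prop :=
  a ∈ Γ.feasible ∧ ∀ b ∈ Γ.feasible, 0 ≤ ⟪Γ.pseudoGradient a, b - a⟫

/-- The cost `U^i(a, lam) = J^i(a) + ⟨lam, g(a)⟩` of player `i` in the game extended by a dual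
player. -/
def lagrangian (i : Fin N) (a : Joint d) (lam : EuclideanSpace ℝ (Fin n)) : ℝ :=
  Γ.J i a + ⟪lam, Γ.constraint a⟫

/-- The two-point estimate of the pseudo-gradient of the extended game: its block `i` is
`(U^i(a, lam) - U^i(μ, lam)) (a^i - μ^i) / σ²`, where `a` is the sampled and `μ` the mean action. -/
def estimate (σ : ℝ) (a μ : Joint d) (lam : EuclideanSpace ℝ (Fin n)) : Joint d :=
  WithLp.toLp 2 (fun p =>
    (Γ.lagrangian p.1 a lam - Γ.lagrangian p.1 μ lam) * ((a p - μ p) / σ ^ 2))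

/-- The Euclidean projection onto the non-negative orthant. -/
def projNonneg (v : EuclideanSpace ℝ (Fin n)) : EuclideanSpace ℝ (Fin n) :=
  WithLp.toLp 2 (fun k => max (v k) 0)

theorem norm_sub_projNonneg_le (v w : EuclideanSpace ℝ (Fin n)) (hw : ∀ k, 0 ≤ w k) :
    ‖v - projNonneg v‖ ≤ ‖v - w‖ := by
  rw [EuclideanSpace.norm_eq, EuclideanSpace.norm_eq]
  refine Real.sqrt_le_sqrt (Finset.sum_le_sum fun k _ => ?_)
  have h := hw k
  simp only [projNonneg, PiLp.sub_apply, Real.norm_eq_abs, sq_abs]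
  rcases le_total (v k) 0 with h0 | h0
  · rw [max_eq_right h0]; nlinarith
  · rw [max_eq_left h0]; nlinarith [sq_nonneg (v k - w k)]

/-- One iteration from the state `(μ, lam)`, with step size `γ`, regularization `ε`, sampling
deviation `σ` and sampled joint action `a`. -/
def step (γ ε σ : ℝ) (a : Joint d) (z : Joint d × EuclideanSpace ℝ (Fin n)) :
    Joint d × EuclideanSpace ℝ (Fin n) :=
  (z.1 - γ • Γ.estimate σ a z.1 z.2,
    projNonneg (z.2 - γ • (-Γ.constraint a + ε • z.2)))

/-- The iterates `(μ(t), lam(t))` of the payoff-based algorithm started at `z₀`, driven by the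
vectors `ξ t`: at time `t` the joint action `a(t) = μ(t) + σ_t ξ(t)` is played. When the `ξ t` are
independent standard Gaussian vectors, each player `i` thus draws `a^i(t)`, given the past, from
the normal distribution with mean `μ^i(t)` and covariance `σ_t² I`, independently of the others. -/
def iterate (γ ε σ : ℕ → ℝ) (z₀ : Joint d × EuclideanSpace ℝ (Fin n)) (ξ : ℕ → Joint d) :
    ℕ → Joint d × EuclideanSpace ℝ (Fin n)
  | 0 => z₀
  | t + 1 =>
    Γ.step (γ t) (ε t) (σ t) ((iterate γ ε σ z₀ ξ t).1 + σ t • ξ t) (iterate γ ε σ z₀ ξ t)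

end Game

end GNEP

end

/-! Existence comes from penalization: replacing the constraint by the penalty `(A a - l)₊ / ε`
leaves a strongly monotone Lipschitz equation, Slater's condition bounds the multipliers uniformly
in `ε`, and a limit point is a KKT point (`exists_kkt`), hence a v-GNE. Uniqueness is strong
monotonicity.

The iteration is a noisy primal-dual scheme. The Gaussian two-point estimate has mean `M μ + A† λ`
up to `O(σ)`, and its size grows linearly with the state (`exists_estimate_bounds`). In the squared
distance to a pair (equilibrium, multiplier) the bilinear coupling cancels, leaving `-ν‖μ - a*‖²`,
the slackness term `⟨λ, g(a*)⟩ ≤ 0` and the effect of the regularization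
(`exists_stepEnergy_bound`). This alone contracts the dual variable only at the slow rate `γ ε`, so
two estimates are combined.

Coarse estimate. The excess of the energy over a fixed threshold contracts at rate `γ ε`, and its
moment of order `2q + 2` obeys a recursion with forcing `γ ε (γ/ε)^(q+1)`
(`exists_excess_pow_contraction`). Since `e < g`, a large `q` makes this moment decay as fast as
desired; the state is essentially bounded.

Fine estimate. The Lyapunov function `‖μ - a*‖² + dist(λ, multipliers)² + η ⟨μ - a*, residual λ⟩`
contracts at the full rate `γ` (`exists_lyap_contraction`). The distance to the whole multiplier set
is needed since multipliers need not be unique. The cross term produces `-‖residual λ‖²`, slackness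
controls the inactive coordinates of `λ` as long as the excess is small, and the Hoffman bound
(`exists_hoffman`) turns these two into control of the dual distance. Young's inequality against
this contraction makes the regularization enter only as `ε²`. The forcing per step is therefore `γ
(ε² + γ + σ²)` plus a multiple of the negligible moment, and Chung's lemma (`isBigO_of_recursion`)
gives `O(ε² + γ + σ²)`, where `s > e` makes `σ²` harmless. -/

namespace GNEP

open scoped Topology

/-! ### Zeros of strongly monotone operators -/

/-- A strongly monotone Lipschitz operator on a Hilbert space has a zero. -/
theorem exists_zero_of_stronglyMonotone {E : Type*} [NormedAddCommGroup E]
    [InnerProductSpace ℝ E] [CompleteSpace E] {T : E → E} {ν L : ℝ} (hν : 0 < ν) (hL : 0 ≤ L)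
    (hmono : ∀ a b, ν * ‖a - b‖ ^ 2 ≤ ⟪T a - T b, a - b⟫)
    (hlip : ∀ a b, ‖T a - T b‖ ≤ L * ‖a - b‖) : ∃ x, T x = 0 := by
  -- The map `x ↦ x - τ T x` has squared Lipschitz constant at most `1 - 2τν + τ²κ²`, which is `1 -
  -- τν` for `τ = ν/κ²`. Taking `κ = L + ν` instead of `L` ensures `κ > 0` and `τν ≤ 1` without
  -- comparing `L` with `ν`.
  set κ : ℝ := L + ν with hκ
  have hκ0 : 0 < κ := by positivity
  set τ : ℝ := ν / κ ^ 2 with hτ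
  have hτ0 : 0 < τ := by positivity
  have hτκ : τ * κ ^ 2 = ν := by rw [hτ]; field_simp
  have hq1 : 0 ≤ 1 - τ * ν := by
    have h2 : τ * ν ≤ 1 := by
      rw [hτ, div_mul_eq_mul_div, div_le_one (by positivity)]
      nlinarith [mul_nonneg hL hν.le, mul_nonneg hL hL]
    linarith
  set q : ℝ := Real.sqrt (1 - τ * ν) with hq
  have hqlt : q < 1 := by
    rw [hq, Real.sqrt_lt' one_pos]; nlinarith [mul_pos hτ0 hν]
  have hcontr : ContractingWith q.toNNReal (fun x => x - τ • T x) := by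
    refine ⟨by rwa [Real.toNNReal_lt_one], LipschitzWith.of_dist_le_mul fun a b => ?_⟩
    rw [Real.coe_toNNReal _ (Real.sqrt_nonneg _), dist_eq_norm, dist_eq_norm]
    refine abs_le_of_sq_le_sq' ?_ (by positivity) |>.2
    have e1 : (a - τ • T a) - (b - τ • T b) = (a - b) - τ • (T a - T b) := by module
    rw [e1, norm_sub_sq_real, inner_smul_right, norm_smul, Real.norm_of_nonneg hτ0.le, mul_pow,
      mul_pow, Real.sq_sqrt hq1, real_inner_comm]
    have h1 := hmono a b
    have h2 : ‖T a - T b‖ ^ 2 ≤ κ ^ 2 * ‖a - b‖ ^ 2 := by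
      rw [← mul_pow]
      refine pow_le_pow_left₀ (norm_nonneg _) ((hlip a b).trans ?_) 2
      gcongr; linarith
    have h3 : τ ^ 2 * ‖T a - T b‖ ^ 2 ≤ τ * ν * ‖a - b‖ ^ 2 := by
      calc τ ^ 2 * ‖T a - T b‖ ^ 2 ≤ τ ^ 2 * (κ ^ 2 * ‖a - b‖ ^ 2) := by gcongr
        _ = τ * (τ * κ ^ 2) * ‖a - b‖ ^ 2 := by ring
        _ = _ := by rw [hτκ]
    nlinarith [mul_le_mul_of_nonneg_left h1 hτ0.le]
  refine ⟨hcontr.fixedPoint, ?_⟩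
  have h := hcontr.fixedPoint_isFixedPt
  rw [Function.IsFixedPt, sub_eq_self] at h
  exact (smul_eq_zero.1 h).resolve_left hτ0.ne'

open Game

/-! ### Projection onto the orthant -/

section Orthant

variable {n : ℕ}

@[simp]
theorem projNonneg_apply (v : EuclideanSpace ℝ (Fin n)) (k : Fin n) :
    projNonneg v k = max (v k) 0 := rfl

theorem euclidean_inner_eq_sum {ι : Type*} [Fintype ι] (v w : EuclideanSpace ℝ ι) :
    ⟪v, w⟫ = ∑ k, v k * w k := by
  simp [PiLp.inner_apply, mul_comm]

/-- Firm nonexpansiveness, checked coordinate by coordinate. It makes the penalty term `A† (A a -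
l)₊` monotone, so penalization keeps the strong monotonicity constant of `M`. -/
theorem norm_projNonneg_sub_sq_le_inner (v w : EuclideanSpace ℝ (Fin n)) :
    ‖projNonneg v - projNonneg w‖ ^ 2 ≤ ⟪projNonneg v - projNonneg w, v - w⟫ := by
  rw [euclidean_inner_eq_sum, EuclideanSpace.real_norm_sq_eq]
  refine Finset.sum_le_sum fun k _ => ?_
  simp only [PiLp.sub_apply, projNonneg_apply]
  rcases le_total (v k) 0 with h | h <;> rcases le_total (w k) 0 with h' | h' <;>
    simp only [h, h', max_eq_left, max_eq_right] <;> nlinarith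

theorem norm_projNonneg_sub_le (v w : EuclideanSpace ℝ (Fin n)) :
    ‖projNonneg v - projNonneg w‖ ≤ ‖v - w‖ := by
  have h1 := norm_projNonneg_sub_sq_le_inner v w
  have h2 := real_inner_le_norm (projNonneg v - projNonneg w) (v - w)
  by_contra! h
  nlinarith [norm_nonneg (v - w), norm_nonneg (projNonneg v - projNonneg w)]

theorem projNonneg_of_nonneg {v : EuclideanSpace ℝ (Fin n)} (hv : ∀ k, 0 ≤ v k) :
    projNonneg v = v := by
  ext k; simp [hv k]

theorem norm_projNonneg_sub_le_of_nonneg (v : EuclideanSpace ℝ (Fin n))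
    {p : EuclideanSpace ℝ (Fin n)} (hp : ∀ k, 0 ≤ p k) : ‖projNonneg v - p‖ ≤ ‖v - p‖ := by
  simpa [projNonneg_of_nonneg hp] using norm_projNonneg_sub_le v p

theorem continuous_projNonneg : Continuous (projNonneg (n := n)) :=
  (LipschitzWith.of_dist_le_mul (K := 1) fun v w => by
    simpa [dist_eq_norm] using norm_projNonneg_sub_le v w).continuous

end Orthant

/-! ### Existence of KKT points by penalization -/

section KKT

variable {E : Type*} [NormedAddCommGroup E] [InnerProductSpace ℝ E] [FiniteDimensional ℝ E]
  {n : ℕ}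

open ContinuousLinearMap in
/-- The penalized equation `M a + A† λ = 0`, `ε λ = (A a - l)₊` has a solution. -/
theorem exists_penalized {M : E → E} {ν L : ℝ} (hν : 0 < ν) (hL : 0 ≤ L)
    (hmono : ∀ a b, ν * ‖a - b‖ ^ 2 ≤ ⟪M a - M b, a - b⟫)
    (hlip : ∀ a b, ‖M a - M b‖ ≤ L * ‖a - b‖) (A : E →L[ℝ] EuclideanSpace ℝ (Fin n))
    (l : EuclideanSpace ℝ (Fin n)) {ε : ℝ} (hε : 0 < ε) :
    ∃ a : E, ∃ lam : EuclideanSpace ℝ (Fin n), ε • lam = projNonneg (A a - l) ∧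
      M a + adjoint A lam = 0 := by
  suffices h : ∃ a, M a + adjoint A (ε⁻¹ • projNonneg (A a - l)) = 0 by
    obtain ⟨a, ha⟩ := h
    exact ⟨a, ε⁻¹ • projNonneg (A a - l), by rw [smul_inv_smul₀ hε.ne'], ha⟩
  refine exists_zero_of_stronglyMonotone
    (T := fun a => M a + adjoint A (ε⁻¹ • projNonneg (A a - l)))
    (L := L + ‖adjoint A‖ * (ε⁻¹ * ‖A‖)) hν (by positivity) (fun a b => ?_) (fun a b => ?_)
  · have e : M a + adjoint A (ε⁻¹ • projNonneg (A a - l))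
        - (M b + adjoint A (ε⁻¹ • projNonneg (A b - l)))
        = (M a - M b) + adjoint A (ε⁻¹ • (projNonneg (A a - l) - projNonneg (A b - l))) := by
      simp only [map_smul, map_sub]; module
    rw [e, inner_add_left, adjoint_inner_left, inner_smul_left]
    have h1 := norm_projNonneg_sub_sq_le_inner (A a - l) (A b - l)
    rw [sub_sub_sub_cancel_right, ← map_sub] at h1
    have h2 := (sq_nonneg _).trans h1
    have : (0:ℝ) ≤ ε⁻¹ * ⟪projNonneg (A a - l) - projNonneg (A b - l), A (a - b)⟫ := by positivity
    simpa using (hmono a b).trans (le_add_of_nonneg_right this)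
  · have e : M a + adjoint A (ε⁻¹ • projNonneg (A a - l))
        - (M b + adjoint A (ε⁻¹ • projNonneg (A b - l)))
        = (M a - M b) + adjoint A (ε⁻¹ • (projNonneg (A a - l) - projNonneg (A b - l))) := by
      simp only [map_smul, map_sub]; module
    rw [e]
    refine (norm_add_le _ _).trans ?_
    rw [add_mul]
    refine add_le_add (hlip a b) ((le_opNorm _ _).trans ?_)
    rw [mul_assoc]
    gcongr
    rw [norm_smul, Real.norm_of_nonneg (by positivity), mul_assoc]
    gcongr
    refine (norm_projNonneg_sub_le _ _).trans ?_
    rw [sub_sub_sub_cancel_right, ← map_sub]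
    exact le_opNorm _ _

open ContinuousLinearMap in
/-- Existence of a Karush-Kuhn-Tucker point for a strongly monotone Lipschitz operator and affine
constraints satisfying Slater's condition. -/
theorem exists_kkt {M : E → E} {ν L : ℝ} (hν : 0 < ν) (hL : 0 ≤ L)
    (hmono : ∀ a b, ν * ‖a - b‖ ^ 2 ≤ ⟪M a - M b, a - b⟫)
    (hlip : ∀ a b, ‖M a - M b‖ ≤ L * ‖a - b‖) (A : E →L[ℝ] EuclideanSpace ℝ (Fin n))
    (l : EuclideanSpace ℝ (Fin n))
    {a₀ : E} (hslater : ∀ k, (A a₀ - l) k < 0) :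
    ∃ a : E, ∃ lam : EuclideanSpace ℝ (Fin n), (∀ k, (A a - l) k ≤ 0) ∧ (∀ k, 0 ≤ lam k) ∧
      (∀ k, lam k * (A a - l) k = 0) ∧ M a + adjoint A lam = 0 := by
  obtain ⟨κ, hκ, hκg⟩ : ∃ κ : ℝ, 0 < κ ∧ ∀ k, (A a₀ - l) k ≤ -κ := by
    rcases isEmpty_or_nonempty (Fin n) with h | h
    · exact ⟨1, one_pos, fun k => h.elim k⟩
    · obtain ⟨k₀, hk₀⟩ := Finite.exists_max (fun k => (A a₀ - l) k)
      exact ⟨-(A a₀ - l) k₀, by linarith [hslater k₀], fun k => by linarith [hk₀ k]⟩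
  -- Penalized solutions are taken for parameters tending to zero; a KKT point is then extracted by
  -- compactness.
  have hε : ∀ j : ℕ, (0:ℝ) < 1 / (j + 1) := fun j => by positivity
  choose a lam hlam hstat using fun j => exists_penalized hν hL hmono hlip A l (hε j)
  have hnn : ∀ j k, 0 ≤ lam j k := by
    intro j k
    have h := congrArg (fun v : EuclideanSpace ℝ (Fin n) => v k) (hlam j)
    simp only [PiLp.smul_apply, smul_eq_mul, projNonneg_apply] at h
    have : 0 ≤ 1 / ((j:ℝ) + 1) * lam j k := by rw [h]; exact le_max_right _ _
    exact nonneg_of_mul_nonneg_right this (hε j)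
  have hcomp : ∀ j k, lam j k * (A (a j) - l) k = 1 / ((j:ℝ) + 1) * lam j k ^ 2 := by
    intro j k
    have h := congrArg (fun v : EuclideanSpace ℝ (Fin n) => v k) (hlam j)
    simp only [PiLp.smul_apply, smul_eq_mul, projNonneg_apply] at h
    rcases le_total ((A (a j) - l) k) 0 with h' | h'
    · rw [max_eq_right h'] at h
      have : lam j k = 0 := (mul_eq_zero.1 h).resolve_left (hε j).ne'
      simp [this]
    · rw [max_eq_left h'] at h
      rw [← h]; ring
  -- Pairing the stationarity equation with `a j - a₀`: the penalized multiplier pairs nonnegatively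
  -- with `A (a j) - l`, while the Slater slack at `a₀` is at least `κ` in every coordinate. This
  -- bounds `a j` by strong monotonicity, and then the sum of the multipliers.
  have hkey : ∀ j, ⟪M (a j), a j - a₀⟫ ≤ -κ * ∑ k, lam j k := by
    intro j
    have e1 : M (a j) = - adjoint A (lam j) := eq_neg_of_add_eq_zero_left (hstat j)
    have e2 : A (a j - a₀) = (A (a j) - l) - (A a₀ - l) := by rw [map_sub]; abel
    rw [e1, inner_neg_left, adjoint_inner_left, e2, inner_sub_right, euclidean_inner_eq_sum,
      euclidean_inner_eq_sum, neg_sub, ← Finset.sum_sub_distrib, Finset.mul_sum]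
    refine Finset.sum_le_sum fun k _ => ?_
    rw [hcomp]
    have := mul_le_mul_of_nonneg_left (hκg k) (hnn j k)
    have : 0 ≤ 1 / ((j:ℝ) + 1) * lam j k ^ 2 := by positivity
    nlinarith
  have hsum : ∀ j, 0 ≤ ∑ k, lam j k := fun j => Finset.sum_nonneg fun k _ => hnn j k
  have ha : ∀ j, ‖a j - a₀‖ ≤ ‖M a₀‖ / ν := by
    intro j
    rw [le_div_iff₀ hν]
    have h1 := hmono (a j) a₀
    rw [inner_sub_left] at h1
    have h2 := neg_le_of_abs_le (abs_real_inner_le_norm (M a₀) (a j - a₀))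
    have h3 := hkey j
    have h4 := mul_nonneg hκ.le (hsum j)
    by_contra! h
    have : 0 ≤ ‖a j - a₀‖ := norm_nonneg _
    have h5 : 0 < ‖a j - a₀‖ := by
      rcases this.eq_or_lt with h6 | h6
      · rw [← h6, zero_mul] at h; exact absurd h (norm_nonneg _).not_gt
      · exact h6
    nlinarith
  have hlamb : ∀ j, ‖lam j‖ ≤ (‖M a₀‖ + L * (‖M a₀‖ / ν)) * (‖M a₀‖ / ν) / κ := by
    intro j
    have h1 : ‖lam j‖ ≤ ∑ k, lam j k := by
      refine abs_le_of_sq_le_sq' ?_ (hsum j) |>.2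
      rw [EuclideanSpace.real_norm_sq_eq]
      exact Finset.sum_sq_le_sq_sum_of_nonneg fun k _ => hnn j k
    refine h1.trans ?_
    rw [le_div_iff₀ hκ]
    have h2 := hkey j
    have h3 := neg_le_of_abs_le (abs_real_inner_le_norm (M (a j)) (a j - a₀))
    have h4 : ‖M (a j)‖ ≤ ‖M a₀‖ + L * (‖M a₀‖ / ν) := by
      have := norm_le_norm_add_norm_sub' (M (a j)) (M a₀)
      exact this.trans (by gcongr; exact (hlip _ _).trans (by gcongr; exact ha j))
    have h5 : ‖M (a j)‖ * ‖a j - a₀‖ ≤ (‖M a₀‖ + L * (‖M a₀‖ / ν)) * (‖M a₀‖ / ν) := by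
      gcongr; exact ha j
    linarith
  obtain ⟨⟨a', lam'⟩, -, φ, hφ, hlim⟩ := tendsto_subseq_of_bounded
    (s := Metric.closedBall (0 : E × EuclideanSpace ℝ (Fin n))
      (max (‖a₀‖ + ‖M a₀‖ / ν) ((‖M a₀‖ + L * (‖M a₀‖ / ν)) * (‖M a₀‖ / ν) / κ)))
    Metric.isBounded_closedBall (x := fun j => (a j, lam j)) (fun j => by
      rw [mem_closedBall_zero_iff, Prod.norm_def]
      refine max_le_max ?_ (hlamb j)
      exact (norm_le_norm_add_norm_sub' (a j) a₀).trans (by gcongr; exact ha j))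
  have hla : Tendsto (fun j => a (φ j)) atTop (𝓝 a') := (continuous_fst.tendsto _).comp hlim
  have hll : Tendsto (fun j => lam (φ j)) atTop (𝓝 lam') := (continuous_snd.tendsto _).comp hlim
  have hMc : Continuous M := (LipschitzWith.of_dist_le_mul (K := L.toNNReal) fun a b => by
    rw [Real.coe_toNNReal _ hL, dist_eq_norm, dist_eq_norm]; exact hlip a b).continuous
  have hεlim : Tendsto (fun j => 1 / (((φ j : ℕ):ℝ) + 1)) atTop (𝓝 0) :=
    tendsto_one_div_add_atTop_nhds_zero_nat.comp hφ.tendsto_atTop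
  have hg : Tendsto (fun j => A (a (φ j)) - l) atTop (𝓝 (A a' - l)) :=
    ((A.continuous.tendsto _).comp hla).sub_const l
  have happ : ∀ (k : Fin n) {u : ℕ → EuclideanSpace ℝ (Fin n)} {v : EuclideanSpace ℝ (Fin n)},
      Tendsto u atTop (𝓝 v) →
      Tendsto (fun j => u j k) atTop (𝓝 (v k)) := fun k u v h =>
    ((EuclideanSpace.proj (𝕜 := ℝ) k).continuous.tendsto v).comp h
  refine ⟨a', lam', fun k => ?_, fun k => ?_, fun k => ?_, ?_⟩
  · have h1 := happ k ((continuous_projNonneg.tendsto _).comp hg)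
    have h2 := happ k (hεlim.smul hll)
    have h3 := tendsto_nhds_unique h1 (h2.congr fun j => by
      rw [hlam (φ j)]; rfl)
    rw [zero_smul, projNonneg_apply] at h3
    exact max_eq_right_iff.1 h3
  · exact ge_of_tendsto' (happ k hll) fun j => hnn _ _
  · have h1 := (happ k hll).mul (happ k hg)
    have h2 := hεlim.mul ((happ k hll).pow 2)
    have h3 := tendsto_nhds_unique h1 (h2.congr fun j => (hcomp (φ j) k).symm)
    rw [h3, zero_mul]
  · have h1 := ((hMc.tendsto _).comp hla).add (((adjoint A).continuous.tendsto _).comp hll)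
    exact tendsto_nhds_unique h1 (tendsto_const_nhds.congr fun j => (hstat (φ j)).symm)

end KKT

/-! ### Hoffman error bound -/

/-- An error bound of Hoffman type: a non-negative point `x` is close to the polyhedron
`{p ≥ 0 : B p = B p₀}` if `B x` is close to `B p₀`. -/
theorem exists_hoffman {E : Type*} [NormedAddCommGroup E] [NormedSpace ℝ E] {n : ℕ}
    (B : EuclideanSpace ℝ (Fin n) →L[ℝ] E) :
    ∃ H : ℝ, 0 < H ∧ ∀ p₀ x : EuclideanSpace ℝ (Fin n), (∀ k, 0 ≤ p₀ k) → (∀ k, 0 ≤ x k) →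
      ∃ p : EuclideanSpace ℝ (Fin n), (∀ k, 0 ≤ p k) ∧ (∀ k, p₀ k = 0 → x k = 0 → p k = 0) ∧
        B p = B p₀ ∧ ‖x - p‖ ≤ H * ‖B x - B p₀‖ := by
  classical
  -- Vectors whose signs are weakly compatible with the pattern `τ`. There are finitely many
  -- patterns, so one constant per pattern yields a uniform one.
  set cone : (Fin n → SignType) → Set (EuclideanSpace ℝ (Fin n)) := fun τ =>
    {v | ∀ k, 0 ≤ (τ k : ℝ) * v k ∧ (τ k = 0 → v k = 0)} with hcone
  have hclosed : ∀ τ, IsClosed (cone τ) := by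
    intro τ
    simp only [hcone, Set.ofPred_forall, Set.ofPred_and]
    refine isClosed_iInter fun k => IsClosed.inter
      (isClosed_le continuous_const (by fun_prop)) ?_
    by_cases h : τ k = 0
    · simpa [h] using isClosed_eq (by fun_prop) continuous_const
    · simp [h]
  -- On a closed cone that meets the kernel of `B` only at zero, compactness of the unit sphere
  -- bounds `‖v‖` by `‖B v‖`. The condition is kept inside the conclusion so that the constant
  -- exists for every pattern and the maximum can be taken.
  have hbound : ∀ τ, ∃ c : ℝ, 0 < c ∧ ((∀ v ∈ cone τ, B v = 0 → v = 0) →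
      ∀ v ∈ cone τ, ‖v‖ ≤ c * ‖B v‖) := by
    intro τ
    by_cases hτ : ∀ v ∈ cone τ, B v = 0 → v = 0
    swap
    · exact ⟨1, one_pos, fun h => absurd h hτ⟩
    have hK : IsCompact (cone τ ∩ Metric.sphere 0 1) :=
      (isCompact_sphere _ _).inter_left (hclosed τ)
    rcases (cone τ ∩ Metric.sphere 0 1).eq_empty_or_nonempty with he | hne
    · refine ⟨1, one_pos, fun _ v hv => ?_⟩
      by_cases hv0 : v = 0
      · simp [hv0]
      exfalso
      have : ‖v‖⁻¹ • v ∈ cone τ ∩ Metric.sphere 0 1 := by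
        refine ⟨fun k => ⟨?_, fun h => ?_⟩, ?_⟩
        · have := (hv k).1
          simp only [PiLp.smul_apply, smul_eq_mul]
          rw [mul_left_comm]; positivity
        · simp [(hv k).2 h]
        · rw [mem_sphere_zero_iff_norm, norm_smul, norm_inv, norm_norm,
            inv_mul_cancel₀ (norm_ne_zero_iff.2 hv0)]
      rw [he] at this; exact this
    obtain ⟨v₀, hv₀, hmin⟩ := hK.exists_isMinOn hne (f := fun v => ‖B v‖)
      (by fun_prop)
    have hpos : 0 < ‖B v₀‖ := by
      rw [norm_pos_iff]
      intro h
      have := hτ v₀ hv₀.1 h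
      have h1 := hv₀.2
      rw [mem_sphere_zero_iff_norm, this, norm_zero] at h1
      exact zero_ne_one h1
    refine ⟨‖B v₀‖⁻¹, by positivity, fun _ v hv => ?_⟩
    by_cases hv0 : v = 0
    · simp [hv0]
    have hvn : 0 < ‖v‖ := norm_pos_iff.2 hv0
    have hmem : ‖v‖⁻¹ • v ∈ cone τ ∩ Metric.sphere 0 1 := by
      refine ⟨fun k => ⟨?_, fun h => ?_⟩, ?_⟩
      · have := (hv k).1
        simp only [PiLp.smul_apply, smul_eq_mul]
        rw [mul_left_comm]; positivity
      · simp [(hv k).2 h]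
      · rw [mem_sphere_zero_iff_norm, norm_smul, norm_inv, norm_norm,
          inv_mul_cancel₀ hvn.ne']
    have h := hmin hmem
    simp only [Set.mem_ofPred_eq, map_smul, norm_smul, norm_inv, norm_norm] at h
    rw [← div_eq_inv_mul, le_div_iff₀ hvn] at h
    rw [← div_eq_inv_mul, le_div_iff₀ hpos]
    linarith
  choose c hc hcb using hbound
  obtain ⟨τ₀, hτ₀⟩ := Finite.exists_max c
  refine ⟨c τ₀, hc τ₀, fun p₀ x hp₀ hx => ?_⟩
  set S : Set (EuclideanSpace ℝ (Fin n)) := {p | (∀ k, 0 ≤ p k) ∧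
    (∀ k, p₀ k = 0 → x k = 0 → p k = 0) ∧ B p = B p₀} with hS
  have hne : S.Nonempty := ⟨p₀, hp₀, fun k h _ => h, rfl⟩
  set supp : EuclideanSpace ℝ (Fin n) → Finset (Fin n) :=
    fun p => Finset.univ.filter fun k => ¬ x k - p k = 0 with hsupp
  have hmem_supp : ∀ p k, k ∈ supp p ↔ ¬ x k - p k = 0 := fun p k => by simp [hsupp]
  -- The witness is a point of the polyhedron differing from `x` in as few coordinates as possible.
  -- Minimality forces the sign cone of `x - p` to meet the kernel of `B` trivially.
  obtain ⟨p, hp, hpmin⟩ := (InvImage.wf (fun p => (supp p).card) wellFounded_lt).has_min S hne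
  refine ⟨p, hp.1, hp.2.1, hp.2.2, ?_⟩
  set τ : Fin n → SignType := fun k => SignType.sign (x k - p k) with hτ
  have hmem : x - p ∈ cone τ := by
    intro k
    simp only [hτ, PiLp.sub_apply]
    refine ⟨?_, fun h => sign_eq_zero_iff.1 h⟩
    rw [sign_mul_self]; exact abs_nonneg _
  have htriv : ∀ v ∈ cone τ, B v = 0 → v = 0 := by
    intro v hv hBv
    by_contra hv0
    have hT : (Finset.univ.filter fun k => v k ≠ 0).Nonempty := by
      by_contra hemp
      rw [Finset.not_nonempty_iff_eq_empty, Finset.filter_eq_empty_iff] at hemp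
      exact hv0 (by ext k; simpa using hemp (Finset.mem_univ k))
    have hvx : ∀ k, v k ≠ 0 → 0 < (x k - p k) / v k := by
      intro k hk
      have h1 := hv k
      simp only [hτ] at h1
      rcases lt_trichotomy (x k - p k) 0 with h | h | h
      · rw [sign_neg h] at h1
        have : v k < 0 := lt_of_le_of_ne (by simpa using h1.1) hk
        exact div_pos_of_neg_of_neg h this
      · exact absurd (h1.2 (by simp [h])) hk
      · rw [sign_pos h] at h1
        have : 0 < v k := lt_of_le_of_ne (by simpa using h1.1) (Ne.symm hk)
        exact div_pos h this
    -- Ratio test: moving from `p` along a kernel direction `v` with the signs of `x - p`, the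
    -- smallest ratio is reached first. No coordinate overshoots `x`, so nonnegativity persists, and
    -- coordinate `k₀` becomes equal to `x k₀`, contradicting minimality.
    obtain ⟨k₀, hk₀, hmin⟩ := Finset.exists_min_image _ (fun k => (x k - p k) / v k) hT
    simp only [Finset.mem_filter, Finset.mem_univ, true_and] at hk₀ hmin
    set s := (x k₀ - p k₀) / v k₀ with hs
    have hs0 : 0 < s := hvx k₀ hk₀
    have hx0 : ∀ k, x k - p k = 0 → v k = 0 := fun k h => (hv k).2 (by simp [hτ, h])
    have hle : ∀ k, 0 ≤ p k + s * v k := by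
      intro k
      by_cases hk : v k = 0
      · simp [hk, hp.1 k]
      rcases lt_or_gt_of_ne hk with h | h
      · have h1 := hmin k hk
        rw [le_div_iff_of_neg h] at h1
        linarith [hx k]
      · have := hp.1 k
        positivity
    have hp'S : p + s • v ∈ S := by
      refine ⟨fun k => by simpa using hle k, fun k h1 h2 => ?_, ?_⟩
      · have := hp.2.1 k h1 h2
        have h3 := hx0 k (by rw [h2, this, sub_zero])
        simp [this, h3]
      · rw [map_add, map_smul, hBv, smul_zero, add_zero, hp.2.2]
    refine hpmin _ hp'S (Finset.card_lt_card ((Finset.ssubset_iff_of_subset fun k => ?_).2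
      ⟨k₀, (hmem_supp _ _).2 fun h => hk₀ (hx0 _ h), ?_⟩))
    · rw [hmem_supp, hmem_supp, PiLp.add_apply, PiLp.smul_apply, smul_eq_mul]
      intro h h'
      exact h (by rw [hx0 k h', mul_zero, add_zero, h'])
    · rw [hmem_supp, PiLp.add_apply, PiLp.smul_apply, smul_eq_mul, hs, div_mul_cancel₀ _ hk₀,
        not_not]
      ring
  have h := hcb τ htriv (x - p) hmem
  rw [map_sub, hp.2.2] at h
  exact h.trans (by gcongr; exact hτ₀ τ)

end GNEP

namespace GNEP

/-! ### Gaussian moments and coordinate reflections -/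

section Gaussian

variable {ι : Type*} [Fintype ι]

theorem integrable_one_add_norm_pow (k : ℕ) :
    Integrable (fun ξ : EuclideanSpace ℝ ι => (1 + ‖ξ‖) ^ k)
      (stdGaussian (EuclideanSpace ℝ ι)) := by
  rcases eq_or_ne k 0 with rfl | hk
  · simp
  have h : MemLp (fun ξ : EuclideanSpace ℝ ι => 1 + ‖ξ‖) k (stdGaussian (EuclideanSpace ℝ ι)) :=
    MemLp.add (f := fun _ => (1 : ℝ)) (memLp_const 1)
      (IsGaussian.memLp_id (stdGaussian (EuclideanSpace ℝ ι)) k (ENNReal.natCast_ne_top k)).norm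
  refine (h.integrable_norm_pow hk).congr (Eventually.of_forall fun ξ => ?_)
  simp only [Real.norm_eq_abs]
  rw [abs_of_nonneg (by positivity)]

/-- A continuous function dominated by a power of `1 + ‖ξ‖` is integrable. -/
theorem integrable_of_norm_le_pow {G : Type*} [NormedAddCommGroup G]
    {f : EuclideanSpace ℝ ι → G} (hf : Continuous f) {c : ℝ} {k : ℕ}
    (hb : ∀ ξ, ‖f ξ‖ ≤ c * (1 + ‖ξ‖) ^ k) : Integrable f (stdGaussian (EuclideanSpace ℝ ι)) :=
  ((integrable_one_add_norm_pow k).const_mul c).mono' hf.aestronglyMeasurable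
    (Eventually.of_forall hb)

theorem integral_inner_mul_inner (v w : EuclideanSpace ℝ ι) :
    ∫ ξ, ⟪v, ξ⟫ * ⟪w, ξ⟫ ∂stdGaussian (EuclideanSpace ℝ ι) = ⟪v, w⟫ := by
  have h := covarianceBilin_apply (IsGaussian.memLp_two_id
    (μ := stdGaussian (EuclideanSpace ℝ ι))) v w
  rw [covarianceBilin_stdGaussian] at h
  simpa [innerSL_apply_apply ℝ] using h.symm

variable [DecidableEq ι]

/-- The reflection changing the sign of the coordinate `p`. -/
noncomputable def flip (p : ι) : EuclideanSpace ℝ ι ≃ₗᵢ[ℝ] EuclideanSpace ℝ ι :=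
  LinearIsometryEquiv.piLpCongrRight 2 fun q =>
    if q = p then LinearIsometryEquiv.neg ℝ else LinearIsometryEquiv.refl ℝ ℝ

theorem flip_apply (p q : ι) (x : EuclideanSpace ℝ ι) :
    flip p x q = if q = p then -x q else x q := by
  rw [flip, LinearIsometryEquiv.piLpCongrRight_apply]
  by_cases h : q = p <;> simp [h]

/-- The reflection in coordinate `p` preserves the standard Gaussian and changes the sign of the
integrand. -/
theorem integral_mul_coord_eq_zero (p : ι) {f : EuclideanSpace ℝ ι → ℝ}
    (hf : ∀ ξ, f (flip p ξ) = f ξ) : ∫ ξ, f ξ * ξ p ∂stdGaussian (EuclideanSpace ℝ ι) = 0 := by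
  have hmp : MeasurePreserving (flip p).toHomeomorph.toMeasurableEquiv
      (stdGaussian (EuclideanSpace ℝ ι)) (stdGaussian (EuclideanSpace ℝ ι)) :=
    ⟨MeasurableEquiv.measurable _, stdGaussian_map (flip p)⟩
  have h := hmp.integral_comp' (fun ξ => f ξ * ξ p)
  have h2 : ∀ ξ, f ((flip p).toHomeomorph.toMeasurableEquiv ξ)
      * ((flip p).toHomeomorph.toMeasurableEquiv ξ) p = -(f ξ * ξ p) := by
    intro ξ
    change f (flip p ξ) * flip p ξ p = _
    rw [hf, flip_apply, if_pos rfl, mul_neg]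
  simp only [h2] at h
  rw [integral_neg] at h
  linarith

theorem integral_inner_mul_coord (v : EuclideanSpace ℝ ι) (p : ι) :
    ∫ ξ, ⟪v, ξ⟫ * ξ p ∂stdGaussian (EuclideanSpace ℝ ι) = v p := by
  have h := integral_inner_mul_inner v (EuclideanSpace.single p 1)
  simpa [EuclideanSpace.inner_single_left, EuclideanSpace.inner_single_right] using h

theorem norm_le_sum_abs {ι : Type*} [Fintype ι] (x : EuclideanSpace ℝ ι) :
    ‖x‖ ≤ ∑ p, |x p| := by
  refine abs_le_of_sq_le_sq' ?_ (Finset.sum_nonneg fun p _ => abs_nonneg _) |>.2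
  rw [EuclideanSpace.real_norm_sq_eq]
  refine le_trans (le_of_eq ?_)
    (Finset.sum_sq_le_sq_sum_of_nonneg (f := fun p => |x p|) fun p _ => abs_nonneg _)
  simp

theorem abs_coord_le_norm {ι : Type*} [Fintype ι] (x : EuclideanSpace ℝ ι) (p : ι) :
    |x p| ≤ ‖x‖ := by simpa using PiLp.norm_apply_le x p

/-- Removing the coordinate `p` of the increment costs the corresponding partial derivative. -/
theorem abs_sub_partial_le {J : EuclideanSpace ℝ ι → ℝ} (hJ : Differentiable ℝ J) {L : ℝ} {p : ι}
    (hL : ∀ a b, |fderiv ℝ J a (EuclideanSpace.single p 1)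
      - fderiv ℝ J b (EuclideanSpace.single p 1)| ≤ L * ‖a - b‖) (x v : EuclideanSpace ℝ ι)
    (hL0 : 0 ≤ L) :
    |J (x + v) - J (x + (v - v p • EuclideanSpace.single p 1))
      - v p * fderiv ℝ J x (EuclideanSpace.single p 1)| ≤ |v p| * (L * ‖v‖) := by
  set e : EuclideanSpace ℝ ι := EuclideanSpace.single p 1 with he
  set w := v - v p • e with hw
  have hwn : ‖w‖ ≤ ‖v‖ := by
    rw [EuclideanSpace.norm_eq, EuclideanSpace.norm_eq]
    refine Real.sqrt_le_sqrt (Finset.sum_le_sum fun q _ => ?_)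
    by_cases hq : q = p
    · subst hq
      simp only [hw, he, PiLp.sub_apply, PiLp.smul_apply, PiLp.single_apply]
      simp only [if_true, smul_eq_mul, mul_one, sub_self, norm_zero]
      nlinarith [norm_nonneg (v q)]
    · simp [hw, he, hq]
  -- Interpolation from `w` to `v`, a segment parallel to coordinate `p`, so only the partial
  -- derivative in direction `p` is differentiated. Along it the increment has norm at most `‖v‖`,
  -- because `‖w‖ ≤ ‖v‖`.
  set f : ℝ → ℝ := fun τ => J (x + (w + τ • (v - w))) - τ * (v p * fderiv ℝ J x e) with hf
  have hvw : v - w = v p • e := by rw [hw]; abel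
  have h := norm_image_sub_le_of_norm_deriv_le_segment_01' (f := f)
    (f' := fun τ => v p * (fderiv ℝ J (x + (w + τ • (v - w))) e - fderiv ℝ J x e))
    (C := |v p| * (L * ‖v‖)) (fun τ _ => ?_) (fun τ hτ => ?_)
  · simp only [hf, one_smul, zero_smul, add_zero, one_mul, zero_mul, sub_zero,
      add_sub_cancel, Real.norm_eq_abs] at h
    convert h using 2
    ring
  · have h1 : HasDerivAt (fun τ : ℝ => x + (w + τ • (v - w))) (v - w) τ := by
      simpa using (((hasDerivAt_id τ).smul_const (v - w)).const_add w).const_add x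
    have h2 := (hJ (x + (w + τ • (v - w)))).hasFDerivAt.comp_hasDerivAt τ h1
    have h3 := h2.sub ((hasDerivAt_id τ).mul_const (v p * fderiv ℝ J x e))
    refine (h3.congr_deriv ?_).hasDerivWithinAt
    rw [hvw, map_smul, smul_eq_mul]; ring
  · rw [Real.norm_eq_abs, abs_mul]
    refine mul_le_mul_of_nonneg_left ((hL _ _).trans ?_) (abs_nonneg _)
    rw [add_sub_cancel_left]
    refine mul_le_mul_of_nonneg_left ?_ hL0
    have e1 : w + τ • (v - w) = (1 - τ) • w + τ • v := by module
    rw [e1]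
    refine (norm_add_le _ _).trans ?_
    rw [norm_smul, norm_smul, Real.norm_of_nonneg hτ.1, Real.norm_of_nonneg (by linarith [hτ.2])]
    nlinarith [hτ.1, hτ.2, mul_le_mul_of_nonneg_left hwn (by linarith [hτ.2] : 0 ≤ 1 - τ)]

end Gaussian

end GNEP

/-! ### Bias of the two-point estimate -/

namespace GNEP

theorem exists_norm_fderiv_le {E : Type*} [NormedAddCommGroup E] [NormedSpace ℝ E] [ProperSpace E]
    {J : E → ℝ} (hJ : ContDiff ℝ 1 J)
    (hO : fderiv ℝ J =O[Bornology.cobounded E] fun x => ‖x‖) :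
    ∃ C : ℝ, 0 ≤ C ∧ ∀ x, ‖fderiv ℝ J x‖ ≤ C * (1 + ‖x‖) := by
  obtain ⟨c, hc, h⟩ := hO.exists_nonneg
  rw [IsBigOWith, ← comap_norm_atTop, eventually_comap, eventually_atTop] at h
  obtain ⟨r, hr⟩ := h
  obtain ⟨c', hc'⟩ := (isCompact_closedBall (0:E) r).exists_bound_of_continuousOn
    (hJ.continuous_fderiv one_ne_zero).continuousOn
  refine ⟨max c c', le_max_of_le_left hc, fun x => ?_⟩
  rcases le_total r ‖x‖ with hx | hx
  · have := hr _ hx x rfl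
    rw [norm_norm] at this
    refine this.trans ?_
    nlinarith [le_max_left c c', norm_nonneg x]
  · have := hc' x (by simpa using hx)
    nlinarith [le_max_right c c', norm_nonneg x, le_max_left c c',
      mul_nonneg (hc.trans (le_max_left c c')) (norm_nonneg x)]

theorem abs_sub_le_of_norm_fderiv_le {E : Type*} [NormedAddCommGroup E] [NormedSpace ℝ E]
    {J : E → ℝ} (hJ : Differentiable ℝ J) {C : ℝ} (hC : 0 ≤ C)
    (hb : ∀ x, ‖fderiv ℝ J x‖ ≤ C * (1 + ‖x‖)) (x v : E) :
    |J (x + v) - J x| ≤ C * (1 + ‖x‖ + ‖v‖) * ‖v‖ := by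
  have h := (convex_closedBall x ‖v‖).norm_image_sub_le_of_norm_fderiv_le (𝕜 := ℝ) (f := J)
    (C := C * (1 + ‖x‖ + ‖v‖)) (x := x) (y := x + v) (fun y _ => hJ y) (fun y hy => ?_)
    (by simp) (by simp)
  · simpa using h
  · refine (hb y).trans (mul_le_mul_of_nonneg_left ?_ hC)
    have : ‖y - x‖ ≤ ‖v‖ := by simpa [dist_eq_norm] using hy
    linarith [norm_le_norm_add_norm_sub' y x]

section Smoothing

variable {ι : Type*} [Fintype ι] [DecidableEq ι]

/-- The Gaussian two-point estimate of a partial derivative is biased by at most `O(σ)`. -/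
theorem abs_integral_twoPoint_sub_le {J : EuclideanSpace ℝ ι → ℝ} (hJ : Differentiable ℝ J)
    {L C : ℝ} {p : ι} (hL0 : 0 ≤ L) (hC : 0 ≤ C)
    (hL : ∀ a b, |fderiv ℝ J a (EuclideanSpace.single p 1)
      - fderiv ℝ J b (EuclideanSpace.single p 1)| ≤ L * ‖a - b‖)
    (hb : ∀ x, ‖fderiv ℝ J x‖ ≤ C * (1 + ‖x‖)) (μ : EuclideanSpace ℝ ι) {σ : ℝ} (hσ : 0 < σ) :
    |∫ ξ, (J (μ + σ • ξ) - J μ) / σ * ξ p ∂stdGaussian (EuclideanSpace ℝ ι)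
      - fderiv ℝ J μ (EuclideanSpace.single p 1)|
      ≤ (L * ∫ ξ, (1 + ‖ξ‖) ^ 3 ∂stdGaussian (EuclideanSpace ℝ ι)) * σ := by
  set ρ := stdGaussian (EuclideanSpace ℝ ι)
  set D := fderiv ℝ J μ (EuclideanSpace.single p 1) with hD
  have hJc := hJ.continuous
  set f : EuclideanSpace ℝ ι → ℝ := fun ξ => (J (μ + σ • ξ) - J μ) / σ * ξ p with hf
  -- The integrand `f` is split as `g ξ_p + D ξ_p² + r`. Here `g` does not see coordinate `p`, so
  -- its term integrates to zero by reflection, and `D ξ_p²` integrates to `D`. The remainder is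
  -- `O(σ)` using only the Lipschitz bound on the partial derivative in direction `p`; Lipschitz
  -- continuity of `M` says nothing about a player's derivatives in the other players' actions.
  set g : EuclideanSpace ℝ ι → ℝ := fun ξ =>
    (J (μ + (σ • ξ - (σ • ξ) p • EuclideanSpace.single p 1)) - J μ) / σ with hg
  set r : EuclideanSpace ℝ ι → ℝ := fun ξ =>
    (J (μ + σ • ξ) - J (μ + (σ • ξ - (σ • ξ) p • EuclideanSpace.single p 1))
      - (σ • ξ) p * D) / σ * ξ p with hr
  have hrb : ∀ ξ, ‖r ξ‖ ≤ (L * σ) * (1 + ‖ξ‖) ^ 3 := by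
    intro ξ
    have h := abs_sub_partial_le hJ hL μ (σ • ξ) hL0
    rw [hr, Real.norm_eq_abs, abs_mul, abs_div, abs_of_pos hσ]
    have h1 := abs_coord_le_norm ξ p
    have hn := norm_nonneg ξ
    have h2 : |(σ • ξ) p| * (L * ‖σ • ξ‖) ≤ (σ * ‖ξ‖) * (L * (σ * ‖ξ‖)) := by
      rw [norm_smul, Real.norm_of_nonneg hσ.le, PiLp.smul_apply, smul_eq_mul, abs_mul,
        abs_of_pos hσ]
      gcongr
    calc _ ≤ (σ * ‖ξ‖) * (L * (σ * ‖ξ‖)) / σ * ‖ξ‖ := by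
          gcongr
          exact h.trans h2
      _ = (L * σ) * ‖ξ‖ ^ 3 := by field_simp
      _ ≤ (L * σ) * (1 + ‖ξ‖) ^ 3 := by gcongr; linarith
  have hri : Integrable r ρ := integrable_of_norm_le_pow (by simp only [hr]; fun_prop) hrb
  have hfi : Integrable f ρ := by
    refine integrable_of_norm_le_pow (k := 3) (c := C * (1 + ‖μ‖ + σ)) (by fun_prop) fun ξ => ?_
    have h := abs_sub_le_of_norm_fderiv_le hJ hC hb μ (σ • ξ)
    rw [norm_smul, Real.norm_of_nonneg hσ.le] at h
    rw [hf, Real.norm_eq_abs, abs_mul, abs_div, abs_of_pos hσ]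
    have h1 := abs_coord_le_norm ξ p
    have hn := norm_nonneg ξ
    have hm := norm_nonneg μ
    calc _ ≤ C * (1 + ‖μ‖ + σ * ‖ξ‖) * (σ * ‖ξ‖) / σ * ‖ξ‖ := by gcongr
      _ = C * ((1 + ‖μ‖ + σ * ‖ξ‖) * ‖ξ‖ * ‖ξ‖) := by field_simp
      _ ≤ C * (((1 + ‖μ‖ + σ) * (1 + ‖ξ‖)) * (1 + ‖ξ‖) * (1 + ‖ξ‖)) := by
          gcongr
          · nlinarith [mul_nonneg hm hn]
          · linarith
          · linarith
      _ = _ := by ring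
  have hsq : Integrable (fun ξ : EuclideanSpace ℝ ι => D * (ξ p * ξ p)) ρ := by
    refine integrable_of_norm_le_pow (k := 2) (c := |D|) (by fun_prop) fun ξ => ?_
    rw [Real.norm_eq_abs, abs_mul, abs_mul, sq]
    have h1 := abs_coord_le_norm ξ p
    gcongr <;> linarith
  have h0 : ∫ ξ, g ξ * ξ p ∂ρ = 0 := by
    refine integral_mul_coord_eq_zero p fun ξ => ?_
    have : σ • flip p ξ - (σ • flip p ξ) p • EuclideanSpace.single p (1:ℝ)
        = σ • ξ - (σ • ξ) p • EuclideanSpace.single p (1:ℝ) := by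
      ext q
      by_cases hq : q = p
      · subst hq; simp [flip_apply]
      · simp [flip_apply, hq]
    simp only [hg, this]
  have hdec : ∀ ξ, g ξ * ξ p = f ξ - r ξ - D * (ξ p * ξ p) := by
    intro ξ
    simp only [hf, hg, hr, PiLp.smul_apply, smul_eq_mul]
    field_simp
    ring
  have hcov : ∫ ξ : EuclideanSpace ℝ ι, ξ p * ξ p ∂ρ = 1 := by
    have := integral_inner_mul_coord (EuclideanSpace.single p (1:ℝ)) p
    simpa [EuclideanSpace.inner_single_left] using this
  simp only [hdec] at h0
  have hfr : Integrable (fun ξ => f ξ - r ξ) ρ := hfi.sub hri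
  rw [integral_sub hfr hsq, integral_sub hfi hri, integral_const_mul, hcov,
    mul_one] at h0
  have e : ∫ ξ, f ξ ∂ρ - D = ∫ ξ, r ξ ∂ρ := by linarith
  rw [e, ← Real.norm_eq_abs]
  refine (norm_integral_le_of_norm_le ((integrable_one_add_norm_pow 3).const_mul (L * σ))
    (Eventually.of_forall hrb)).trans (le_of_eq ?_)
  rw [integral_const_mul]; ring

end Smoothing

/-! ### The estimate of the extended pseudo-gradient -/

namespace Game

variable {N n : ℕ} {d : Fin N → ℕ} (Γ : Game N n d)

/-- The linear part of the constraint function. -/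
noncomputable def linearPart : Joint d →L[ℝ] EuclideanSpace ℝ (Fin n) :=
  (Matrix.toLpLin 2 2 Γ.K).toContinuousLinearMap

theorem constraint_eq (a : Joint d) : Γ.constraint a = Γ.linearPart a - Γ.l := by
  ext k; rfl

theorem constraint_add (a v : Joint d) :
    Γ.constraint (a + v) = Γ.constraint a + Γ.linearPart v := by
  rw [constraint_eq, constraint_eq, map_add]; abel

theorem pseudoGradient_apply (a : Joint d) (p : Σ i : Fin N, Fin (d i)) :
    Γ.pseudoGradient a p = fderiv ℝ (Γ.J p.1) a (EuclideanSpace.single p 1) := rfl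

/-- Since the constraint is affine, the multiplier contributes a term quadratic in `ξ` and free of
`σ`; its Gaussian mean is exactly `A† λ`, so all the bias comes from `J`. -/
theorem estimate_apply {σ : ℝ} (hσ : σ ≠ 0) (μ ξ : Joint d) (lam : EuclideanSpace ℝ (Fin n))
    (p : Σ i : Fin N, Fin (d i)) :
    Γ.estimate σ (μ + σ • ξ) μ lam p = (Γ.J p.1 (μ + σ • ξ) - Γ.J p.1 μ) / σ * ξ p
      + ⟪lam, Γ.linearPart ξ⟫ * ξ p := by
  simp only [estimate, lagrangian, constraint_add, inner_add_right, map_smul,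
    inner_smul_right, PiLp.add_apply, PiLp.smul_apply, smul_eq_mul, add_sub_cancel_left]
  field_simp
  ring

theorem continuous_constraint : Continuous Γ.constraint := by
  have : Γ.constraint = fun a => Γ.linearPart a - Γ.l := funext Γ.constraint_eq
  rw [this]; fun_prop

theorem continuous_estimate (hJ : ∀ i, Continuous (Γ.J i)) (σ : ℝ) :
    Continuous fun x : Joint d × Joint d × EuclideanSpace ℝ (Fin n) =>
      Γ.estimate σ x.1 x.2.1 x.2.2 := by
  have := Γ.continuous_constraint
  unfold estimate lagrangian
  fun_prop

open ContinuousLinearMap in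
/-- Growth and bias of the estimate of the pseudo-gradient of the extended game. -/
theorem exists_estimate_bounds (hdiff : ∀ i, ContDiff ℝ 1 (Γ.J i)) (hgrowth : Γ.HasQuadraticGrowth)
    (hlip : ∃ L : ℝ≥0, LipschitzWith L Γ.pseudoGradient) {B : ℝ} (hB : 0 ≤ B) :
    ∃ C : ℝ, 0 ≤ C ∧ ∀ (σ : ℝ), 0 < σ → σ ≤ B →
      ∀ (μ : Joint d) (lam : EuclideanSpace ℝ (Fin n)),
      (∀ ξ, ‖Γ.estimate σ (μ + σ • ξ) μ lam‖ ≤ C * (1 + ‖μ‖ + ‖lam‖) * (1 + ‖ξ‖) ^ 3) ∧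
      ‖∫ ξ, Γ.estimate σ (μ + σ • ξ) μ lam ∂stdGaussian (Joint d)
        - (Γ.pseudoGradient μ + adjoint Γ.linearPart lam)‖ ≤ C * σ := by
  obtain ⟨L, hL⟩ := hlip
  choose c hc0 hc using fun i => exists_norm_fderiv_le (hdiff i) (hgrowth i).2
  set κ := ∫ ξ, (1 + ‖ξ‖) ^ 3 ∂stdGaussian (Joint d) with hκ
  have hκ0 : 0 ≤ κ := integral_nonneg fun ξ => by positivity
  have hLp : ∀ p : Σ i : Fin N, Fin (d i), ∀ a b,
      |fderiv ℝ (Γ.J p.1) a (EuclideanSpace.single p 1)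
        - fderiv ℝ (Γ.J p.1) b (EuclideanSpace.single p 1)| ≤ L * ‖a - b‖ := by
    intro p a b
    have h1 := abs_coord_le_norm (Γ.pseudoGradient a - Γ.pseudoGradient b) p
    have h2 := hL.norm_sub_le a b
    exact h1.trans h2
  set C₁ : ℝ := ∑ p : Σ i : Fin N, Fin (d i), (c p.1 * (1 + B) + ‖Γ.linearPart‖) with hC₁
  set C₂ : ℝ := ∑ _p : Σ i : Fin N, Fin (d i), L * κ with hC₂
  have hC₁0 : 0 ≤ C₁ := Finset.sum_nonneg fun p _ => by have := hc0 p.1; positivity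
  have hC₂0 : 0 ≤ C₂ := Finset.sum_nonneg fun p _ => by positivity
  refine ⟨C₁ + C₂, by positivity, fun σ hσ hσB μ lam => ?_⟩
  have hcoord : ∀ (p : Σ i : Fin N, Fin (d i)) (ξ : Joint d),
      |Γ.estimate σ (μ + σ • ξ) μ lam p| ≤
        (c p.1 * (1 + B) + ‖Γ.linearPart‖) * (1 + ‖μ‖ + ‖lam‖) * (1 + ‖ξ‖) ^ 3 := by
    intro p ξ
    rw [Γ.estimate_apply hσ.ne', ← add_mul, abs_mul]
    have h := abs_sub_le_of_norm_fderiv_le ((hdiff p.1).differentiable one_ne_zero) (hc0 p.1)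
      (hc p.1) μ (σ • ξ)
    rw [norm_smul, Real.norm_of_nonneg hσ.le] at h
    have h1 := abs_coord_le_norm ξ p
    have hn := norm_nonneg ξ
    have hm := norm_nonneg μ
    have hl := norm_nonneg lam
    have hcp := hc0 p.1
    have hA := norm_nonneg Γ.linearPart
    have h2 : |(Γ.J p.1 (μ + σ • ξ) - Γ.J p.1 μ) / σ|
        ≤ c p.1 * (1 + B) * (1 + ‖μ‖ + ‖lam‖) * (1 + ‖ξ‖) ^ 2 := by
      rw [abs_div, abs_of_pos hσ, div_le_iff₀ hσ]
      refine h.trans ?_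
      have : (1 + ‖μ‖ + σ * ‖ξ‖) ≤ (1 + B) * (1 + ‖μ‖ + ‖lam‖) * (1 + ‖ξ‖) := by
        -- The a priori bound `σ ≤ B` makes the growth constant independent of the iteration.
        have h3 : σ * ‖ξ‖ ≤ B * ‖ξ‖ := by gcongr
        have h4 : (1 + ‖μ‖ + B * ‖ξ‖) ≤ (1 + B) * (1 + ‖μ‖ + 0) * (1 + ‖ξ‖) := by
          have := mul_nonneg hB hn
          have := mul_nonneg hm hn
          have := mul_nonneg hB hm
          have := mul_nonneg this hn
          nlinarith
        refine (by linarith : _ ≤ 1 + ‖μ‖ + B * ‖ξ‖).trans (h4.trans ?_)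
        gcongr
      calc _ ≤ c p.1 * ((1 + B) * (1 + ‖μ‖ + ‖lam‖) * (1 + ‖ξ‖)) * (σ * (1 + ‖ξ‖)) := by
            gcongr; linarith
        _ = _ := by ring
    have h3 : |⟪lam, Γ.linearPart ξ⟫| ≤ ‖Γ.linearPart‖ * (1 + ‖μ‖ + ‖lam‖) * (1 + ‖ξ‖) ^ 2 := by
      refine (abs_real_inner_le_norm _ _).trans ?_
      calc ‖lam‖ * ‖Γ.linearPart ξ‖ ≤ (1 + ‖μ‖ + ‖lam‖) * (‖Γ.linearPart‖ * (1 + ‖ξ‖) ^ 2) := by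
            refine mul_le_mul (by linarith) ((Γ.linearPart.le_opNorm ξ).trans ?_) (norm_nonneg _)
              (by positivity)
            gcongr
            nlinarith
        _ = _ := by ring
    calc _ ≤ (c p.1 * (1 + B) * (1 + ‖μ‖ + ‖lam‖) * (1 + ‖ξ‖) ^ 2
          + ‖Γ.linearPart‖ * (1 + ‖μ‖ + ‖lam‖) * (1 + ‖ξ‖) ^ 2) * (1 + ‖ξ‖) := by
          refine mul_le_mul ((abs_add_le _ _).trans (add_le_add h2 h3)) (by linarith)
            (abs_nonneg _) (by positivity)
      _ = _ := by ring
  constructor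
  · intro ξ
    refine (norm_le_sum_abs _).trans ((Finset.sum_le_sum fun p _ => hcoord p ξ).trans ?_)
    rw [← Finset.sum_mul, ← Finset.sum_mul]
    gcongr
    linarith
  · have hcont : Continuous fun ξ : Joint d => Γ.estimate σ (μ + σ • ξ) μ lam :=
      (Γ.continuous_estimate (fun i => (hdiff i).continuous) σ).comp
        (by fun_prop : Continuous fun ξ : Joint d => (μ + σ • ξ, μ, lam))
    have hint : ∀ p, Integrable (fun ξ => Γ.estimate σ (μ + σ • ξ) μ lam p)
        (stdGaussian (Joint d)) := fun p =>
      integrable_of_norm_le_pow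
        ((by fun_prop : Continuous fun x : Joint d => x p).comp hcont) (hcoord p)
    refine (norm_le_sum_abs _).trans ((Finset.sum_le_sum fun p _ => ?_).trans
      (?_ : ∑ _p : Σ i : Fin N, Fin (d i), L * κ * σ ≤ _))
    · rw [PiLp.sub_apply, eval_integral_piLp hint, PiLp.add_apply, pseudoGradient_apply]
      simp only [Γ.estimate_apply hσ.ne']
      have hi2 : Integrable (fun ξ : Joint d => ⟪lam, Γ.linearPart ξ⟫ * ξ p)
          (stdGaussian (Joint d)) := by
        refine integrable_of_norm_le_pow (k := 2) (c := ‖lam‖ * ‖Γ.linearPart‖) (by fun_prop)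
          fun ξ => ?_
        rw [Real.norm_eq_abs, abs_mul]
        calc _ ≤ (‖lam‖ * (‖Γ.linearPart‖ * ‖ξ‖)) * ‖ξ‖ := by
              gcongr
              · refine (abs_real_inner_le_norm _ _).trans ?_
                gcongr
                exact Γ.linearPart.le_opNorm ξ
              · exact abs_coord_le_norm ξ p
          _ = ‖lam‖ * ‖Γ.linearPart‖ * ‖ξ‖ ^ 2 := by ring
          _ ≤ _ := by gcongr; linarith [norm_nonneg ξ]
      have hi1 : Integrable (fun ξ : Joint d =>
          (Γ.J p.1 (μ + σ • ξ) - Γ.J p.1 μ) / σ * ξ p) (stdGaussian (Joint d)) := by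
        refine ((hint p).sub hi2).congr (Eventually.of_forall fun ξ => ?_)
        simp only [Pi.sub_apply, Γ.estimate_apply hσ.ne', add_sub_cancel_right]
      have h4 : ∫ ξ : Joint d, ⟪lam, Γ.linearPart ξ⟫ * ξ p ∂stdGaussian (Joint d)
          = adjoint Γ.linearPart lam p := by
        rw [← integral_inner_mul_coord (adjoint Γ.linearPart lam) p]
        simp only [adjoint_inner_left]
      rw [integral_add hi1 hi2, h4, add_sub_add_right_eq_sub]
      exact abs_integral_twoPoint_sub_le ((hdiff p.1).differentiable one_ne_zero) L.2 (hc0 p.1)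
        (hLp p) (hc p.1) μ hσ
    · rw [← Finset.sum_mul]
      gcongr
      linarith

end Game

end GNEP

/-! ### One-step expansions of the squared distance -/

namespace GNEP

/-- Second order expansion of the squared distance after a noisy step, integrated over the noise. -/
theorem integral_noisy_step_le {X E F : Type*} [MeasurableSpace X] {ρ : Measure X}
    [IsProbabilityMeasure ρ] [NormedAddCommGroup E] [InnerProductSpace ℝ E] [CompleteSpace E]
    [NormedAddCommGroup F] [InnerProductSpace ℝ F] [CompleteSpace F]
    {m : X → E} {v : X → F} {b : X → ℝ} (hm : AEStronglyMeasurable m ρ)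
    (hv : AEStronglyMeasurable v ρ) (hb1 : Integrable b ρ) (hb : Integrable (fun x => b x ^ 2) ρ)
    {c : ℝ} (hmb : ∀ x, ‖m x‖ ≤ c * b x) (hvb : ∀ x, ‖v x‖ ≤ c * b x) (θ : E) (y : F) (γ : ℝ) :
    Integrable (fun x => ‖θ - γ • m x‖ ^ 2 + ‖y + γ • v x‖ ^ 2) ρ ∧
    ∫ x, (‖θ - γ • m x‖ ^ 2 + ‖y + γ • v x‖ ^ 2) ∂ρ ≤
      ‖θ‖ ^ 2 + ‖y‖ ^ 2 + γ * (2 * ⟪y, ∫ x, v x ∂ρ⟫ - 2 * ⟪θ, ∫ x, m x ∂ρ⟫)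
        + 2 * c ^ 2 * (∫ x, b x ^ 2 ∂ρ) * γ ^ 2 := by
  have hmi : Integrable m ρ := (hb1.const_mul c).mono' hm (Eventually.of_forall hmb)
  have hvi : Integrable v ρ := (hb1.const_mul c).mono' hv (Eventually.of_forall hvb)
  have hsq : ∀ x, ‖m x‖ ^ 2 + ‖v x‖ ^ 2 ≤ 2 * c ^ 2 * b x ^ 2 := by
    intro x
    have h1 := pow_le_pow_left₀ (norm_nonneg _) (hmb x) 2
    have h2 := pow_le_pow_left₀ (norm_nonneg _) (hvb x) 2
    nlinarith
  have hsqi : Integrable (fun x => ‖m x‖ ^ 2 + ‖v x‖ ^ 2) ρ := by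
    refine (hb.const_mul (2 * c ^ 2)).mono' ((hm.norm.pow 2).add (hv.norm.pow 2))
      (Eventually.of_forall fun x => ?_)
    rw [Real.norm_of_nonneg (by positivity)]
    exact hsq x
  have hi1 : Integrable (fun x => ⟪y, v x⟫) ρ := hvi.const_inner y
  have hi2 : Integrable (fun x => ⟪θ, m x⟫) ρ := hmi.const_inner θ
  have hexp : ∀ x, ‖θ - γ • m x‖ ^ 2 + ‖y + γ • v x‖ ^ 2 =
      (‖θ‖ ^ 2 + ‖y‖ ^ 2) + ((2 * γ) * ⟪y, v x⟫ - (2 * γ) * ⟪θ, m x⟫)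
        + γ ^ 2 * (‖m x‖ ^ 2 + ‖v x‖ ^ 2) := by
    intro x
    rw [norm_sub_sq_real, norm_add_sq_real, inner_smul_right, inner_smul_right, norm_smul,
      norm_smul, mul_pow, mul_pow, Real.norm_eq_abs, sq_abs]
    ring
  have hi3 : Integrable (fun x => (2 * γ) * ⟪y, v x⟫ - (2 * γ) * ⟪θ, m x⟫) ρ :=
    (hi1.const_mul _).sub (hi2.const_mul _)
  have hi4 : Integrable (fun x => (‖θ‖ ^ 2 + ‖y‖ ^ 2)
      + ((2 * γ) * ⟪y, v x⟫ - (2 * γ) * ⟪θ, m x⟫)) ρ := (integrable_const _).add hi3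
  have hi5 := hsqi.const_mul (γ ^ 2)
  simp only [hexp]
  refine ⟨hi4.add hi5, ?_⟩
  rw [integral_add hi4 hi5, integral_add (integrable_const _) hi3,
    integral_sub (hi1.const_mul _) (hi2.const_mul _), integral_const_mul, integral_const_mul,
    integral_const_mul, integral_inner hvi, integral_inner hmi]
  have h := integral_mono hsqi (hb.const_mul (2 * c ^ 2)) hsq
  rw [integral_const_mul] at h
  have h2 := mul_le_mul_of_nonneg_left h (sq_nonneg γ)
  simp only [integral_const, probReal_univ, one_smul]
  linarith

/-- Second order expansion of powers of the positive part. -/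
theorem exists_posPart_pow_le (k : ℕ) : ∃ K : ℝ, 0 ≤ K ∧ ∀ y δ : ℝ, 0 ≤ y →
    max (y + δ) 0 ^ (k + 2) ≤ y ^ (k + 2) + (k + 2) * y ^ (k + 1) * δ
      + K * (δ ^ 2 * y ^ k + |δ| ^ (k + 2)) := by
  -- The case `y + δ ≥ 0`, by induction: multiplying the expansion of order `k + 2` by `y + δ`
  -- creates only the new term `(k + 2) y^(k+1) δ²`, and `y + δ ≤ 2 max y |δ|` controls the old
  -- remainder.
  have hmain : ∀ k : ℕ, ∃ K : ℝ, 0 ≤ K ∧ ∀ y δ : ℝ, 0 ≤ y → 0 ≤ y + δ →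
      (y + δ) ^ (k + 2) ≤ y ^ (k + 2) + (k + 2) * y ^ (k + 1) * δ
        + K * (δ ^ 2 * max y |δ| ^ k) := by
    intro k
    induction k with
    | zero => exact ⟨1, zero_le_one, fun y δ _ _ => by norm_num; nlinarith⟩
    | succ k ih =>
      obtain ⟨K, hK, h⟩ := ih
      refine ⟨(k + 2) + 2 * K, by positivity, fun y δ hy hyδ => ?_⟩
      set Q := max y |δ| with hQ
      have hyQ : y ≤ Q := le_max_left _ _
      have hQ0 : 0 ≤ Q := hy.trans hyQ
      have h1 := mul_le_mul_of_nonneg_left (h y δ hy hyδ) hyδ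
      have h2 : y + δ ≤ 2 * Q := by
        have := le_max_right y |δ|
        linarith [le_abs_self δ]
      have h3 : (y + δ) * (K * (δ ^ 2 * Q ^ k)) ≤ (2 * Q) * (K * (δ ^ 2 * Q ^ k)) := by gcongr
      have h4 : y ^ (k + 1) ≤ Q ^ (k + 1) := by gcongr
      have h5 : δ ^ 2 * ((k + 2) * y ^ (k + 1)) ≤ δ ^ 2 * ((k + 2) * Q ^ (k + 1)) := by gcongr
      push_cast
      calc (y + δ) ^ (k + 1 + 2) = (y + δ) * (y + δ) ^ (k + 2) := by ring
        _ ≤ _ := h1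
        _ = y ^ (k + 1 + 2) + (k + 1 + 2) * y ^ (k + 1 + 1) * δ
            + δ ^ 2 * ((k + 2) * y ^ (k + 1)) + (y + δ) * (K * (δ ^ 2 * Q ^ k)) := by ring
        _ ≤ y ^ (k + 1 + 2) + (k + 1 + 2) * y ^ (k + 1 + 1) * δ
            + δ ^ 2 * ((k + 2) * Q ^ (k + 1)) + (2 * Q) * (K * (δ ^ 2 * Q ^ k)) := by gcongr
        _ = _ := by ring
  obtain ⟨K, hK, h⟩ := hmain k
  -- The extra `k + 2` serves the truncated case `y + δ ≤ 0`: there `y ≤ |δ|`, so the negative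
  -- linear term is at most `(k + 2) |δ|^(k+2)` in absolute value.
  refine ⟨K + (k + 2), by positivity, fun y δ hy => ?_⟩
  have hpow : δ ^ 2 * max y |δ| ^ k ≤ δ ^ 2 * y ^ k + |δ| ^ (k + 2) := by
    have e : |δ| ^ (k + 2) = δ ^ 2 * |δ| ^ k := by rw [pow_add, sq_abs, mul_comm]
    rw [e]
    have : (0:ℝ) ≤ δ ^ 2 * y ^ k := by positivity
    have : (0:ℝ) ≤ δ ^ 2 * |δ| ^ k := by positivity
    rcases max_choice y |δ| with hc | hc <;> rw [hc] <;> linarith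
  have hT : 0 ≤ δ ^ 2 * y ^ k + |δ| ^ (k + 2) := by positivity
  rcases le_total 0 (y + δ) with hs | hs
  · rw [max_eq_left hs]
    have h1 := h y δ hy hs
    have h2 := mul_le_mul_of_nonneg_left hpow hK
    have h3 : 0 ≤ ((k:ℝ) + 2) * (δ ^ 2 * y ^ k + |δ| ^ (k + 2)) := by positivity
    linarith
  · rw [max_eq_right hs, zero_pow (by omega)]
    have hδ : |δ| = -δ := abs_of_nonpos (by linarith)
    have h1 : y ^ (k + 1) * |δ| ≤ |δ| ^ (k + 2) := by
      rw [pow_succ |δ| (k + 1)]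
      gcongr
      linarith
    have h2 : 0 ≤ δ ^ 2 * y ^ k := by positivity
    have h3 : 0 ≤ y ^ (k + 2) := by positivity
    have h4 : ((k:ℝ) + 2) * (y ^ (k + 1) * |δ|) ≤ (k + 2) * (δ ^ 2 * y ^ k + |δ| ^ (k + 2)) := by
      gcongr; linarith
    have h5 : 0 ≤ K * (δ ^ 2 * y ^ k + |δ| ^ (k + 2)) := by positivity
    rw [hδ] at h4
    rw [hδ] at h5 ⊢
    nlinarith

namespace Game

variable {N n : ℕ} {d : Fin N → ℕ}

/-- A Karush-Kuhn-Tucker point of a game together with the constants used in the analysis of the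
payoff-based algorithm. -/
structure Setup (Γ : Game N n d) where
  (B ν L C : ℝ)
  a : Joint d
  p₀ : EuclideanSpace ℝ (Fin n)
  B_pos : 0 < B
  ν_pos : 0 < ν
  L_nonneg : 0 ≤ L
  C_nonneg : 0 ≤ C
  mono : ∀ x y, ν * ‖x - y‖ ^ 2 ≤ ⟪Γ.pseudoGradient x - Γ.pseudoGradient y, x - y⟫
  lip : ∀ x y, ‖Γ.pseudoGradient x - Γ.pseudoGradient y‖ ≤ L * ‖x - y‖
  feas : ∀ k, Γ.constraint a k ≤ 0
  p₀_nonneg : ∀ k, 0 ≤ p₀ k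
  compl : ∀ k, p₀ k * Γ.constraint a k = 0
  stat : Γ.pseudoGradient a + ContinuousLinearMap.adjoint Γ.linearPart p₀ = 0
  cont : ∀ i, Continuous (Γ.J i)
  est_le : ∀ σ, 0 < σ → σ ≤ B → ∀ (μ : Joint d) (lam : EuclideanSpace ℝ (Fin n)) (ξ : Joint d),
    ‖Γ.estimate σ (μ + σ • ξ) μ lam‖ ≤ C * (1 + ‖μ‖ + ‖lam‖) * (1 + ‖ξ‖) ^ 3
  bias_le : ∀ σ, 0 < σ → σ ≤ B → ∀ (μ : Joint d) (lam : EuclideanSpace ℝ (Fin n)),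
    ‖∫ ξ, Γ.estimate σ (μ + σ • ξ) μ lam ∂stdGaussian (Joint d)
      - (Γ.pseudoGradient μ + ContinuousLinearMap.adjoint Γ.linearPart lam)‖ ≤ C * σ

namespace Setup

variable {Γ : Game N n d} (S : Setup Γ)

open ContinuousLinearMap

/-- The parameters of a single iteration. -/
structure Admissible (γ ε σ : ℝ) : Prop where
  γ_pos : 0 < γ
  γ_le : γ ≤ S.B
  ε_pos : 0 < ε
  ε_le : ε ≤ S.B
  σ_pos : 0 < σ
  σ_le : σ ≤ S.B

/-- The multipliers associated with the equilibrium. -/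
def multipliers : Set (EuclideanSpace ℝ (Fin n)) :=
  {p | (∀ k, 0 ≤ p k) ∧ (∀ k, Γ.constraint S.a k ≠ 0 → p k = 0) ∧
    adjoint Γ.linearPart p = adjoint Γ.linearPart S.p₀}

theorem p₀_mem : S.p₀ ∈ S.multipliers :=
  ⟨S.p₀_nonneg, fun k h => (mul_eq_zero.1 (S.compl k)).resolve_right h, rfl⟩

theorem inner_multiplier {p : EuclideanSpace ℝ (Fin n)} (hp : p ∈ S.multipliers) :
    ⟪p, Γ.constraint S.a⟫ = 0 := by
  rw [euclidean_inner_eq_sum]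
  refine Finset.sum_eq_zero fun k _ => ?_
  by_cases h : Γ.constraint S.a k = 0
  · rw [h, mul_zero]
  · rw [hp.2.1 k h, zero_mul]

theorem adjoint_multiplier {p : EuclideanSpace ℝ (Fin n)} (hp : p ∈ S.multipliers) :
    adjoint Γ.linearPart p = -Γ.pseudoGradient S.a := by
  rw [hp.2.2]; exact eq_neg_of_add_eq_zero_right S.stat

/-- The size of a state. -/
noncomputable def size (z : Joint d × EuclideanSpace ℝ (Fin n)) : ℝ :=
  1 + ‖z.1 - S.a‖ ^ 2 + ‖z.2‖ ^ 2

theorem one_le_size (z : Joint d × EuclideanSpace ℝ (Fin n)) : 1 ≤ S.size z := by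
  rw [size]; nlinarith [sq_nonneg ‖z.1 - S.a‖, sq_nonneg ‖z.2‖]

/-- The direction in which the dual variable moves. -/
noncomputable def dualDir (_S : Setup Γ) (ε σ : ℝ) (z : Joint d × EuclideanSpace ℝ (Fin n))
    (ξ : Joint d) : EuclideanSpace ℝ (Fin n) :=
  Γ.constraint (z.1 + σ • ξ) - ε • z.2

/-- The direction in which the mean action moves. -/
noncomputable def primalDir (_S : Setup Γ) (σ : ℝ) (z : Joint d × EuclideanSpace ℝ (Fin n))
    (ξ : Joint d) : Joint d :=
  Γ.estimate σ (z.1 + σ • ξ) z.1 z.2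

theorem step_eq (γ ε σ : ℝ) (z : Joint d × EuclideanSpace ℝ (Fin n)) (ξ : Joint d) :
    Γ.step γ ε σ (z.1 + σ • ξ) z
      = (z.1 - γ • S.primalDir σ z ξ, projNonneg (z.2 + γ • S.dualDir ε σ z ξ)) := by
  rw [step, primalDir, dualDir]
  congr 2
  module

theorem continuous_primalDir (σ : ℝ) (z : Joint d × EuclideanSpace ℝ (Fin n)) :
    Continuous (S.primalDir σ z) :=
  (Γ.continuous_estimate S.cont σ).comp
    (by fun_prop : Continuous fun ξ : Joint d => (z.1 + σ • ξ, z.1, z.2))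

theorem continuous_dualDir (ε σ : ℝ) (z : Joint d × EuclideanSpace ℝ (Fin n)) :
    Continuous (S.dualDir ε σ z) := by
  have := Γ.continuous_constraint
  unfold dualDir; fun_prop

theorem dualDir_eq (ε σ : ℝ) (z : Joint d × EuclideanSpace ℝ (Fin n)) (ξ : Joint d) :
    S.dualDir ε σ z ξ = Γ.constraint S.a + Γ.linearPart (z.1 - S.a) + σ • Γ.linearPart ξ
      - ε • z.2 := by
  have : Γ.constraint z.1 = Γ.constraint S.a + Γ.linearPart (z.1 - S.a) := by
    rw [← constraint_add, add_sub_cancel]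
  rw [dualDir, constraint_add, this, map_smul]

/-- Both directions grow at most linearly in the state, that is like `√(size z)`, times a polynomial
in `‖ξ‖`. Second-order terms of a step are therefore `O(γ² size z)` in mean. -/
theorem exists_noise_bound : ∃ C₁ : ℝ, 0 ≤ C₁ ∧ ∀ γ ε σ, S.Admissible γ ε σ → ∀ z ξ,
    ‖S.primalDir σ z ξ‖ ≤ C₁ * √(S.size z) * (1 + ‖ξ‖) ^ 3 ∧
    ‖S.dualDir ε σ z ξ‖ ≤ C₁ * √(S.size z) * (1 + ‖ξ‖) ^ 3 := by
  have hC := S.C_nonneg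
  have hB := S.B_pos
  refine ⟨S.C * (3 + ‖S.a‖) + (‖Γ.constraint S.a‖ + ‖Γ.linearPart‖ * (1 + S.B) + S.B),
    by positivity, fun γ ε σ h z ξ => ?_⟩
  set T := √(S.size z) with hT
  have hT2 : T ^ 2 = S.size z := Real.sq_sqrt (by linarith [S.one_le_size z])
  have hT0 : 0 ≤ T := Real.sqrt_nonneg _
  have hn := norm_nonneg ξ
  have h1 : 1 ≤ T := by
    rw [hT, Real.one_le_sqrt]; exact S.one_le_size z
  have h2 : ‖z.1 - S.a‖ ≤ T := by
    refine Real.le_sqrt_of_sq_le ?_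
    rw [size]; nlinarith [sq_nonneg ‖z.2‖]
  have h3 : ‖z.2‖ ≤ T := by
    refine Real.le_sqrt_of_sq_le ?_
    rw [size]; nlinarith [sq_nonneg ‖z.1 - S.a‖]
  have h4 : (1:ℝ) ≤ (1 + ‖ξ‖) ^ 3 := one_le_pow₀ (by linarith)
  have h5 : ‖ξ‖ ≤ (1 + ‖ξ‖) ^ 3 := by
    calc ‖ξ‖ ≤ (1 + ‖ξ‖) ^ 1 := by linarith
      _ ≤ _ := pow_le_pow_right₀ (by linarith) (by norm_num)
  constructor
  · refine (S.est_le σ h.σ_pos h.σ_le z.1 z.2 ξ).trans ?_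
    have h6 : 1 + ‖z.1‖ + ‖z.2‖ ≤ (3 + ‖S.a‖) * T := by
      have := norm_le_norm_add_norm_sub' z.1 S.a
      nlinarith [norm_nonneg S.a]
    have h7 : S.C * (1 + ‖z.1‖ + ‖z.2‖) ≤ S.C * (3 + ‖S.a‖) * T := by
      rw [mul_assoc]; gcongr
    have h8 : 0 ≤ (‖Γ.constraint S.a‖ + ‖Γ.linearPart‖ * (1 + S.B) + S.B) * T := by positivity
    refine mul_le_mul_of_nonneg_right ?_ (by positivity)
    linarith
  · rw [S.dualDir_eq]
    have e1 : ‖Γ.linearPart (z.1 - S.a)‖ ≤ ‖Γ.linearPart‖ * T :=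
      (Γ.linearPart.le_opNorm _).trans (by gcongr)
    have e2 : ‖σ • Γ.linearPart ξ‖ ≤ S.B * (‖Γ.linearPart‖ * ‖ξ‖) := by
      rw [norm_smul, Real.norm_of_nonneg h.σ_pos.le]
      exact mul_le_mul h.σ_le (Γ.linearPart.le_opNorm _) (norm_nonneg _) hB.le
    have e3 : ‖ε • z.2‖ ≤ S.B * T := by
      rw [norm_smul, Real.norm_of_nonneg h.ε_pos.le]
      exact mul_le_mul h.ε_le h3 (norm_nonneg _) hB.le
    have e4 := norm_sub_le (Γ.constraint S.a + Γ.linearPart (z.1 - S.a) + σ • Γ.linearPart ξ)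
      (ε • z.2)
    have e5 := norm_add₃_le (a := Γ.constraint S.a) (b := Γ.linearPart (z.1 - S.a))
      (c := σ • Γ.linearPart ξ)
    set P := (1 + ‖ξ‖) ^ 3
    have t1 : T ≤ T * P := le_mul_of_one_le_right hT0 h4
    have t2 : 1 ≤ T * P := h1.trans t1
    have t3 : ‖ξ‖ ≤ T * P := h5.trans (le_mul_of_one_le_left (by positivity) h1)
    have t4 : ‖Γ.constraint S.a‖ ≤ ‖Γ.constraint S.a‖ * (T * P) :=
      le_mul_of_one_le_right (norm_nonneg _) t2
    have t5 : ‖Γ.linearPart‖ * T ≤ ‖Γ.linearPart‖ * (T * P) := by gcongr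
    have t6 : S.B * (‖Γ.linearPart‖ * ‖ξ‖) ≤ S.B * (‖Γ.linearPart‖ * (T * P)) := by gcongr
    have t7 : S.B * T ≤ S.B * (T * P) := by gcongr
    have t8 : 0 ≤ S.C * (3 + ‖S.a‖) * (T * P) := by positivity
    linarith

theorem integral_dualDir (ε σ : ℝ) (z : Joint d × EuclideanSpace ℝ (Fin n)) :
    ∫ ξ, S.dualDir ε σ z ξ ∂stdGaussian (Joint d)
      = Γ.constraint S.a + Γ.linearPart (z.1 - S.a) - ε • z.2 := by
  have h : ∀ ξ, S.dualDir ε σ z ξ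
      = (Γ.constraint S.a + Γ.linearPart (z.1 - S.a) - ε • z.2) + (σ • Γ.linearPart) ξ := by
    intro ξ
    rw [dualDir_eq, smul_apply]; abel
  simp only [h]
  have hi : Integrable (fun ξ : Joint d => ξ) (stdGaussian (Joint d)) := IsGaussian.integrable_id
  rw [integral_add (integrable_const _) ((σ • Γ.linearPart).integrable_comp hi),
    (σ • Γ.linearPart).integral_comp_comm hi, integral_id_stdGaussian]
  simp

/-- The squared distance of a state to the pair formed by the equilibrium and `p`, after an
unprojected step. -/
noncomputable def stepEnergy (γ ε σ : ℝ) (p : EuclideanSpace ℝ (Fin n))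
    (z : Joint d × EuclideanSpace ℝ (Fin n)) (ξ : Joint d) : ℝ :=
  ‖(z.1 - S.a) - γ • S.primalDir σ z ξ‖ ^ 2 + ‖(z.2 - p) + γ • S.dualDir ε σ z ξ‖ ^ 2

/-- The coupling `⟨A(μ - a*), λ - p⟩` enters the primal and dual parts with opposite signs and
cancels. It is stated for every multiplier `p` because the coarse estimate uses the fixed `p₀` and
the fine one the multiplier nearest to `λ`. -/
theorem exists_stepEnergy_bound : ∃ C₂ : ℝ, 0 ≤ C₂ ∧ ∀ γ ε σ, S.Admissible γ ε σ →
    ∀ p ∈ S.multipliers, ∀ z,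
    Integrable (S.stepEnergy γ ε σ p z) (stdGaussian (Joint d)) ∧
    ∫ ξ, S.stepEnergy γ ε σ p z ξ ∂stdGaussian (Joint d) ≤
      ‖z.1 - S.a‖ ^ 2 + ‖z.2 - p‖ ^ 2
        + γ * (-2 * S.ν * ‖z.1 - S.a‖ ^ 2 + 2 * S.C * σ * ‖z.1 - S.a‖
          + 2 * ⟪z.2, Γ.constraint S.a⟫ - 2 * ε * ⟪z.2 - p, z.2⟫)
        + C₂ * γ ^ 2 * S.size z := by
  obtain ⟨C₁, hC₁, hb⟩ := S.exists_noise_bound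
  set κ := ∫ ξ, ((1 + ‖ξ‖) ^ 3) ^ 2 ∂stdGaussian (Joint d) with hκ
  have hκ0 : 0 ≤ κ := integral_nonneg fun ξ => by positivity
  refine ⟨2 * C₁ ^ 2 * κ, by positivity, fun γ ε σ h p hp z => ?_⟩
  have key := integral_noisy_step_le (ρ := stdGaussian (Joint d)) (m := S.primalDir σ z)
    (v := S.dualDir ε σ z) (b := fun ξ => (1 + ‖ξ‖) ^ 3) (c := C₁ * √(S.size z))
    (S.continuous_primalDir σ z).aestronglyMeasurable
    (S.continuous_dualDir ε σ z).aestronglyMeasurable (integrable_one_add_norm_pow 3)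
    (by simpa only [← pow_mul] using integrable_one_add_norm_pow (3 * 2))
    (fun ξ => (hb γ ε σ h z ξ).1) (fun ξ => (hb γ ε σ h z ξ).2) (z.1 - S.a) (z.2 - p) γ
  refine ⟨key.1, key.2.trans ?_⟩
  rw [S.integral_dualDir]
  set mb := ∫ ξ, S.primalDir σ z ξ ∂stdGaussian (Joint d) with hmb
  have hbias : ‖mb - (Γ.pseudoGradient z.1 + adjoint Γ.linearPart z.2)‖ ≤ S.C * σ :=
    S.bias_le σ h.σ_pos h.σ_le z.1 z.2
  set θ := z.1 - S.a with hθ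
  -- Bias, monotone part and coupling are separated; stationarity replaces `A† p` by `-M(a*)`.
  have e0 : mb = (mb - (Γ.pseudoGradient z.1 + adjoint Γ.linearPart z.2))
      + (Γ.pseudoGradient z.1 - Γ.pseudoGradient S.a) + adjoint Γ.linearPart (z.2 - p) := by
    rw [map_sub, S.adjoint_multiplier hp]; abel
  have e1 : -⟪θ, mb⟫ ≤ S.C * σ * ‖θ‖ - S.ν * ‖θ‖ ^ 2 - ⟪Γ.linearPart θ, z.2 - p⟫ := by
    rw [e0, inner_add_right, inner_add_right, adjoint_inner_right]
    have h1 := neg_le_of_abs_le (abs_real_inner_le_norm θ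
      (mb - (Γ.pseudoGradient z.1 + adjoint Γ.linearPart z.2)))
    have h2 := S.mono z.1 S.a
    rw [real_inner_comm] at h2
    have h3 := mul_le_mul_of_nonneg_left hbias (norm_nonneg θ)
    linarith
  have e2 : ⟪z.2 - p, Γ.constraint S.a + Γ.linearPart θ - ε • z.2⟫
      = ⟪z.2, Γ.constraint S.a⟫ + ⟪Γ.linearPart θ, z.2 - p⟫ - ε * ⟪z.2 - p, z.2⟫ := by
    rw [inner_sub_right, inner_add_right, inner_smul_right, inner_sub_left z.2 p
      (Γ.constraint S.a), S.inner_multiplier hp, sub_zero, real_inner_comm (Γ.linearPart θ)]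
  have e3 : 2 * (C₁ * √(S.size z)) ^ 2 * κ * γ ^ 2 = 2 * C₁ ^ 2 * κ * γ ^ 2 * S.size z := by
    rw [mul_pow, Real.sq_sqrt (by linarith [S.one_le_size z])]; ring
  rw [e2, e3]
  have e4 := mul_le_mul_of_nonneg_left e1 h.γ_pos.le
  nlinarith

theorem inner_constraint_nonpos {lam : EuclideanSpace ℝ (Fin n)} (h : ∀ k, 0 ≤ lam k) :
    ⟪lam, Γ.constraint S.a⟫ ≤ 0 := by
  rw [euclidean_inner_eq_sum]
  exact Finset.sum_nonpos fun k _ => mul_nonpos_of_nonneg_of_nonpos (h k) (S.feas k)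

theorem norm_step_le (γ ε σ : ℝ) {p : EuclideanSpace ℝ (Fin n)} (hp : ∀ k, 0 ≤ p k)
    (z : Joint d × EuclideanSpace ℝ (Fin n)) (ξ : Joint d) :
    ‖(Γ.step γ ε σ (z.1 + σ • ξ) z).1 - S.a‖ ^ 2 + ‖(Γ.step γ ε σ (z.1 + σ • ξ) z).2 - p‖ ^ 2
      ≤ S.stepEnergy γ ε σ p z ξ := by
  rw [S.step_eq, stepEnergy]
  simp only
  have h := norm_projNonneg_sub_le_of_nonneg (z.2 + γ • S.dualDir ε σ z ξ) hp
  rw [add_sub_right_comm] at h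
  rw [sub_right_comm]
  gcongr

end Setup

end Game

end GNEP

/-! ### Moments of the excess: the coarse estimate -/

namespace GNEP

theorem one_add_pow_le {y : ℝ} (hy : 0 ≤ y) (m : ℕ) : (1 + y) ^ m ≤ 2 ^ m * (1 + y ^ m) := by
  have h0 : 0 ≤ y ^ m := by positivity
  rcases le_total y 1 with h | h
  · calc (1 + y) ^ m ≤ 2 ^ m := by gcongr; linarith
      _ ≤ _ := le_mul_of_one_le_right (by positivity) (by linarith)
  · calc (1 + y) ^ m ≤ (2 * y) ^ m := by gcongr; linarith
      _ = 2 ^ m * y ^ m := mul_pow _ _ _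
      _ ≤ _ := by gcongr; linarith

theorem pow_le_one_add_pow {y : ℝ} (hy : 0 ≤ y) {j m : ℕ} (hjm : j ≤ m) :
    y ^ j ≤ 1 + y ^ m := by
  have h0 : 0 ≤ y ^ m := by positivity
  rcases le_total y 1 with h | h
  · linarith [pow_le_one₀ (n := j) hy h]
  · linarith [pow_le_pow_right₀ h hjm]

namespace Game.Setup

variable {N n : ℕ} {d : Fin N → ℕ} {Γ : Game N n d} (S : Setup Γ)

/-- The squared distance to the reference point of the primal-dual space. -/
noncomputable def energy (z : Joint d × EuclideanSpace ℝ (Fin n)) : ℝ :=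
  ‖z.1 - S.a‖ ^ 2 + ‖z.2 - S.p₀‖ ^ 2

/-- The excess of the energy over a threshold. -/
noncomputable def excess (z : Joint d × EuclideanSpace ℝ (Fin n)) : ℝ :=
  max (S.energy z - (‖S.p₀‖ ^ 2 + 2)) 0

theorem excess_nonneg (z : Joint d × EuclideanSpace ℝ (Fin n)) : 0 ≤ S.excess z :=
  le_max_right _ _

theorem energy_le (z : Joint d × EuclideanSpace ℝ (Fin n)) :
    S.energy z ≤ S.excess z + (‖S.p₀‖ ^ 2 + 2) := by
  linarith [le_max_left (S.energy z - (‖S.p₀‖ ^ 2 + 2)) 0, show S.excess z =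
    max (S.energy z - (‖S.p₀‖ ^ 2 + 2)) 0 from rfl]

theorem continuous_energy : Continuous S.energy := by unfold energy; fun_prop

theorem continuous_excess : Continuous S.excess := by
  have := S.continuous_energy
  unfold excess; fun_prop

theorem norm_sub_sq_le (x y : EuclideanSpace ℝ (Fin n)) :
    ‖x‖ ^ 2 ≤ 2 * ‖x - y‖ ^ 2 + 2 * ‖y‖ ^ 2 := by
  have h := norm_le_norm_add_norm_sub' x y
  nlinarith [norm_nonneg x, norm_nonneg y, norm_nonneg (x - y), sq_nonneg (‖y‖ - ‖x - y‖)]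

theorem size_le (z : Joint d × EuclideanSpace ℝ (Fin n)) :
    S.size z ≤ (5 + 4 * ‖S.p₀‖ ^ 2) * (1 + S.excess z) := by
  have h1 := norm_sub_sq_le z.2 S.p₀
  have h2 := S.energy_le z
  have h3 := S.excess_nonneg z
  rw [energy] at h2
  rw [size]
  nlinarith [sq_nonneg ‖z.1 - S.a‖, mul_nonneg (sq_nonneg ‖S.p₀‖) h3]

theorem abs_norm_sub_smul_sq_sub_le {E : Type*} [NormedAddCommGroup E] [InnerProductSpace ℝ E]
    (θ m : E) (γ : ℝ) (hγ : 0 ≤ γ) :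
    |‖θ + γ • m‖ ^ 2 - ‖θ‖ ^ 2| ≤ γ * (2 * ‖θ‖ * ‖m‖ + γ * ‖m‖ ^ 2) := by
  rw [norm_add_sq_real, inner_smul_right, norm_smul, mul_pow, Real.norm_eq_abs, sq_abs]
  have h := abs_le.1 (abs_real_inner_le_norm θ m)
  have h1 := mul_le_mul_of_nonneg_left h.1 hγ
  have h2 := mul_le_mul_of_nonneg_left h.2 hγ
  have h3 := mul_nonneg (mul_nonneg hγ hγ) (sq_nonneg ‖m‖)
  rw [abs_le]
  constructor <;> nlinarith

/-- A pointwise first-order bound, cruder than the mean drift. It controls the quadratic and higher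
terms in the expansion of powers of the excess. -/
theorem exists_increment_bound : ∃ C₃ : ℝ, 0 ≤ C₃ ∧ ∀ γ ε σ, S.Admissible γ ε σ → ∀ z ξ,
    |S.stepEnergy γ ε σ S.p₀ z ξ - S.energy z|
      ≤ C₃ * γ * (1 + S.excess z) * ((1 + ‖ξ‖) ^ 3) ^ 2 := by
  obtain ⟨C₁, hC₁, hb⟩ := S.exists_noise_bound
  have hB := S.B_pos
  refine ⟨(2 * C₁ * (2 + ‖S.p₀‖) + 2 * S.B * C₁ ^ 2) * (5 + 4 * ‖S.p₀‖ ^ 2), by positivity,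
    fun γ ε σ h z ξ => ?_⟩
  obtain ⟨h1, h2⟩ := hb γ ε σ h z ξ
  have hγ := h.γ_pos
  set P := (1 + ‖ξ‖) ^ 3 with hP
  have hP1 : 1 ≤ P := one_le_pow₀ (by linarith [norm_nonneg ξ])
  set T := √(S.size z) with hT
  have hT2 : T ^ 2 = S.size z := Real.sq_sqrt (by linarith [S.one_le_size z])
  have hT0 : 0 ≤ T := Real.sqrt_nonneg _
  have hT1 : 1 ≤ T := by rw [hT, Real.one_le_sqrt]; exact S.one_le_size z
  have hθ : ‖z.1 - S.a‖ ≤ T := by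
    refine Real.le_sqrt_of_sq_le ?_
    rw [size]; nlinarith [sq_nonneg ‖z.2‖]
  have hl : ‖z.2‖ ≤ T := by
    refine Real.le_sqrt_of_sq_le ?_
    rw [size]; nlinarith [sq_nonneg ‖z.1 - S.a‖]
  have hp : ‖z.2 - S.p₀‖ ≤ (1 + ‖S.p₀‖) * T := by
    refine (norm_sub_le _ _).trans ?_
    nlinarith [norm_nonneg S.p₀]
  have a1 := abs_norm_sub_smul_sq_sub_le (z.1 - S.a) (-S.primalDir σ z ξ) γ hγ.le
  have a2 := abs_norm_sub_smul_sq_sub_le (z.2 - S.p₀) (S.dualDir ε σ z ξ) γ hγ.le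
  rw [smul_neg, ← sub_eq_add_neg, norm_neg] at a1
  have b1 : 2 * ‖z.1 - S.a‖ * ‖S.primalDir σ z ξ‖ + γ * ‖S.primalDir σ z ξ‖ ^ 2
      ≤ (2 * C₁ + S.B * C₁ ^ 2) * (T * P) ^ 2 := by
    calc _ ≤ 2 * T * (C₁ * T * P) + S.B * (C₁ * T * P) ^ 2 := by
          gcongr
          exact h.γ_le
      _ = 2 * C₁ * (T ^ 2 * P) + S.B * C₁ ^ 2 * (T * P) ^ 2 := by ring
      _ ≤ 2 * C₁ * (T ^ 2 * P ^ 2) + S.B * C₁ ^ 2 * (T * P) ^ 2 := by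
          gcongr
          exact le_self_pow₀ hP1 two_ne_zero
      _ = _ := by ring
  have b2 : 2 * ‖z.2 - S.p₀‖ * ‖S.dualDir ε σ z ξ‖ + γ * ‖S.dualDir ε σ z ξ‖ ^ 2
      ≤ (2 * C₁ * (1 + ‖S.p₀‖) + S.B * C₁ ^ 2) * (T * P) ^ 2 := by
    calc _ ≤ 2 * ((1 + ‖S.p₀‖) * T) * (C₁ * T * P) + S.B * (C₁ * T * P) ^ 2 := by
          gcongr
          exact h.γ_le
      _ = 2 * C₁ * (1 + ‖S.p₀‖) * (T ^ 2 * P) + S.B * C₁ ^ 2 * (T * P) ^ 2 := by ring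
      _ ≤ 2 * C₁ * (1 + ‖S.p₀‖) * (T ^ 2 * P ^ 2) + S.B * C₁ ^ 2 * (T * P) ^ 2 := by
          gcongr
          exact le_self_pow₀ hP1 two_ne_zero
      _ = _ := by ring
  have e1 : S.stepEnergy γ ε σ S.p₀ z ξ - S.energy z
      = (‖z.1 - S.a - γ • S.primalDir σ z ξ‖ ^ 2 - ‖z.1 - S.a‖ ^ 2)
        + (‖z.2 - S.p₀ + γ • S.dualDir ε σ z ξ‖ ^ 2 - ‖z.2 - S.p₀‖ ^ 2) := by
    rw [stepEnergy, energy]; ring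
  rw [e1]
  refine (abs_add_le _ _).trans ((add_le_add a1 a2).trans ?_)
  calc _ ≤ γ * ((2 * C₁ + S.B * C₁ ^ 2) * (T * P) ^ 2)
        + γ * ((2 * C₁ * (1 + ‖S.p₀‖) + S.B * C₁ ^ 2) * (T * P) ^ 2) := by gcongr
    _ = (2 * C₁ * (2 + ‖S.p₀‖) + 2 * S.B * C₁ ^ 2) * γ * P ^ 2 * S.size z := by rw [← hT2]; ring
    _ ≤ (2 * C₁ * (2 + ‖S.p₀‖) + 2 * S.B * C₁ ^ 2) * γ * P ^ 2
        * ((5 + 4 * ‖S.p₀‖ ^ 2) * (1 + S.excess z)) := by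
        gcongr
        exact S.size_le z
    _ = _ := by ring

theorem excess_step_le (γ ε σ : ℝ) (z : Joint d × EuclideanSpace ℝ (Fin n)) (ξ : Joint d) :
    S.excess (Γ.step γ ε σ (z.1 + σ • ξ) z)
      ≤ max (S.excess z + (S.stepEnergy γ ε σ S.p₀ z ξ - S.energy z)) 0 := by
  have h := S.norm_step_le γ ε σ S.p₀_nonneg z ξ
  have h2 := S.energy_le z
  rw [excess]
  refine max_le_max ?_ le_rfl
  rw [energy]
  linarith

theorem continuous_step (S : Setup Γ) (γ ε σ : ℝ) (z : Joint d × EuclideanSpace ℝ (Fin n)) :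
    Continuous fun ξ : Joint d => Γ.step γ ε σ (z.1 + σ • ξ) z := by
  have h1 := S.continuous_primalDir σ z
  have h2 := S.continuous_dualDir ε σ z
  have h3 := continuous_projNonneg (n := n)
  simp only [S.step_eq]
  fun_prop

/-- Expansion of the moments of the excess after one iteration. -/
theorem exists_excess_pow_step (k : ℕ) : ∃ K : ℝ, 0 ≤ K ∧ ∀ γ ε σ, S.Admissible γ ε σ → ∀ z,
    Integrable (fun ξ => S.excess (Γ.step γ ε σ (z.1 + σ • ξ) z) ^ (k + 2))
      (stdGaussian (Joint d)) ∧
    ∫ ξ, S.excess (Γ.step γ ε σ (z.1 + σ • ξ) z) ^ (k + 2) ∂stdGaussian (Joint d) ≤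
      S.excess z ^ (k + 2) + (k + 2) * S.excess z ^ (k + 1) *
        (∫ ξ, S.stepEnergy γ ε σ S.p₀ z ξ ∂stdGaussian (Joint d) - S.energy z)
        + K * γ ^ 2 * (S.excess z ^ k + S.excess z ^ (k + 2)) + K * γ ^ (k + 2) := by
  obtain ⟨C₃, hC₃, hinc⟩ := S.exists_increment_bound
  obtain ⟨C₂, hC₂, hE⟩ := S.exists_stepEnergy_bound
  obtain ⟨K₀, hK₀, hpow⟩ := exists_posPart_pow_le k
  have hB := S.B_pos
  set κ₁ := ∫ ξ, (1 + ‖ξ‖) ^ 12 ∂stdGaussian (Joint d) with hκ₁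
  set κ₂ := ∫ ξ, (1 + ‖ξ‖) ^ (6 * (k + 2)) ∂stdGaussian (Joint d) with hκ₂
  have hκ₁0 : 0 ≤ κ₁ := integral_nonneg fun ξ => by positivity
  have hκ₂0 : 0 ≤ κ₂ := integral_nonneg fun ξ => by positivity
  set K₁ := K₀ * C₃ ^ 2 * κ₁ * 2 with hK₁
  set K₂ := K₀ * C₃ ^ (k + 2) * κ₂ * 2 ^ (k + 2) with hK₂
  have hK₁0 : 0 ≤ K₁ := by positivity
  have hK₂0 : 0 ≤ K₂ := by positivity
  refine ⟨K₁ + K₂ * (1 + S.B ^ k), by positivity, fun γ ε σ h z => ?_⟩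
  have hγ := h.γ_pos
  set y := S.excess z with hy
  have hy0 : 0 ≤ y := S.excess_nonneg z
  set δ : Joint d → ℝ := fun ξ => S.stepEnergy γ ε σ S.p₀ z ξ - S.energy z with hδ
  have hδi : Integrable δ (stdGaussian (Joint d)) :=
    (hE γ ε σ h S.p₀ S.p₀_mem z).1.sub (integrable_const _)
  have hδI : ∫ ξ, δ ξ ∂stdGaussian (Joint d)
      = ∫ ξ, S.stepEnergy γ ε σ S.p₀ z ξ ∂stdGaussian (Joint d) - S.energy z := by
    rw [hδ, integral_sub (hE γ ε σ h S.p₀ S.p₀_mem z).1 (integrable_const _)]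
    simp
  set A₁ := K₀ * (C₃ * γ * (1 + y)) ^ 2 * y ^ k with hA₁
  set A₂ := K₀ * (C₃ * γ * (1 + y)) ^ (k + 2) with hA₂
  set G : Joint d → ℝ := fun ξ => (y ^ (k + 2) + (k + 2) * y ^ (k + 1) * δ ξ)
    + (A₁ * (1 + ‖ξ‖) ^ 12 + A₂ * (1 + ‖ξ‖) ^ (6 * (k + 2))) with hG
  have hGi1 : Integrable (fun ξ => y ^ (k + 2) + (k + 2) * y ^ (k + 1) * δ ξ)
      (stdGaussian (Joint d)) := (integrable_const _).add (hδi.const_mul _)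
  have hGi2 : Integrable (fun ξ : Joint d => A₁ * (1 + ‖ξ‖) ^ 12
      + A₂ * (1 + ‖ξ‖) ^ (6 * (k + 2))) (stdGaussian (Joint d)) :=
    ((integrable_one_add_norm_pow 12).const_mul A₁).add
      ((integrable_one_add_norm_pow _).const_mul A₂)
  have hGi : Integrable G (stdGaussian (Joint d)) := hGi1.add hGi2
  have hle : ∀ ξ, S.excess (Γ.step γ ε σ (z.1 + σ • ξ) z) ^ (k + 2) ≤ G ξ := by
    intro ξ
    have h1 := pow_le_pow_left₀ (S.excess_nonneg _) (S.excess_step_le γ ε σ z ξ) (k + 2)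
    have h2 := hpow y (δ ξ) hy0
    have h3 : |δ ξ| ≤ C₃ * γ * (1 + y) * ((1 + ‖ξ‖) ^ 3) ^ 2 := hinc γ ε σ h z ξ
    have h4 : δ ξ ^ 2 ≤ (C₃ * γ * (1 + y) * ((1 + ‖ξ‖) ^ 3) ^ 2) ^ 2 := by
      rw [← sq_abs]; gcongr
    have h5 : |δ ξ| ^ (k + 2) ≤ (C₃ * γ * (1 + y) * ((1 + ‖ξ‖) ^ 3) ^ 2) ^ (k + 2) := by gcongr
    refine h1.trans (h2.trans ?_)
    have h6 : K₀ * (δ ξ ^ 2 * y ^ k + |δ ξ| ^ (k + 2))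
        ≤ K₀ * ((C₃ * γ * (1 + y) * ((1 + ‖ξ‖) ^ 3) ^ 2) ^ 2 * y ^ k
          + (C₃ * γ * (1 + y) * ((1 + ‖ξ‖) ^ 3) ^ 2) ^ (k + 2)) := by gcongr
    have h7 : (((1 + ‖ξ‖) ^ 3) ^ 2) ^ 2 = (1 + ‖ξ‖) ^ 12 := by rw [← pow_mul, ← pow_mul]
    have h8 : (((1 + ‖ξ‖) ^ 3) ^ 2) ^ (k + 2) = (1 + ‖ξ‖) ^ (6 * (k + 2)) := by
      rw [← pow_mul, ← pow_mul]; ring_nf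
    rw [mul_pow _ (((1 + ‖ξ‖) ^ 3) ^ 2), mul_pow _ (((1 + ‖ξ‖) ^ 3) ^ 2), h7, h8] at h6
    simp only [hG, hA₁, hA₂]
    linarith
  have hint : Integrable (fun ξ => S.excess (Γ.step γ ε σ (z.1 + σ • ξ) z) ^ (k + 2))
      (stdGaussian (Joint d)) := by
    refine hGi.mono' (((S.continuous_excess.comp (S.continuous_step γ ε σ z)).pow
      _).aestronglyMeasurable) (Eventually.of_forall fun ξ => ?_)
    rw [Real.norm_of_nonneg (pow_nonneg (S.excess_nonneg _) _)]
    exact hle ξ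
  refine ⟨hint, (integral_mono hint hGi hle).trans ?_⟩
  rw [hG, integral_add hGi1 hGi2, integral_add (integrable_const _) (hδi.const_mul _),
    integral_add ((integrable_one_add_norm_pow 12).const_mul A₁)
      ((integrable_one_add_norm_pow _).const_mul A₂), integral_const_mul, integral_const_mul,
    integral_const_mul, hδI, ← hκ₁, ← hκ₂]
  simp only [integral_const, probReal_univ, one_smul]
  have f1 : A₁ * κ₁ ≤ K₁ * γ ^ 2 * (y ^ k + y ^ (k + 2)) := by
    have : (1 + y) ^ 2 * y ^ k ≤ 2 * (y ^ k + y ^ (k + 2)) := by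
      have : (1 + y) ^ 2 ≤ 2 * (1 + y ^ 2) := by nlinarith [sq_nonneg (y - 1)]
      calc (1 + y) ^ 2 * y ^ k ≤ 2 * (1 + y ^ 2) * y ^ k := by gcongr
        _ = _ := by ring
    calc A₁ * κ₁ = K₀ * C₃ ^ 2 * κ₁ * γ ^ 2 * ((1 + y) ^ 2 * y ^ k) := by rw [hA₁]; ring
      _ ≤ K₀ * C₃ ^ 2 * κ₁ * γ ^ 2 * (2 * (y ^ k + y ^ (k + 2))) := by gcongr
      _ = _ := by rw [hK₁]; ring
  have f2 : A₂ * κ₂ ≤ K₂ * γ ^ (k + 2) + K₂ * S.B ^ k * γ ^ 2 * y ^ (k + 2) := by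
    calc A₂ * κ₂ = K₀ * C₃ ^ (k + 2) * κ₂ * γ ^ (k + 2) * (1 + y) ^ (k + 2) := by
          rw [hA₂, mul_pow, mul_pow]; ring
      _ ≤ K₀ * C₃ ^ (k + 2) * κ₂ * γ ^ (k + 2) * (2 ^ (k + 2) * (1 + y ^ (k + 2))) := by
          gcongr
          exact one_add_pow_le hy0 _
      _ = K₂ * γ ^ (k + 2) + K₂ * (γ ^ k * γ ^ 2) * y ^ (k + 2) := by rw [hK₂]; ring
      _ ≤ K₂ * γ ^ (k + 2) + K₂ * (S.B ^ k * γ ^ 2) * y ^ (k + 2) := by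
          gcongr
          exact h.γ_le
      _ = _ := by ring
  have g1 : 0 ≤ K₂ * γ ^ 2 * (y ^ k + y ^ (k + 2)) := by positivity
  have g2 : 0 ≤ K₂ * S.B ^ k * γ ^ 2 * y ^ k := by positivity
  have g3 : 0 ≤ K₁ * γ ^ (k + 2) := by positivity
  have g4 : 0 ≤ K₂ * S.B ^ k * γ ^ (k + 2) := by positivity
  nlinarith

/-- Needs no smallness of the parameters, unlike the contraction below, and so yields integrability
of the moments at every time, early iterations included. -/
theorem exists_excess_pow_crude (k : ℕ) : ∃ K : ℝ, 0 ≤ K ∧ ∀ γ ε σ, S.Admissible γ ε σ → ∀ z,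
    ∫ ξ, S.excess (Γ.step γ ε σ (z.1 + σ • ξ) z) ^ (k + 2) ∂stdGaussian (Joint d) ≤
      K * (1 + S.excess z ^ (k + 2)) := by
  obtain ⟨C₃, hC₃, hinc⟩ := S.exists_increment_bound
  obtain ⟨C₂, hC₂, hE⟩ := S.exists_stepEnergy_bound
  obtain ⟨K, hK, h⟩ := S.exists_excess_pow_step k
  have hB := S.B_pos
  set κ := ∫ ξ, ((1 + ‖ξ‖) ^ 3) ^ 2 ∂stdGaussian (Joint d) with hκ
  have hκ0 : 0 ≤ κ := integral_nonneg fun ξ => by positivity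
  refine ⟨1 + (k + 2) * (C₃ * S.B * κ * 2) + K * S.B ^ 2 * 2 + K * S.B ^ (k + 2), by positivity,
    fun γ ε σ hadm z => (h γ ε σ hadm z).2.trans ?_⟩
  have hγ := hadm.γ_pos
  have hγB := hadm.γ_le
  set y := S.excess z with hy
  have hy0 : 0 ≤ y := S.excess_nonneg z
  have hi := (hE γ ε σ hadm S.p₀ S.p₀_mem z).1
  have e1 : ∫ ξ, S.stepEnergy γ ε σ S.p₀ z ξ ∂stdGaussian (Joint d) - S.energy z
      ≤ C₃ * S.B * κ * (1 + y) := by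
    have hci : Integrable (fun ξ : Joint d => C₃ * γ * (1 + y) * ((1 + ‖ξ‖) ^ 3) ^ 2)
        (stdGaussian (Joint d)) := by
      simp only [← pow_mul]
      exact (integrable_one_add_norm_pow _).const_mul _
    have := integral_mono (hi.sub (integrable_const (S.energy z))) hci
      (fun ξ => (le_abs_self _).trans (hinc γ ε σ hadm z ξ))
    rw [integral_const_mul, ← hκ] at this
    simp only [Pi.sub_apply] at this
    rw [integral_sub hi (integrable_const _)] at this
    simp only [integral_const, probReal_univ, one_smul] at this
    refine this.trans ?_
    calc C₃ * γ * (1 + y) * κ = C₃ * κ * (1 + y) * γ := by ring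
      _ ≤ C₃ * κ * (1 + y) * S.B := by gcongr
      _ = _ := by ring
  set D := ∫ ξ, S.stepEnergy γ ε σ S.p₀ z ξ ∂stdGaussian (Joint d) - S.energy z
  have y0 : 0 ≤ y ^ (k + 2) := by positivity
  have y1 : y ^ (k + 1) * (1 + y) ≤ 2 * (1 + y ^ (k + 2)) := by
    have := pow_le_one_add_pow hy0 (show k + 1 ≤ k + 2 by omega)
    have e : y ^ (k + 1) * (1 + y) = y ^ (k + 1) + y ^ (k + 2) := by ring
    linarith
  have y2 : y ^ k + y ^ (k + 2) ≤ 2 * (1 + y ^ (k + 2)) := by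
    have := pow_le_one_add_pow hy0 (show k ≤ k + 2 by omega)
    linarith
  have s1 : ((k:ℝ) + 2) * y ^ (k + 1) * D
      ≤ (k + 2) * (C₃ * S.B * κ * 2) * (1 + y ^ (k + 2)) := by
    calc ((k:ℝ) + 2) * y ^ (k + 1) * D ≤ (k + 2) * y ^ (k + 1) * (C₃ * S.B * κ * (1 + y)) := by
          gcongr
      _ = (k + 2) * (C₃ * S.B * κ) * (y ^ (k + 1) * (1 + y)) := by ring
      _ ≤ (k + 2) * (C₃ * S.B * κ) * (2 * (1 + y ^ (k + 2))) := by gcongr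
      _ = _ := by ring
  have s2 : K * γ ^ 2 * (y ^ k + y ^ (k + 2)) ≤ K * S.B ^ 2 * 2 * (1 + y ^ (k + 2)) := by
    calc K * γ ^ 2 * (y ^ k + y ^ (k + 2)) ≤ K * S.B ^ 2 * (2 * (1 + y ^ (k + 2))) := by gcongr
      _ = _ := by ring
  have s3 : K * γ ^ (k + 2) ≤ K * S.B ^ (k + 2) * (1 + y ^ (k + 2)) := by
    calc K * γ ^ (k + 2) ≤ K * S.B ^ (k + 2) := by gcongr
      _ ≤ _ := le_mul_of_one_le_right (by positivity) (by linarith)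
  linarith

/-- For small parameters the energy decreases on average above the threshold. -/
theorem exists_energy_drift : ∃ η : ℝ, 0 < η ∧ ∀ γ ε σ, S.Admissible γ ε σ → ε ≤ η →
    σ ^ 2 ≤ η * ε → γ ≤ η * ε → ∀ z : Joint d × EuclideanSpace ℝ (Fin n), (∀ k, 0 ≤ z.2 k) →
    0 < S.excess z →
    ∫ ξ, S.stepEnergy γ ε σ S.p₀ z ξ ∂stdGaussian (Joint d) - S.energy z
      ≤ -(γ * ε * S.excess z / 2) := by
  obtain ⟨C₂, hC₂, hE⟩ := S.exists_stepEnergy_bound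
  have hν := S.ν_pos
  set c₁ := S.C ^ 2 / S.ν with hc₁
  have hc₁0 : 0 ≤ c₁ := by positivity
  set c₂ := C₂ * (5 + 4 * ‖S.p₀‖ ^ 2) with hc₂
  have hc₂0 : 0 ≤ c₂ := by positivity
  -- The bound by `ν` lets strong monotonicity absorb `ε t²`. The other bound gives `c₁ η ≤ 1` and
  -- `c₂ η ≤ 1/2`, so bias and noise are paid for by the surplus `2` in the threshold and half of
  -- the contraction.
  refine ⟨min S.ν (1 / (c₁ + 2 * c₂ + 1)), by positivity, fun γ ε σ h hε hσ hγ z hz hy => ?_⟩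
  have hγ0 := h.γ_pos
  have hε0 := h.ε_pos
  set η := min S.ν (1 / (c₁ + 2 * c₂ + 1)) with hη
  have hη0 : 0 < η := by positivity
  have hη1 : η * (c₁ + 2 * c₂ + 1) ≤ 1 := by
    rw [← le_div_iff₀ (by positivity)]; exact min_le_right _ _
  have hεν : ε ≤ S.ν := hε.trans (min_le_left _ _)
  have hb := (hE γ ε σ h S.p₀ S.p₀_mem z).2
  set y := S.excess z with hydef
  have hV : S.energy z = y + (‖S.p₀‖ ^ 2 + 2) := by
    have : y = S.energy z - (‖S.p₀‖ ^ 2 + 2) := by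
      rw [hydef, excess] at hy ⊢
      rcases max_choice (S.energy z - (‖S.p₀‖ ^ 2 + 2)) 0 with hc | hc
      · exact hc
      · rw [hc] at hy; exact absurd hy (lt_irrefl _)
    linarith
  have hneg := S.inner_constraint_nonpos hz
  have hsz := S.size_le z
  set t := ‖z.1 - S.a‖ with ht
  have ht0 : 0 ≤ t := norm_nonneg _
  have q1 : 2 * S.C * σ * t ≤ S.ν * t ^ 2 + c₁ * σ ^ 2 := by
    have e : c₁ * S.ν = S.C ^ 2 := by rw [hc₁]; field_simp
    have := sq_nonneg (S.ν * t - S.C * σ)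
    have e' : c₁ * S.ν * σ ^ 2 = S.C ^ 2 * σ ^ 2 := by rw [e]
    have h2 : S.ν * (2 * S.C * σ * t) ≤ S.ν * (S.ν * t ^ 2 + c₁ * σ ^ 2) := by linarith
    exact le_of_mul_le_mul_left h2 hν
  -- Polarization with `-‖λ‖²` dropped. The remaining `‖p₀‖²` is why the threshold contains it.
  have q2 : -2 * ⟪z.2 - S.p₀, z.2⟫ ≤ -‖z.2 - S.p₀‖ ^ 2 + ‖S.p₀‖ ^ 2 := by
    have e : z.2 = (z.2 - S.p₀) + S.p₀ := by abel
    have e2 : ⟪z.2 - S.p₀, z.2⟫ = ‖z.2 - S.p₀‖ ^ 2 + ⟪z.2 - S.p₀, S.p₀⟫ := by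
      conv_lhs => rw [e]
      rw [add_sub_cancel_right, inner_add_right, real_inner_self_eq_norm_sq]
    rw [e2]
    have h3 := norm_add_sq_real (z.2 - S.p₀) S.p₀
    nlinarith [sq_nonneg ‖z.2 - S.p₀ + S.p₀‖]
  have q2' := mul_le_mul_of_nonneg_left q2 hε0.le
  have hsz0 : 0 ≤ S.size z := by linarith [S.one_le_size z]
  have q3 : C₂ * γ * S.size z ≤ c₂ * (η * ε) * (1 + y) := by
    calc C₂ * γ * S.size z ≤ C₂ * (η * ε) * ((5 + 4 * ‖S.p₀‖ ^ 2) * (1 + y)) := by gcongr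
      _ = _ := by rw [hc₂]; ring
  have q4 : c₁ * σ ^ 2 ≤ c₁ * (η * ε) := by gcongr
  have q5 : ε * t ^ 2 ≤ S.ν * t ^ 2 := by gcongr
  have hVe : ‖z.2 - S.p₀‖ ^ 2 = y + (‖S.p₀‖ ^ 2 + 2) - t ^ 2 := by rw [← hV, energy]; ring
  have hbr : -2 * S.ν * t ^ 2 + 2 * S.C * σ * t + 2 * ⟪z.2, Γ.constraint S.a⟫
      - 2 * ε * ⟪z.2 - S.p₀, z.2⟫ + C₂ * γ * S.size z ≤ -(ε * y / 2) := by
    have r1 : -2 * S.ν * t ^ 2 + 2 * S.C * σ * t + 2 * ⟪z.2, Γ.constraint S.a⟫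
      - 2 * ε * ⟪z.2 - S.p₀, z.2⟫ + C₂ * γ * S.size z
        ≤ -(ε * (y + 2)) + c₁ * (η * ε) + c₂ * (η * ε) * (1 + y) := by
      rw [hVe] at q2'
      linarith
    have r2 : c₁ * η ≤ 1 := by linarith [mul_nonneg hη0.le hc₂0]
    have r3 : c₂ * η ≤ 1 / 2 := by linarith [mul_nonneg hη0.le hc₁0]
    have r4 : c₁ * η * ε ≤ 1 * ε := by gcongr
    have r5 : c₂ * η * (ε * (1 + y)) ≤ 1 / 2 * (ε * (1 + y)) := by gcongr
    linarith
  have := mul_le_mul_of_nonneg_left hbr hγ0.le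
  rw [show S.energy z = t ^ 2 + ‖z.2 - S.p₀‖ ^ 2 from rfl]
  linarith

/-- Contraction of the even moments of the excess, for small parameters. -/
theorem exists_excess_pow_contraction (q : ℕ) : ∃ K η : ℝ, 0 ≤ K ∧ 0 < η ∧
    ∀ γ ε σ, S.Admissible γ ε σ → ε ≤ η → σ ^ 2 ≤ η * ε → γ ≤ η * ε →
    ∀ z : Joint d × EuclideanSpace ℝ (Fin n), (∀ k, 0 ≤ z.2 k) →
    ∫ ξ, S.excess (Γ.step γ ε σ (z.1 + σ • ξ) z) ^ (2 * q + 2) ∂stdGaussian (Joint d) ≤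
      (1 - γ * ε / 4) * S.excess z ^ (2 * q + 2) + K * (γ * ε) * (γ / ε) ^ (q + 1) := by
  obtain ⟨K, hK, h⟩ := S.exists_excess_pow_step (2 * q)
  obtain ⟨η, hη, hdr⟩ := S.exists_energy_drift
  have hB := S.B_pos
  refine ⟨8 ^ q * K ^ (q + 1) * 8 + K * S.B ^ (2 * q), min η (1 / (8 * (K + 1))), by positivity,
    by positivity, fun γ ε σ hadm hε hσ hγ z hz => (h γ ε σ hadm z).2.trans ?_⟩
  have hγ0 := hadm.γ_pos
  have hε0 := hadm.ε_pos
  set y := S.excess z with hy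
  have hy0 : 0 ≤ y := S.excess_nonneg z
  have hγ1 : γ ≤ η * ε := hγ.trans (by gcongr; exact min_le_left _ _)
  have hγ2 : 8 * (K + 1) * γ ≤ ε := by
    have : γ ≤ 1 / (8 * (K + 1)) * ε := hγ.trans (by gcongr; exact min_le_right _ _)
    rw [one_div, inv_mul_eq_div, le_div_iff₀ (by positivity)] at this
    linarith
  set D := ∫ ξ, S.stepEnergy γ ε σ S.p₀ z ξ ∂stdGaussian (Joint d) - S.energy z with hD
  -- The drift estimate holds only for positive excess; at zero excess the factor `y^(2q+1)`
  -- vanishes. Of the `2q + 2` copies of the drift a single one suffices.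
  have t1 : ((2 * q : ℕ) + 2 : ℝ) * y ^ (2 * q + 1) * D ≤ -(γ * ε / 2) * y ^ (2 * q + 2) := by
    rcases hy0.eq_or_lt with h0 | h0
    · rw [← h0]; simp
    · have hd := hdr γ ε σ hadm (hε.trans (min_le_left _ _))
        (hσ.trans (by gcongr; exact min_le_left _ _)) hγ1 z hz h0
      have h1 : ((2 * q : ℕ) + 2 : ℝ) * y ^ (2 * q + 1) * D
          ≤ ((2 * q : ℕ) + 2 : ℝ) * y ^ (2 * q + 1) * (-(γ * ε * y / 2)) := by gcongr
      have h2 : (0:ℝ) ≤ ((2 * q : ℕ) + 1 : ℝ) * (γ * ε / 2 * y ^ (2 * q + 2)) := by positivity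
      have e : ((2 * q : ℕ) + 2 : ℝ) * y ^ (2 * q + 1) * (-(γ * ε * y / 2))
        = -(γ * ε / 2) * y ^ (2 * q + 2)
          - ((2 * q : ℕ) + 1 : ℝ) * (γ * ε / 2 * y ^ (2 * q + 2)) := by ring
      linarith
  have t2 : K * γ ^ 2 * y ^ (2 * q + 2) ≤ γ * ε / 8 * y ^ (2 * q + 2) := by
    gcongr
    nlinarith
  set b := K * (γ / ε) with hb
  have hb0 : 0 ≤ b := by positivity
  -- Young's inequality by cases: above the level `y² = 8b` the contraction dominates, below it the
  -- term is a constant. With `b` of order `γ/ε` this constant is the forcing `(γ/ε)^(q+1)`; the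
  -- even exponent avoids half-integer powers of `b`.
  have t3 : b * y ^ (2 * q) ≤ 1 / 8 * y ^ (2 * q + 2) + 8 ^ q * b ^ (q + 1) * 8 := by
    rcases le_total (8 * b) (y ^ 2) with hc | hc
    · have h1 : 8 * b * y ^ (2 * q) ≤ y ^ 2 * y ^ (2 * q) := by gcongr
      have h2 : 0 ≤ 8 ^ q * b ^ (q + 1) * 8 := by positivity
      have e : y ^ (2 * q + 2) = y ^ 2 * y ^ (2 * q) := by ring
      linarith
    · have h1 : b * y ^ (2 * q) ≤ b * (8 * b) ^ q := by
        rw [pow_mul]; gcongr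
      have h2 : 0 ≤ 8 ^ q * b ^ (q + 1) := by positivity
      have h3 : 0 ≤ 1 / 8 * y ^ (2 * q + 2) := by positivity
      have e : b * (8 * b) ^ q = 8 ^ q * b ^ (q + 1) := by rw [mul_pow]; ring
      linarith
  have t4 : K * γ ^ 2 * y ^ (2 * q) ≤ γ * ε / 8 * y ^ (2 * q + 2)
      + 8 ^ q * K ^ (q + 1) * 8 * (γ * ε) * (γ / ε) ^ (q + 1) := by
    have e : K * γ ^ 2 * y ^ (2 * q) = (γ * ε) * (b * y ^ (2 * q)) := by
      rw [hb]; field_simp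
    rw [e]
    have := mul_le_mul_of_nonneg_left t3 (by positivity : 0 ≤ γ * ε)
    rw [hb, mul_pow] at this
    rw [hb]
    linarith
  have t5 : K * γ ^ (2 * q + 2) ≤ K * S.B ^ (2 * q) * (γ * ε) * (γ / ε) ^ (q + 1) := by
    have e : K * γ ^ (2 * q + 2) = K * (γ ^ q * ε ^ q) * ((γ * ε) * (γ / ε) ^ (q + 1)) := by
      rw [div_pow]; field_simp; ring
    rw [e]
    have : γ ^ q * ε ^ q ≤ S.B ^ (2 * q) := by
      rw [two_mul, pow_add]
      gcongr
      · exact hadm.γ_le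
      · exact hadm.ε_le
    calc K * (γ ^ q * ε ^ q) * ((γ * ε) * (γ / ε) ^ (q + 1))
        ≤ K * S.B ^ (2 * q) * ((γ * ε) * (γ / ε) ^ (q + 1)) := by gcongr
      _ = _ := by ring
  linarith

end Game.Setup

end GNEP

/-! ### Lyapunov function with contraction at rate `γ`: the fine estimate -/

namespace GNEP.Game.Setup

variable {N n : ℕ} {d : Fin N → ℕ} {Γ : Game N n d} (S : Setup Γ)

open ContinuousLinearMap

open Classical in
/-- The part of a multiplier that is carried by the constraints active at the equilibrium. -/
noncomputable def active (lam : EuclideanSpace ℝ (Fin n)) : EuclideanSpace ℝ (Fin n) :=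
  WithLp.toLp 2 fun k => if Γ.constraint S.a k = 0 then lam k else 0

theorem active_apply_of_eq {k : Fin n} (h : Γ.constraint S.a k = 0)
    (lam : EuclideanSpace ℝ (Fin n)) : S.active lam k = lam k := by simp [active, h]

theorem active_apply_of_ne {k : Fin n} (h : Γ.constraint S.a k ≠ 0)
    (lam : EuclideanSpace ℝ (Fin n)) : S.active lam k = 0 := by simp [active, h]

theorem active_sub (x y : EuclideanSpace ℝ (Fin n)) :
    S.active (x - y) = S.active x - S.active y := by
  ext k
  by_cases h : Γ.constraint S.a k = 0
  · simp [S.active_apply_of_eq h]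
  · simp [S.active_apply_of_ne h]

theorem norm_active_le_of_le {x y : EuclideanSpace ℝ (Fin n)}
    (hxy : ∀ k, Γ.constraint S.a k = 0 → |x k| ≤ |y k|) : ‖S.active x‖ ≤ ‖y‖ := by
  rw [EuclideanSpace.norm_eq, EuclideanSpace.norm_eq]
  refine Real.sqrt_le_sqrt (Finset.sum_le_sum fun k _ => ?_)
  simp only [Real.norm_eq_abs]
  by_cases h : Γ.constraint S.a k = 0
  · rw [S.active_apply_of_eq h]
    exact pow_le_pow_left₀ (abs_nonneg _) (hxy k h) 2
  · rw [S.active_apply_of_ne h, abs_zero, zero_pow two_ne_zero]; positivity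

theorem norm_active_le (x : EuclideanSpace ℝ (Fin n)) : ‖S.active x‖ ≤ ‖x‖ :=
  S.norm_active_le_of_le fun _ _ => le_rfl

theorem continuous_active : Continuous S.active :=
  (LipschitzWith.of_dist_le_mul (K := 1) fun x y => by
    rw [dist_eq_norm, dist_eq_norm, ← active_sub, NNReal.coe_one, one_mul]
    exact S.norm_active_le _).continuous

theorem active_of_mem {p : EuclideanSpace ℝ (Fin n)} (hp : p ∈ S.multipliers) :
    S.active p = p := by
  ext k
  by_cases h : Γ.constraint S.a k = 0
  · rw [S.active_apply_of_eq h]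
  · rw [S.active_apply_of_ne h, hp.2.1 k h]

/-- The residual of the stationarity condition for the active part of a multiplier. -/
noncomputable def residual (lam : EuclideanSpace ℝ (Fin n)) : Joint d :=
  adjoint Γ.linearPart (S.active lam) + Γ.pseudoGradient S.a

theorem residual_sub (x y : EuclideanSpace ℝ (Fin n)) :
    S.residual x - S.residual y = adjoint Γ.linearPart (S.active (x - y)) := by
  rw [residual, residual, active_sub, map_sub]; abel

theorem residual_of_mem {p : EuclideanSpace ℝ (Fin n)} (hp : p ∈ S.multipliers) :
    S.residual p = 0 := by
  rw [residual, S.active_of_mem hp, S.adjoint_multiplier hp, neg_add_cancel]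

theorem continuous_residual : Continuous S.residual := by
  have := S.continuous_active
  unfold residual; fun_prop

theorem isClosed_multipliers : IsClosed S.multipliers := by
  have e : S.multipliers = (⋂ k, {p | 0 ≤ p k}) ∩ ((⋂ k, {p : EuclideanSpace ℝ (Fin n) |
      Γ.constraint S.a k ≠ 0 → p k = 0}) ∩
      {p | adjoint Γ.linearPart p = adjoint Γ.linearPart S.p₀}) := by
    ext p; simp [multipliers]
  rw [e]
  refine (isClosed_iInter fun k => isClosed_le continuous_const (by fun_prop)).inter
    ((isClosed_iInter fun k => ?_).inter (isClosed_eq (by fun_prop) continuous_const))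
  by_cases h : Γ.constraint S.a k = 0
  · simp [h]
  · simpa [h] using isClosed_eq (by fun_prop) continuous_const

/-- The distance to the set of multipliers. -/
noncomputable def dualDist (lam : EuclideanSpace ℝ (Fin n)) : ℝ :=
  Metric.infDist lam S.multipliers

theorem dualDist_nonneg (lam : EuclideanSpace ℝ (Fin n)) : 0 ≤ S.dualDist lam :=
  Metric.infDist_nonneg

theorem dualDist_le {p : EuclideanSpace ℝ (Fin n)} (hp : p ∈ S.multipliers)
    (lam : EuclideanSpace ℝ (Fin n)) : S.dualDist lam ≤ ‖lam - p‖ := by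
  rw [← dist_eq_norm]; exact Metric.infDist_le_dist_of_mem hp

theorem exists_nearest (lam : EuclideanSpace ℝ (Fin n)) :
    ∃ p ∈ S.multipliers, ‖lam - p‖ = S.dualDist lam := by
  obtain ⟨p, hp, h⟩ := S.isClosed_multipliers.exists_infDist_eq_dist ⟨_, S.p₀_mem⟩ lam
  exact ⟨p, hp, by rw [dualDist, h, dist_eq_norm]⟩

/-- The residual is Lipschitz and vanishes on the multipliers. This makes the cross term of the
Lyapunov function subordinate to the squared distances. -/
theorem norm_residual_le (lam : EuclideanSpace ℝ (Fin n)) :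
    ‖S.residual lam‖ ≤ ‖Γ.linearPart‖ * S.dualDist lam := by
  obtain ⟨p, hp, h⟩ := S.exists_nearest lam
  have e := S.residual_sub lam p
  rw [S.residual_of_mem hp, sub_zero] at e
  rw [e, ← h, ← LinearIsometryEquiv.norm_map adjoint Γ.linearPart]
  refine (le_opNorm _ _).trans ?_
  gcongr
  exact S.norm_active_le _

/-- Hoffman's bound for `A†`, applied to the active part of `λ` and to `p₀`. Both vanish at the
inactive constraints, hence so does the nearby point, which is therefore a multiplier. -/
theorem exists_dualDist_bound : ∃ H : ℝ, 0 < H ∧ ∀ lam : EuclideanSpace ℝ (Fin n),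
    (∀ k, 0 ≤ lam k) → S.dualDist lam ≤ ‖lam - S.active lam‖ + H * ‖S.residual lam‖ := by
  obtain ⟨H, hH, h⟩ := exists_hoffman (adjoint Γ.linearPart)
  refine ⟨H, hH, fun lam hlam => ?_⟩
  have hact : ∀ k, 0 ≤ S.active lam k := by
    intro k
    by_cases hk : Γ.constraint S.a k = 0
    · rw [S.active_apply_of_eq hk]; exact hlam k
    · rw [S.active_apply_of_ne hk]
  obtain ⟨p, hp0, hps, hpA, hpd⟩ := h S.p₀ (S.active lam) S.p₀_nonneg hact
  have hp : p ∈ S.multipliers :=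
    ⟨hp0, fun k hk => hps k (S.p₀_mem.2.1 k hk) (S.active_apply_of_ne hk lam), hpA⟩
  have e : adjoint Γ.linearPart (S.active lam) - adjoint Γ.linearPart S.p₀ = S.residual lam := by
    rw [S.adjoint_multiplier S.p₀_mem, residual, sub_neg_eq_add]
  rw [e] at hpd
  refine (S.dualDist_le hp lam).trans ?_
  have := norm_sub_le_norm_sub_add_norm_sub lam (S.active lam) p
  linarith

/-- The inactive part of the multiplier is controlled by complementary slackness and the excess. -/
theorem exists_inactive_bound : ∃ C : ℝ, 0 < C ∧ ∀ (m : ℕ) (_ : m ≠ 0)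
    (z : Joint d × EuclideanSpace ℝ (Fin n)), (∀ k, 0 ≤ z.2 k) →
    ‖z.2 - S.active z.2‖ ^ 2 ≤ C * (-⟪z.2, Γ.constraint S.a⟫ + S.excess z ^ m) := by
  obtain ⟨κ, hκ, hκg⟩ : ∃ κ : ℝ, 0 < κ ∧ ∀ k, Γ.constraint S.a k ≠ 0 →
      Γ.constraint S.a k ≤ -κ := by
    classical
    rcases (Finset.univ.filter fun k => ¬ Γ.constraint S.a k = 0).eq_empty_or_nonempty with h | h
    · refine ⟨1, one_pos, fun k hk => ?_⟩
      have := Finset.filter_eq_empty_iff.1 h (Finset.mem_univ k)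
      exact absurd hk this
    · obtain ⟨k₀, hk₀, hmax⟩ := Finset.exists_max_image _ (fun k => Γ.constraint S.a k) h
      rw [Finset.mem_filter] at hk₀
      refine ⟨-Γ.constraint S.a k₀, ?_, fun k hk => ?_⟩
      · linarith [lt_of_le_of_ne (S.feas k₀) hk₀.2]
      · rw [neg_neg]
        exact hmax k (Finset.mem_filter.2 ⟨Finset.mem_univ k, hk⟩)
  set R := ‖S.p₀‖ ^ 2 + 3 with hR
  have hR1 : 1 ≤ R := by rw [hR]; nlinarith [sq_nonneg ‖S.p₀‖]
  refine ⟨R * κ⁻¹ + R * (n + 1), by positivity, fun m hm z hz => ?_⟩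
  set y := S.excess z with hy
  have hy0 : 0 ≤ y := S.excess_nonneg z
  have hs := S.inner_constraint_nonpos hz
  have hcoord : ∀ k, (z.2 - S.active z.2) k ^ 2
      ≤ R * κ⁻¹ * -(z.2 k * Γ.constraint S.a k) + R * y ^ m := by
    intro k
    by_cases hk : Γ.constraint S.a k = 0
    · rw [PiLp.sub_apply, S.active_apply_of_eq hk, hk, sub_self]
      have : 0 ≤ R * y ^ m := by positivity
      linarith
    · rw [PiLp.sub_apply, S.active_apply_of_ne hk, sub_zero]
      have h1 : z.2 k ^ 2 ≤ y + (R - 1) := by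
        have h2 : (z.2 - S.p₀) k = z.2 k := by
          rw [PiLp.sub_apply, S.p₀_mem.2.1 k hk, sub_zero]
        have h3 := abs_coord_le_norm (z.2 - S.p₀) k
        rw [h2] at h3
        have h4 := pow_le_pow_left₀ (abs_nonneg _) h3 2
        rw [sq_abs] at h4
        have h5 := S.energy_le z
        rw [energy] at h5
        have := sq_nonneg ‖z.1 - S.a‖
        rw [hR]
        linarith
      have h6 : z.2 k ≤ κ⁻¹ * -(z.2 k * Γ.constraint S.a k) := by
        rw [← div_eq_inv_mul, le_div_iff₀ hκ]
        have := mul_le_mul_of_nonneg_left (hκg k hk) (hz k)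
        linarith
      -- Slackness is only linear in an inactive coordinate, so the square must be reduced to first
      -- order. If `y ≤ 1` the coordinate is at most `R`; if `y ≥ 1` the energy bound is absorbed by
      -- `y^m`. Here `p₀` vanishes at inactive coordinates, so the energy bounds them directly.
      have h7 : z.2 k ^ 2 ≤ R * z.2 k + R * y ^ m := by
        have hzk := hz k
        rcases le_total y 1 with h | h
        · have h8 : z.2 k ≤ R := by
            by_contra! hlt
            nlinarith
          have : 0 ≤ R * y ^ m := by positivity
          nlinarith
        · have h8 : y ≤ y ^ m := le_self_pow₀ h hm
          have h9 : y + (R - 1) ≤ R * y := by nlinarith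
          have h10 : R * y ≤ R * y ^ m := by gcongr
          have : 0 ≤ R * z.2 k := by positivity
          linarith
      have := mul_le_mul_of_nonneg_left h6 (by linarith : 0 ≤ R)
      linarith
  rw [EuclideanSpace.real_norm_sq_eq]
  refine (Finset.sum_le_sum fun k _ => hcoord k).trans ?_
  rw [Finset.sum_add_distrib, ← Finset.mul_sum, Finset.sum_neg_distrib,
    ← euclidean_inner_eq_sum, Finset.sum_const, Finset.card_univ, Fintype.card_fin, nsmul_eq_mul]
  have hym : 0 ≤ y ^ m := by positivity
  have g1 : 0 ≤ R * κ⁻¹ * y ^ m := by positivity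
  have g2 : 0 ≤ R * (n + 1) * -⟪z.2, Γ.constraint S.a⟫ :=
    mul_nonneg (by positivity) (by linarith)
  have g3 : 0 ≤ R * y ^ m := by positivity
  linarith

/-- The residual sees only active coordinates, where the constraint vanishes at equilibrium, so its
increment has no constant drift; projecting from a nonnegative coordinate does not lengthen the
step. A constant drift would leave in the cross term an error linear in `‖μ - a*‖`, which the
contraction could not absorb at the required order. -/
theorem norm_residual_step_sub_le {γ : ℝ} (hγ : 0 ≤ γ) (ε σ : ℝ)
    (z : Joint d × EuclideanSpace ℝ (Fin n)) (hz : ∀ k, 0 ≤ z.2 k) (ξ : Joint d) :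
    ‖S.residual (projNonneg (z.2 + γ • S.dualDir ε σ z ξ)) - S.residual z.2‖
      ≤ ‖Γ.linearPart‖ * (γ * ‖Γ.linearPart (z.1 - S.a) + σ • Γ.linearPart ξ - ε • z.2‖) := by
  rw [residual_sub]
  refine (le_opNorm _ _).trans ?_
  rw [LinearIsometryEquiv.norm_map]
  refine mul_le_mul_of_nonneg_left ?_ (norm_nonneg _)
  have hn : γ * ‖Γ.linearPart (z.1 - S.a) + σ • Γ.linearPart ξ - ε • z.2‖
      = ‖γ • (Γ.linearPart (z.1 - S.a) + σ • Γ.linearPart ξ - ε • z.2)‖ := by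
    rw [norm_smul, Real.norm_of_nonneg hγ]
  rw [hn]
  refine S.norm_active_le_of_le fun k hk => ?_
  rw [S.dualDir_eq]
  set u := Γ.linearPart (z.1 - S.a) + σ • Γ.linearPart ξ - ε • z.2 with hu
  have e : Γ.constraint S.a + Γ.linearPart (z.1 - S.a) + σ • Γ.linearPart ξ - ε • z.2
      = Γ.constraint S.a + u := by rw [hu]; abel
  rw [e]
  simp only [PiLp.sub_apply, projNonneg_apply, PiLp.add_apply, PiLp.smul_apply, smul_eq_mul, hk,
    zero_add]
  have hzk := hz k
  rcases le_total (z.2 k + γ * u k) 0 with h | h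
  · rw [max_eq_right h, zero_sub, abs_neg, abs_of_nonneg hzk, abs_of_nonpos (by linarith)]
    linarith
  · rw [max_eq_left h, add_sub_cancel_left]

/-- The pairing of the residual with the mean of the stochastic primal direction. -/
theorem exists_neg_inner_residual_le : ∃ C : ℝ, 0 ≤ C ∧ ∀ γ ε σ, S.Admissible γ ε σ → ∀ z,
    -⟪S.residual z.2, ∫ ξ, S.primalDir σ z ξ ∂stdGaussian (Joint d)⟫
      ≤ -(‖S.residual z.2‖ ^ 2 / 2)
        + C * (‖z.1 - S.a‖ ^ 2 + ‖z.2 - S.active z.2‖ ^ 2 + σ ^ 2) := by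
  refine ⟨3 / 2 * (S.C ^ 2 + S.L ^ 2 + ‖Γ.linearPart‖ ^ 2), by positivity, fun γ ε σ h z => ?_⟩
  set mb := ∫ ξ, S.primalDir σ z ξ ∂stdGaussian (Joint d) with hmb
  have hbias : ‖mb - (Γ.pseudoGradient z.1 + adjoint Γ.linearPart z.2)‖ ≤ S.C * σ :=
    S.bias_le σ h.σ_pos h.σ_le z.1 z.2
  set q := S.residual z.2 with hq
  set ρ := ‖z.2 - S.active z.2‖ with hρ
  -- The mean primal direction is the residual plus `w`, which collects the bias, the variation of
  -- `M` from equilibrium and the inactive part of `λ`. Pairing with the residual yields its square,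
  -- half of which absorbs `w`.
  set w := (mb - (Γ.pseudoGradient z.1 + adjoint Γ.linearPart z.2))
    + (Γ.pseudoGradient z.1 - Γ.pseudoGradient S.a)
    + adjoint Γ.linearPart (z.2 - S.active z.2) with hw
  have e : mb = q + w := by rw [hq, hw, residual, map_sub]; abel
  have hwn : ‖w‖ ≤ S.C * σ + S.L * ‖z.1 - S.a‖ + ‖Γ.linearPart‖ * ρ := by
    refine norm_add₃_le.trans (add_le_add (add_le_add hbias (S.lip _ _)) ?_)
    rw [← LinearIsometryEquiv.norm_map adjoint Γ.linearPart]
    exact le_opNorm _ _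
  have h1 := neg_le_of_abs_le (abs_real_inner_le_norm q w)
  have h2 : ‖q‖ * ‖w‖ ≤ ‖q‖ ^ 2 / 2 + ‖w‖ ^ 2 / 2 := by nlinarith [sq_nonneg (‖q‖ - ‖w‖)]
  have h3 : ‖w‖ ^ 2 ≤ (S.C * σ + S.L * ‖z.1 - S.a‖ + ‖Γ.linearPart‖ * ρ) ^ 2 := by gcongr
  have h4 : ∀ x y z : ℝ, (x + y + z) ^ 2 ≤ 3 * (x ^ 2 + y ^ 2 + z ^ 2) := by
    intro x y z
    nlinarith [sq_nonneg (x - y), sq_nonneg (y - z), sq_nonneg (x - z)]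
  have h5 := h4 (S.C * σ) (S.L * ‖z.1 - S.a‖) (‖Γ.linearPart‖ * ρ)
  simp only [mul_pow] at h5
  rw [e, inner_add_right, real_inner_self_eq_norm_sq]
  have p1 := mul_nonneg (sq_nonneg S.C) (sq_nonneg ‖z.1 - S.a‖)
  have p2 := mul_nonneg (sq_nonneg S.C) (sq_nonneg ρ)
  have p3 := mul_nonneg (sq_nonneg S.L) (sq_nonneg σ)
  have p4 := mul_nonneg (sq_nonneg S.L) (sq_nonneg ρ)
  have p5 := mul_nonneg (sq_nonneg ‖Γ.linearPart‖) (sq_nonneg σ)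
  have p6 := mul_nonneg (sq_nonneg ‖Γ.linearPart‖) (sq_nonneg ‖z.1 - S.a‖)
  linarith

/-- The cross term of the Lyapunov function after one iteration. -/
theorem exists_cross_step_le : ∃ C : ℝ, 0 ≤ C ∧ ∀ γ ε σ, S.Admissible γ ε σ →
    ∀ z : Joint d × EuclideanSpace ℝ (Fin n), (∀ k, 0 ≤ z.2 k) → ∀ ξ,
    ⟪(Γ.step γ ε σ (z.1 + σ • ξ) z).1 - S.a, S.residual (Γ.step γ ε σ (z.1 + σ • ξ) z).2⟫
      ≤ ⟪z.1 - S.a, S.residual z.2⟫ - γ * ⟪S.residual z.2, S.primalDir σ z ξ⟫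
        + C * γ * (‖z.1 - S.a‖ ^ 2 + ε ^ 2 * S.size z
          + (σ ^ 2 + γ * S.size z) * (1 + ‖ξ‖) ^ 6) := by
  obtain ⟨C₁, hC₁, hb⟩ := S.exists_noise_bound
  have hB := S.B_pos
  set A := ‖Γ.linearPart‖ with hA
  have hA0 : 0 ≤ A := norm_nonneg _
  refine ⟨A * (1 + A) * (3 + C₁ * (1 + 2 * S.B)), by positivity, fun γ ε σ h z hz ξ => ?_⟩
  have hγ := h.γ_pos
  have hε := h.ε_pos
  have hσ := h.σ_pos
  set P := (1 + ‖ξ‖) ^ 3 with hP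
  have hP1 : 1 ≤ P := one_le_pow₀ (by linarith [norm_nonneg ξ])
  have hP6 : (1 + ‖ξ‖) ^ 6 = P ^ 2 := by rw [hP, ← pow_mul]
  have hξP : ‖ξ‖ ≤ P := by
    calc ‖ξ‖ ≤ (1 + ‖ξ‖) ^ 1 := by linarith
      _ ≤ _ := pow_le_pow_right₀ (by linarith [norm_nonneg ξ]) (by norm_num)
  have hm := (hb γ ε σ h z ξ).1
  have hr := S.norm_residual_step_sub_le hγ.le ε σ z hz ξ
  rw [S.step_eq]
  simp only
  set m := S.primalDir σ z ξ
  set q := S.residual z.2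
  set q' := S.residual (projNonneg (z.2 + γ • S.dualDir ε σ z ξ))
  set T := √(S.size z) with hT
  have hT2 : T ^ 2 = S.size z := Real.sq_sqrt (by linarith [S.one_le_size z])
  have hT0 : 0 ≤ T := Real.sqrt_nonneg _
  have hθ : ‖z.1 - S.a‖ ≤ T := by
    refine Real.le_sqrt_of_sq_le ?_
    rw [size]; nlinarith [sq_nonneg ‖z.2‖]
  have hl : ‖z.2‖ ≤ T := by
    refine Real.le_sqrt_of_sq_le ?_
    rw [size]; nlinarith [sq_nonneg ‖z.1 - S.a‖]
  set t := ‖z.1 - S.a‖ with ht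
  have ht0 : 0 ≤ t := norm_nonneg _
  set U := t + σ * P + ε * T with hU
  have hU0 : 0 ≤ U := by positivity
  have hq' : ‖q' - q‖ ≤ A * (1 + A) * γ * U := by
    have h1 : ‖Γ.linearPart (z.1 - S.a) + σ • Γ.linearPart ξ - ε • z.2‖ ≤ (1 + A) * U := by
      have e1 : ‖Γ.linearPart (z.1 - S.a)‖ ≤ A * t := le_opNorm _ _
      have e2 : ‖σ • Γ.linearPart ξ‖ ≤ σ * (A * P) := by
        rw [norm_smul, Real.norm_of_nonneg hσ.le]
        gcongr
        exact (le_opNorm _ _).trans (by gcongr)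
      have e3 : ‖ε • z.2‖ ≤ ε * T := by
        rw [norm_smul, Real.norm_of_nonneg hε.le]; gcongr
      have e4 := norm_sub_le (Γ.linearPart (z.1 - S.a) + σ • Γ.linearPart ξ) (ε • z.2)
      have e5 := norm_add_le (Γ.linearPart (z.1 - S.a)) (σ • Γ.linearPart ξ)
      have p1 : 0 ≤ σ * P := by positivity
      have p2 : 0 ≤ A * (ε * T) := by positivity
      rw [hU]
      linarith
    calc ‖q' - q‖ ≤ A * (γ * ((1 + A) * U)) := hr.trans (by gcongr)
      _ = _ := by ring
  -- Discrete product rule: the useful term `-γ⟨q, m⟩` is isolated, and the rest pairs the new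
  -- primal error with the increment of the residual, itself of order `γ U`.
  have e : ⟪z.1 - γ • m - S.a, q'⟫ = ⟪z.1 - S.a, q⟫ - γ * ⟪q, m⟫
      + ⟪z.1 - S.a - γ • m, q' - q⟫ := by
    rw [sub_right_comm, inner_sub_right (z.1 - S.a - γ • m) q' q,
      inner_sub_left (z.1 - S.a) (γ • m) q, inner_smul_left, real_inner_comm q m]
    simp only [conj_trivial]
    ring
  rw [e]
  refine add_le_add le_rfl ((real_inner_le_norm _ _).trans ?_)
  have h2 : ‖z.1 - S.a - γ • m‖ ≤ t + γ * (C₁ * T * P) := by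
    refine (norm_sub_le _ _).trans ?_
    rw [norm_smul, Real.norm_of_nonneg hγ.le]
    gcongr
  have h3 : U ≤ (1 + 2 * S.B) * (T * P) := by
    have p1 : T ≤ T * P := le_mul_of_one_le_right hT0 hP1
    have hT1 : 1 ≤ T := by rw [hT, Real.one_le_sqrt]; exact S.one_le_size z
    have p2 : P ≤ T * P := le_mul_of_one_le_left (by positivity) hT1
    have p3 : σ * P ≤ S.B * (T * P) := mul_le_mul h.σ_le p2 (by positivity) hB.le
    have p4 : ε * T ≤ S.B * (T * P) := mul_le_mul h.ε_le p1 (by positivity) hB.le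
    rw [hU]
    linarith
  have h4 : t * U ≤ 3 * (t ^ 2 + ε ^ 2 * T ^ 2 + σ ^ 2 * P ^ 2) := by
    rw [hU]
    nlinarith [sq_nonneg (t - σ * P), sq_nonneg (t - ε * T), sq_nonneg t, sq_nonneg (σ * P),
      sq_nonneg (ε * T)]
  have h5 : γ * (C₁ * T * P) * U ≤ C₁ * (1 + 2 * S.B) * (γ * T ^ 2 * P ^ 2) := by
    calc γ * (C₁ * T * P) * U ≤ γ * (C₁ * T * P) * ((1 + 2 * S.B) * (T * P)) := by gcongr
      _ = _ := by ring
  have h6 : (t + γ * (C₁ * T * P)) * U ≤ (3 + C₁ * (1 + 2 * S.B))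
      * (t ^ 2 + ε ^ 2 * T ^ 2 + (σ ^ 2 + γ * T ^ 2) * P ^ 2) := by
    have p1 : 0 ≤ C₁ * (1 + 2 * S.B) * (t ^ 2 + ε ^ 2 * T ^ 2 + σ ^ 2 * P ^ 2) := by positivity
    have p2 : 0 ≤ γ * T ^ 2 * P ^ 2 := by positivity
    linarith
  calc ‖z.1 - S.a - γ • m‖ * ‖q' - q‖
      ≤ (t + γ * (C₁ * T * P)) * (A * (1 + A) * γ * U) := by gcongr
    _ = A * (1 + A) * γ * ((t + γ * (C₁ * T * P)) * U) := by ring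
    _ ≤ A * (1 + A) * γ * ((3 + C₁ * (1 + 2 * S.B))
      * (t ^ 2 + ε ^ 2 * T ^ 2 + (σ ^ 2 + γ * T ^ 2) * P ^ 2)) := by gcongr
    _ = _ := by rw [hP6, ← hT2]; ring

/-- The Lyapunov function: the squared distance to the set of equilibria, corrected by a small
multiple of a cross term. -/
noncomputable def lyap (η : ℝ) (z : Joint d × EuclideanSpace ℝ (Fin n)) : ℝ :=
  ‖z.1 - S.a‖ ^ 2 + S.dualDist z.2 ^ 2 + η * ⟪z.1 - S.a, S.residual z.2⟫

theorem continuous_lyap (η : ℝ) : Continuous (S.lyap η) := by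
  have h1 := S.continuous_residual
  have h2 : Continuous S.dualDist := Metric.continuous_infDist_pt _
  unfold lyap; fun_prop

/-- For small `η` the Lyapunov function lies between `3/4` and `5/4` of the sum of the two squared
distances. -/
theorem abs_cross_le {η : ℝ} (hη : 0 ≤ η) (hη1 : 2 * η * ‖Γ.linearPart‖ ≤ 1)
    (z : Joint d × EuclideanSpace ℝ (Fin n)) :
    |η * ⟪z.1 - S.a, S.residual z.2⟫| ≤ (‖z.1 - S.a‖ ^ 2 + S.dualDist z.2 ^ 2) / 4 := by
  rw [abs_mul, abs_of_nonneg hη]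
  have h1 := abs_real_inner_le_norm (z.1 - S.a) (S.residual z.2)
  have h2 := S.norm_residual_le z.2
  have hD := S.dualDist_nonneg z.2
  have ht := norm_nonneg (z.1 - S.a)
  set t := ‖z.1 - S.a‖
  set D := S.dualDist z.2
  calc η * |⟪z.1 - S.a, S.residual z.2⟫| ≤ η * (t * (‖Γ.linearPart‖ * D)) := by
        gcongr
        exact h1.trans (by gcongr)
    _ = (2 * η * ‖Γ.linearPart‖) * (t * D / 2) := by ring
    _ ≤ 1 * (t * D / 2) := by gcongr
    _ ≤ _ := by nlinarith [sq_nonneg (t - D)]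

/-- Collection of the terms in the drift of the Lyapunov function. -/
theorem lyap_bracket_le {ν C σ t g ε ip β βi D w C₂ γ η C₄ C₅ Q ρ κ s Y Cs c₁ b : ℝ}
    (hν : 0 ≤ ν) (hη : 0 ≤ η) (hβi : 0 ≤ βi) (hC₂ : 0 ≤ C₂) (hC₄ : 0 ≤ C₄)
    (hC₅ : 0 ≤ C₅) (hκ : 0 ≤ κ) (hc₁ : 0 ≤ c₁) (hCs : 0 ≤ Cs) (hγ : 0 ≤ γ) (hw : 0 ≤ w)
    (hs : 0 ≤ s) (hY : 0 ≤ Y) (hg : g = -s)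
    (b1 : 2 * C * σ * t ≤ ν / 2 * t ^ 2 + c₁ * σ ^ 2)
    (b2 : -2 * ε * ip ≤ β * D ^ 2 + ε ^ 2 * βi * w)
    (b5 : 2 * β * D ^ 2 ≤ s + Y + η / 2 * Q ^ 2)
    (b6 : η * C₅ * ρ ^ 2 ≤ 1 / 2 * (s + Y))
    (b7 : η * (C₄ + C₅) * t ^ 2 ≤ ν / 2 * t ^ 2)
    (b8 : w ≤ Cs * (1 + Y)) (b9 : b ≤ ν / 2 * t ^ 2 + β * D ^ 2) :
    (-2 * ν * t ^ 2 + 2 * C * σ * t + 2 * g - 2 * ε * ip) + C₂ * γ * w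
        + η * (C₄ * (t ^ 2 + ε ^ 2 * w)) + η * (-(Q ^ 2 / 2) + C₅ * (t ^ 2 + ρ ^ 2 + σ ^ 2))
        + η * (C₄ * (σ ^ 2 + γ * w)) * κ
      ≤ -b + ((c₁ + η * C₅ + η * C₄ * κ + 2) + (βi + η * C₄ + C₂ + η * C₄ * κ) * Cs)
        * ((ε ^ 2 + γ) * (1 + Y) + σ ^ 2 + Y) := by
  subst hg
  have m1 : (βi + η * C₄ + C₂ + η * C₄ * κ) * (ε ^ 2 + γ) * w
      ≤ (βi + η * C₄ + C₂ + η * C₄ * κ) * Cs * ((ε ^ 2 + γ) * (1 + Y)) := by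
    calc _ ≤ (βi + η * C₄ + C₂ + η * C₄ * κ) * (ε ^ 2 + γ) * (Cs * (1 + Y)) := by gcongr
      _ = _ := by ring
  have m2 : 0 ≤ (βi + η * C₄) * γ * w := by positivity
  have m3 : 0 ≤ (C₂ + η * C₄ * κ) * ε ^ 2 * w := by positivity
  have m4 : 0 ≤ (c₁ + η * C₅ + η * C₄ * κ + 2) * ((ε ^ 2 + γ) * (1 + Y)) := by positivity
  have m5 : 0 ≤ (βi + η * C₄ + C₂ + η * C₄ * κ) * Cs * (σ ^ 2 + Y) := by positivity
  have m6 : 0 ≤ (c₁ + η * C₅ + η * C₄ * κ) * Y + 2 * σ ^ 2 := by positivity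
  have m7 : 0 ≤ ν * t ^ 2 := by positivity
  generalize (βi + η * C₄ + C₂ + η * C₄ * κ) * Cs = K at m1 m5 ⊢
  linarith

set_option maxHeartbeats 1000000 in
/-- Contraction of the Lyapunov function in one iteration. -/
theorem exists_lyap_contraction (m : ℕ) (hm : m ≠ 0) : ∃ η c K : ℝ, 0 < c ∧ 0 ≤ K ∧
    (∀ z, ‖z.1 - S.a‖ ^ 2 ≤ 2 * S.lyap η z) ∧
    ∀ γ ε σ, S.Admissible γ ε σ →
    ∀ z : Joint d × EuclideanSpace ℝ (Fin n), (∀ k, 0 ≤ z.2 k) →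
    Integrable (fun ξ => S.lyap η (Γ.step γ ε σ (z.1 + σ • ξ) z)) (stdGaussian (Joint d)) ∧
    ∫ ξ, S.lyap η (Γ.step γ ε σ (z.1 + σ • ξ) z) ∂stdGaussian (Joint d) ≤
      (1 - c * γ) * S.lyap η z + K * γ * ((ε ^ 2 + γ) * (1 + S.excess z ^ m) + σ ^ 2
        + S.excess z ^ m) := by
  obtain ⟨C₂, hC₂, hE⟩ := S.exists_stepEnergy_bound
  obtain ⟨C₄, hC₄, hX⟩ := S.exists_cross_step_le
  obtain ⟨C₅, hC₅, hR⟩ := S.exists_neg_inner_residual_le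
  obtain ⟨H, hH, hD⟩ := S.exists_dualDist_bound
  obtain ⟨Cr, hCr, hI⟩ := S.exists_inactive_bound
  obtain ⟨C₁, hC₁, hb⟩ := S.exists_noise_bound
  have hν := S.ν_pos
  have hSC := S.C_nonneg
  set A := ‖Γ.linearPart‖ with hA
  have hA0 : 0 ≤ A := norm_nonneg _
  set κ := ∫ ξ, (1 + ‖ξ‖) ^ 6 ∂stdGaussian (Joint d) with hκ
  have hκ0 : 0 ≤ κ := integral_nonneg fun ξ => by positivity
  -- The three conditions make the cross term subordinate, let `-ν t²` absorb the cross-term errors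
  -- in `t²`, and let slackness absorb those from the inactive part.
  obtain ⟨η, hη, hη1, hη2, hη3⟩ : ∃ η : ℝ, 0 < η ∧ 2 * η * A ≤ 1 ∧
      η * (C₄ + C₅) ≤ S.ν / 2 ∧ η * C₅ * Cr ≤ 1 / 2 := by
    have hden : 0 < 2 * A + 2 * (C₄ + C₅) / S.ν + 2 * C₅ * Cr + 1 := by positivity
    refine ⟨1 / (2 * A + 2 * (C₄ + C₅) / S.ν + 2 * C₅ * Cr + 1), by positivity, ?_, ?_, ?_⟩
    · rw [mul_one_div, div_mul_eq_mul_div, div_le_one hden]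
      have : 0 ≤ 2 * (C₄ + C₅) / S.ν + 2 * C₅ * Cr := by positivity
      linarith
    · rw [one_div_mul_eq_div, div_le_iff₀ hden]
      have e : S.ν / 2 * (2 * (C₄ + C₅) / S.ν) = C₄ + C₅ := by field_simp
      have : 0 ≤ S.ν / 2 * (2 * A + 2 * C₅ * Cr + 1) := by positivity
      linarith
    · rw [mul_assoc, one_div_mul_eq_div, div_le_iff₀ hden]
      have : 0 ≤ 2 * A + 2 * (C₄ + C₅) / S.ν := by positivity
      linarith
  -- `β` is the dual contraction obtained from slackness and the squared residual: `D² ≤ 2ρ² +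
  -- 2H²Q²` gives `2β D² ≤ s + Y + (η/2) Q²`. One copy of `β D²` pays for the regularization, the
  -- other is the contraction.
  set β := min (1 / (4 * Cr)) (η / (8 * H ^ 2)) with hβ
  have hβ0 : 0 < β := by positivity
  have hβ1 : 4 * β * Cr ≤ 1 := by
    have : β ≤ 1 / (4 * Cr) := min_le_left _ _
    rw [le_div_iff₀ (by positivity)] at this
    linarith
  have hβ2 : 4 * β * H ^ 2 ≤ η / 2 := by
    have : β ≤ η / (8 * H ^ 2) := min_le_right _ _
    rw [le_div_iff₀ (by positivity)] at this
    linarith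
  -- The factor `4/5` inverts the upper comparison constant `5/4` of the Lyapunov function.
  set c := min (S.ν / 2) β * (4 / 5) with hc
  have hcpos : 0 < c := by positivity
  set c₁ := 2 * S.C ^ 2 / S.ν with hc₁
  have hc₁0 : 0 ≤ c₁ := by positivity
  set Cs := 2 * (5 + 4 * ‖S.p₀‖ ^ 2) with hCs
  have hCs0 : 0 ≤ Cs := by positivity
  set K₁ := c₁ + η * C₅ + η * C₄ * κ + 2
  have hK₁0 : 0 ≤ K₁ := by positivity
  set K₂ := (β⁻¹ + η * C₄ + C₂ + η * C₄ * κ) * Cs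
  have hK₂0 : 0 ≤ K₂ := by positivity
  have hlow : ∀ z, ‖z.1 - S.a‖ ^ 2 ≤ 2 * S.lyap η z := by
    intro z
    have := neg_le_of_abs_le (S.abs_cross_le hη.le hη1 z)
    rw [lyap]
    nlinarith [sq_nonneg (S.dualDist z.2), sq_nonneg ‖z.1 - S.a‖]
  refine ⟨η, c, K₁ + K₂, hcpos, by positivity, hlow, fun γ ε σ h z hz => ?_⟩
  have hγ := h.γ_pos
  have hε := h.ε_pos
  -- The multiplier nearest to the current `λ` is frozen during the step; afterwards the distance to
  -- the set is at most the distance to this same `p`.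
  obtain ⟨p, hp, hpD⟩ := S.exists_nearest z.2
  obtain ⟨hEi, hEle⟩ := hE γ ε σ h p hp z
  set w := S.size z with hw
  have hw0 : 0 ≤ w := by linarith [S.one_le_size z]
  have hmi : Integrable (S.primalDir σ z) (stdGaussian (Joint d)) :=
    integrable_of_norm_le_pow (S.continuous_primalDir σ z) fun ξ => (hb γ ε σ h z ξ).1
  set t := ‖z.1 - S.a‖ with ht
  set D := S.dualDist z.2 with hDdef
  set Q := ‖S.residual z.2‖ with hQ
  set ρ := ‖z.2 - S.active z.2‖ with hρ
  set s := -⟪z.2, Γ.constraint S.a⟫ with hs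
  set Y := S.excess z ^ m with hY
  set X := ⟪z.1 - S.a, S.residual z.2⟫ with hXdef
  have hs0 : 0 ≤ s := by have := S.inner_constraint_nonpos hz; linarith
  have hY0 : 0 ≤ Y := pow_nonneg (S.excess_nonneg z) _
  have hQ0 : 0 ≤ Q := norm_nonneg _
  have hD0 : 0 ≤ D := S.dualDist_nonneg _
  have ht0 : 0 ≤ t := norm_nonneg _
  set G : Joint d → ℝ := fun ξ => S.stepEnergy γ ε σ p z ξ
    + ((η * (X + C₄ * γ * (t ^ 2 + ε ^ 2 * w)) - (η * γ) * ⟪S.residual z.2, S.primalDir σ z ξ⟫)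
      + (η * (C₄ * γ * (σ ^ 2 + γ * w))) * (1 + ‖ξ‖) ^ 6) with hG
  have hi1 : Integrable (fun ξ => ⟪S.residual z.2, S.primalDir σ z ξ⟫) (stdGaussian (Joint d)) :=
    hmi.const_inner _
  have hi2 : Integrable (fun ξ => η * (X + C₄ * γ * (t ^ 2 + ε ^ 2 * w))
      - (η * γ) * ⟪S.residual z.2, S.primalDir σ z ξ⟫) (stdGaussian (Joint d)) :=
    (integrable_const _).sub (hi1.const_mul _)
  have hi3 := (integrable_one_add_norm_pow (ι := Σ i : Fin N, Fin (d i)) 6).const_mul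
    (η * (C₄ * γ * (σ ^ 2 + γ * w)))
  have hi4 : Integrable (fun ξ => (η * (X + C₄ * γ * (t ^ 2 + ε ^ 2 * w))
      - (η * γ) * ⟪S.residual z.2, S.primalDir σ z ξ⟫)
      + (η * (C₄ * γ * (σ ^ 2 + γ * w))) * (1 + ‖ξ‖) ^ 6) (stdGaussian (Joint d)) := hi2.add hi3
  have hGi : Integrable G (stdGaussian (Joint d)) := hEi.add hi4
  have hle : ∀ ξ, S.lyap η (Γ.step γ ε σ (z.1 + σ • ξ) z) ≤ G ξ := by
    intro ξ
    have h1 := S.norm_step_le γ ε σ hp.1 z ξ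
    have h2 := pow_le_pow_left₀ (S.dualDist_nonneg _)
      (S.dualDist_le hp (Γ.step γ ε σ (z.1 + σ • ξ) z).2) 2
    have h3 := mul_le_mul_of_nonneg_left (hX γ ε σ h z hz ξ) hη.le
    rw [lyap]
    simp only [hG]
    linarith
  have hint : Integrable (fun ξ => S.lyap η (Γ.step γ ε σ (z.1 + σ • ξ) z))
      (stdGaussian (Joint d)) := by
    refine hGi.mono' ((S.continuous_lyap η).comp (S.continuous_step γ ε σ z)).aestronglyMeasurable
      (Eventually.of_forall fun ξ => ?_)
    rw [Real.norm_of_nonneg (by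
      have := hlow (Γ.step γ ε σ (z.1 + σ • ξ) z)
      linarith [sq_nonneg ‖(Γ.step γ ε σ (z.1 + σ • ξ) z).1 - S.a‖])]
    exact hle ξ
  refine ⟨hint, (integral_mono hint hGi hle).trans ?_⟩
  have hGint : ∫ ξ, G ξ ∂stdGaussian (Joint d) =
      ∫ ξ, S.stepEnergy γ ε σ p z ξ ∂stdGaussian (Joint d)
      + ((η * (X + C₄ * γ * (t ^ 2 + ε ^ 2 * w))
        - (η * γ) * ⟪S.residual z.2, ∫ ξ, S.primalDir σ z ξ ∂stdGaussian (Joint d)⟫)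
      + (η * (C₄ * γ * (σ ^ 2 + γ * w))) * κ) := by
    rw [hG, integral_add hEi hi4, integral_add hi2 hi3,
      integral_sub (integrable_const _) (hi1.const_mul _), integral_const_mul (η * γ),
      integral_const_mul (η * (C₄ * γ * (σ ^ 2 + γ * w))), integral_inner hmi]
    simp only [integral_const, probReal_univ, one_smul]
    rfl
  rw [hGint]
  have r1 := hR γ ε σ h z
  have r1' := mul_le_mul_of_nonneg_left r1 (by positivity : 0 ≤ η * γ)
  set ip := ⟪S.residual z.2, ∫ ξ, S.primalDir σ z ξ ∂stdGaussian (Joint d)⟫ with hip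
  have b1 : 2 * S.C * σ * t ≤ S.ν / 2 * t ^ 2 + c₁ * σ ^ 2 := by
    have e : c₁ * S.ν = 2 * S.C ^ 2 := by rw [hc₁]; field_simp
    have e' : c₁ * S.ν * σ ^ 2 = 2 * S.C ^ 2 * σ ^ 2 := by rw [e]
    have := sq_nonneg (S.ν * t - 2 * S.C * σ)
    have h2 : S.ν * (2 * S.C * σ * t) ≤ S.ν * (S.ν / 2 * t ^ 2 + c₁ * σ ^ 2) := by
      linarith only [this, e']
    exact le_of_mul_le_mul_left h2 hν
  -- The regularization error is first order in `ε` but carries a factor `D`; trading that factor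
  -- against the dual contraction leaves `ε²`, the source of the exponent `2e`.
  have b2 : -2 * ε * ⟪z.2 - p, z.2⟫ ≤ β * D ^ 2 + ε ^ 2 * β⁻¹ * w := by
    have h1 := neg_le_of_abs_le (abs_real_inner_le_norm (z.2 - p) z.2)
    rw [hpD] at h1
    have h2 : ‖z.2‖ ^ 2 ≤ w := by
      rw [hw, size]; nlinarith [sq_nonneg ‖z.1 - S.a‖]
    have h3 : ε ^ 2 * β⁻¹ * ‖z.2‖ ^ 2 ≤ ε ^ 2 * β⁻¹ * w := by gcongr
    have h4 : 2 * ε * (D * ‖z.2‖) ≤ β * D ^ 2 + ε ^ 2 * β⁻¹ * ‖z.2‖ ^ 2 := by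
      have e : β * D ^ 2 + ε ^ 2 * β⁻¹ * ‖z.2‖ ^ 2 - 2 * ε * (D * ‖z.2‖)
        = β⁻¹ * (β * D - ε * ‖z.2‖) ^ 2 := by field_simp; ring
      have : 0 ≤ β⁻¹ * (β * D - ε * ‖z.2‖) ^ 2 := by positivity
      linarith only [e, this]
    have h5 := mul_le_mul_of_nonneg_left h1 (by positivity : 0 ≤ 2 * ε)
    linarith only [h3, h4, h5]
  have b3 : ρ ^ 2 ≤ Cr * (s + Y) := hI m hm z hz
  have b4 : D ^ 2 ≤ 2 * ρ ^ 2 + 2 * H ^ 2 * Q ^ 2 := by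
    have h1 := (pow_le_pow_left₀ hD0 (hD z.2 hz) 2).trans (add_sq_le (a := ρ) (b := H * Q))
    linarith only [h1, mul_pow H Q 2]
  have b5 : 2 * β * D ^ 2 ≤ s + Y + η / 2 * Q ^ 2 := by
    have h1 := mul_le_mul_of_nonneg_left b4 (by positivity : 0 ≤ 2 * β)
    have h2 := mul_le_mul_of_nonneg_left b3 (by positivity : 0 ≤ 4 * β)
    have h3 := mul_le_mul_of_nonneg_right hβ1 (by positivity : 0 ≤ s + Y)
    have h4 := mul_le_mul_of_nonneg_right hβ2 (sq_nonneg Q)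
    linarith only [h1, h2, h3, h4]
  have b6 : η * C₅ * ρ ^ 2 ≤ 1 / 2 * (s + Y) := by
    calc η * C₅ * ρ ^ 2 ≤ η * C₅ * (Cr * (s + Y)) := by gcongr
      _ = (η * C₅ * Cr) * (s + Y) := by ring
      _ ≤ _ := by gcongr
  have b7 : η * (C₄ + C₅) * t ^ 2 ≤ S.ν / 2 * t ^ 2 := by gcongr
  have b8 : w ≤ Cs * (1 + Y) := by
    have h1 := S.size_le z
    have h2 := pow_le_one_add_pow (S.excess_nonneg z) (Nat.one_le_iff_ne_zero.2 hm)
    rw [pow_one] at h2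
    calc w ≤ (5 + 4 * ‖S.p₀‖ ^ 2) * (1 + S.excess z) := h1
      _ ≤ (5 + 4 * ‖S.p₀‖ ^ 2) * (2 * (1 + Y)) := by gcongr; linarith
      _ = _ := by rw [hCs]; ring
  have b9 : c * S.lyap η z ≤ S.ν / 2 * t ^ 2 + β * D ^ 2 := by
    have h1 := le_of_abs_le (S.abs_cross_le hη.le hη1 z)
    have h2 : S.lyap η z ≤ 5 / 4 * (t ^ 2 + D ^ 2) := by
      rw [lyap]; linarith only [h1]
    have h3 : c * S.lyap η z ≤ c * (5 / 4 * (t ^ 2 + D ^ 2)) := by gcongr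
    have h4 : c * (5 / 4) = min (S.ν / 2) β := by rw [hc]; ring
    have h5 : min (S.ν / 2) β * t ^ 2 ≤ S.ν / 2 * t ^ 2 := by gcongr; exact min_le_left _ _
    have h6 : min (S.ν / 2) β * D ^ 2 ≤ β * D ^ 2 := by gcongr; exact min_le_right _ _
    have h7 : c * (5 / 4 * (t ^ 2 + D ^ 2))
      = min (S.ν / 2) β * t ^ 2 + min (S.ν / 2) β * D ^ 2 := by rw [← h4]; ring
    linarith only [h3, h5, h6, h7]
  have main := lyap_bracket_le (ip := ⟪z.2 - p, z.2⟫) (g := ⟪z.2, Γ.constraint S.a⟫) hν.le hη.le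
    (inv_nonneg.2 hβ0.le) hC₂ hC₄ hC₅ hκ0 hc₁0 hCs0 hγ.le hw0 hs0 hY0 (by ring) b1 b2 b5 b6
    b7 b8 b9
  have main' := mul_le_mul_of_nonneg_left main hγ.le
  have e1 : S.lyap η z = t ^ 2 + D ^ 2 + η * X := rfl
  rw [hpD] at hEle
  rw [e1] at main' ⊢
  linarith only [hEle, main', r1']

end GNEP.Game.Setup

/-! ### Scalar recursions, integration along the chain, independence -/

namespace GNEP

section Recursion

theorem eventually_div_rpow_le {p q : ℝ} (hpq : q < p) (A : ℝ) {b : ℝ} (hb : 0 < b) :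
    ∀ᶠ t : ℕ in atTop, A / (t : ℝ) ^ p ≤ b / (t : ℝ) ^ q := by
  have h := (tendsto_rpow_neg_atTop (sub_pos.2 hpq)).comp tendsto_natCast_atTop_atTop
  have h2 := (h.const_mul A).eventually (gt_mem_nhds (show A * 0 < b by simpa using hb))
  filter_upwards [h2, eventually_gt_atTop 0] with t ht ht0
  have ht' : (0:ℝ) < t := by exact_mod_cast ht0
  rw [div_le_div_iff₀ (by positivity) (by positivity)]
  have e : (t:ℝ) ^ p = (t:ℝ) ^ q * (t:ℝ) ^ (p - q) := by
    rw [← Real.rpow_add ht']; congr 1; ring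
  have e2 : (t:ℝ) ^ (-(p - q)) * (t:ℝ) ^ (p - q) = 1 := by
    rw [← Real.rpow_add ht']; simp
  simp only [Function.comp] at ht
  have h3 := mul_le_mul_of_nonneg_right ht.le (by positivity : 0 ≤ (t:ℝ) ^ (p - q))
  rw [mul_assoc, e2, mul_one] at h3
  rw [e]
  calc A * (t:ℝ) ^ q ≤ (b * (t:ℝ) ^ (p - q)) * (t:ℝ) ^ q := by gcongr
    _ = _ := by ring

theorem one_div_rpow_le {t p q : ℝ} (ht : 1 ≤ t) (hpq : q ≤ p) : 1 / t ^ p ≤ 1 / t ^ q :=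
  one_div_le_one_div_of_le (Real.rpow_pos_of_pos (by linarith) _)
    (Real.rpow_le_rpow_of_exponent_le ht hpq)

/-- From `(1 - r/t)(1 + 1/t)^r ≤ exp(-r/t) exp(r/t) = 1`: the target `t^(-r)` loses at most the
relative amount `r/t` per step. -/
theorem sub_div_le_rpow {t r : ℝ} (ht : 1 ≤ t) (hr : 0 ≤ r) :
    1 / t ^ r * (1 - r / t) ≤ 1 / (t + 1) ^ r := by
  have ht0 : 0 < t := by linarith
  have h1 : t + 1 = t * (1 + 1 / t) := by field_simp
  have h2 : (0:ℝ) < 1 + 1 / t := by positivity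
  rw [h1, Real.mul_rpow ht0.le h2.le, one_div_mul_eq_div,
    div_le_div_iff₀ (by positivity) (by positivity)]
  have h3 : (1 - r / t) * (1 + 1 / t) ^ r ≤ 1 := by
    have h4 : (1 + 1 / t) ^ r ≤ Real.exp (r / t) := by
      rw [Real.rpow_def_of_pos h2]
      refine Real.exp_le_exp.2 ?_
      have h5 : Real.log (1 + 1 / t) ≤ 1 / t := by
        have := Real.log_le_sub_one_of_pos h2; linarith
      calc Real.log (1 + 1 / t) * r ≤ 1 / t * r := by gcongr
        _ = r / t := by ring
    have h6 : 1 - r / t ≤ Real.exp (-(r / t)) := by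
      have := Real.add_one_le_exp (-(r / t)); linarith
    calc (1 - r / t) * (1 + 1 / t) ^ r ≤ Real.exp (-(r / t)) * (1 + 1 / t) ^ r := by gcongr
      _ ≤ Real.exp (-(r / t)) * Real.exp (r / t) := by gcongr
      _ = 1 := by rw [← Real.exp_add]; simp
  calc (1 - r / t) * (t ^ r * (1 + 1 / t) ^ r) = t ^ r * ((1 - r / t) * (1 + 1 / t) ^ r) := by ring
    _ ≤ t ^ r * 1 := by gcongr
    _ = _ := by ring

/-- Chung's lemma. -/
theorem isBigO_of_recursion {x : ℕ → ℝ} (hx : ∀ t, 0 ≤ x t) {a r c C : ℝ} (ha : 0 < a)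
    (ha1 : a < 1) (hr : 0 ≤ r) (hc : 0 < c)
    (h : ∀ᶠ t : ℕ in atTop, x (t + 1) ≤ (1 - c / (t : ℝ) ^ a) * x t
      + C / (t : ℝ) ^ a * (1 / (t : ℝ) ^ r)) :
    x =O[atTop] fun t : ℕ => 1 / (t : ℝ) ^ r := by
  have h1 := eventually_div_rpow_le ha c one_pos
  have h2 := eventually_div_rpow_le ha1 r (half_pos hc)
  obtain ⟨T, hT⟩ := eventually_atTop.1 ((h.and (h1.and h2)).and (eventually_ge_atTop 1))
  -- The second entry starts the induction. The first makes the forcing cost at most half of the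
  -- contraction `c t^(-a)`; the other half covers the loss `r/t`, smaller since `a < 1`, while `a >
  -- 0` makes `1 - c t^(-a)` eventually nonnegative.
  set A := max (2 * C / c) (x T * (T:ℝ) ^ r) with hA
  have hT1 : 1 ≤ T := (hT T le_rfl).2
  have hT0 : (0:ℝ) < T := by exact_mod_cast hT1
  have hA0 : 0 ≤ A := le_max_of_le_right (by have := hx T; positivity)
  have hAC : C ≤ c / 2 * A := by
    have : 2 * C / c ≤ A := le_max_left _ _
    rw [div_le_iff₀ hc] at this
    linarith
  have key : ∀ t, T ≤ t → x t ≤ A * (1 / (t:ℝ) ^ r) := by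
    intro t ht
    induction t, ht using Nat.le_induction with
    | base =>
      rw [mul_one_div, le_div_iff₀ (by positivity)]
      exact le_max_right _ _
    | succ t ht ih =>
      obtain ⟨⟨g1, g2, g3⟩, g4⟩ := hT t ht
      have ht1 : (1:ℝ) ≤ t := by exact_mod_cast g4
      have ht0 : (0:ℝ) < t := by linarith
      rw [Real.rpow_zero, div_one] at g2
      rw [Real.rpow_one] at g3
      set b := 1 / (t:ℝ) ^ a with hb
      have hb0 : 0 < b := by positivity
      have e1 : c / (t:ℝ) ^ a = c * b := by rw [hb]; ring
      have e2 : C / (t:ℝ) ^ a = C * b := by rw [hb]; ring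
      have e3 : c / 2 / (t:ℝ) ^ a = c / 2 * b := by rw [hb]; ring
      rw [e1] at g2
      rw [e3] at g3
      rw [e1, e2] at g1
      set w := 1 / (t:ℝ) ^ r with hw
      have hw0 : 0 < w := by positivity
      have s1 : (1 - c * b) * x t ≤ (1 - c * b) * (A * w) :=
        mul_le_mul_of_nonneg_left ih (by linarith)
      have s2 : C * b * w ≤ c / 2 * A * b * w := by gcongr
      have s3 : A * w * (r / t) ≤ A * w * (c / 2 * b) := by gcongr
      have s4 := mul_le_mul_of_nonneg_left (sub_div_le_rpow ht1 hr) hA0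
      push_cast
      rw [← hw] at s4
      linarith
  refine IsBigO.of_bound A (eventually_atTop.2 ⟨T, fun t ht => ?_⟩)
  rw [Real.norm_of_nonneg (hx t), Real.norm_of_nonneg (by positivity)]
  exact key t ht

end Recursion

section Markov

variable {Ω X Z : Type*} [MeasurableSpace Ω] [MeasurableSpace X] [MeasurableSpace Z]

/-- Integration of a function of the next state of a Markov chain. -/
theorem integral_next_le {P : Measure Ω} [IsProbabilityMeasure P] {ρ : Measure X}
    [IsProbabilityMeasure ρ] {ζ : Ω → Z} {ξ : Ω → X} (hζ : Measurable ζ) (hξ : Measurable ξ)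
    (hind : IndepFun ζ ξ P) (hlaw : P.map ξ = ρ) {f : Z × X → ℝ} (hf : Measurable f)
    (hf0 : ∀ p, 0 ≤ f p) {h : Z → ℝ} (hh : Integrable (fun ω => h (ζ ω)) P)
    (hstep : ∀ ω, Integrable (fun x => f (ζ ω, x)) ρ ∧ ∫ x, f (ζ ω, x) ∂ρ ≤ h (ζ ω)) :
    Integrable (fun ω => f (ζ ω, ξ ω)) P ∧ ∫ ω, f (ζ ω, ξ ω) ∂P ≤ ∫ ω, h (ζ ω) ∂P := by
  have hmap : P.map (fun ω => (ζ ω, ξ ω)) = (P.map ζ).prod ρ := by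
    rw [(indepFun_iff_map_prod_eq_prod_map_map hζ.aemeasurable hξ.aemeasurable).1 hind, hlaw]
  have : IsProbabilityMeasure (P.map ζ) := Measure.isProbabilityMeasure_map hζ.aemeasurable
  have hsm : StronglyMeasurable f := hf.stronglyMeasurable
  have hsi : StronglyMeasurable fun z => ∫ x, f (z, x) ∂ρ := hsm.integral_prod_right'
  have hi : Integrable (fun ω => ∫ x, f (ζ ω, x) ∂ρ) P := by
    refine hh.mono' (hsi.comp_measurable hζ).aestronglyMeasurable (Eventually.of_forall fun ω => ?_)
    rw [Real.norm_of_nonneg (integral_nonneg fun x => hf0 _)]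
    exact (hstep ω).2
  have hprod : Integrable f ((P.map ζ).prod ρ) := by
    rw [integrable_prod_iff hsm.aestronglyMeasurable]
    constructor
    -- The one-step bounds are known only along the trajectory, where the multipliers are
    -- nonnegative, so integrability of sections is checked almost everywhere for the law of `ζ`.
    · rw [ae_map_iff hζ.aemeasurable 
        (measurableSet_integrable (f := fun z x => f (z, x)) hsm)]
      exact Eventually.of_forall fun ω => (hstep ω).1
    · simp only [Real.norm_of_nonneg (hf0 _)]
      exact (integrable_map_measure hsi.aestronglyMeasurable hζ.aemeasurable).2 hi
  have hpair : AEMeasurable (fun ω => (ζ ω, ξ ω)) P := (hζ.prodMk hξ).aemeasurable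
  constructor
  · rw [← hmap] at hprod
    exact (integrable_map_measure hsm.aestronglyMeasurable hpair).1 hprod
  · have e1 : ∫ ω, f (ζ ω, ξ ω) ∂P = ∫ p, f p ∂((P.map ζ).prod ρ) := by
      rw [← hmap, integral_map hpair hsm.aestronglyMeasurable]
    rw [e1, integral_prod _ hprod, integral_map hζ.aemeasurable hsi.aestronglyMeasurable]
    exact integral_mono hi hh fun ω => (hstep ω).2

end Markov

namespace Game

variable {N n : ℕ} {d : Fin N → ℕ}

theorem continuous_step_uncurry {Γ : Game N n d} (hJ : ∀ i, Continuous (Γ.J i)) (γ ε σ : ℝ) :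
    Continuous fun p : (Joint d × EuclideanSpace ℝ (Fin n)) × Joint d =>
      Γ.step γ ε σ (p.1.1 + σ • p.2) p.1 := by
  have h1 := (Γ.continuous_estimate hJ σ).comp (by fun_prop : Continuous
    fun p : (Joint d × EuclideanSpace ℝ (Fin n)) × Joint d => (p.1.1 + σ • p.2, p.1.1, p.1.2))
  have h2 := Γ.continuous_constraint
  have h3 := continuous_projNonneg (n := n)
  simp only [Function.comp_def] at h1
  unfold step
  fun_prop

theorem measurable_iterate {Γ : Game N n d} (hJ : ∀ i, Continuous (Γ.J i)) (γ ε σ : ℕ → ℝ)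
    (z₀ : Joint d × EuclideanSpace ℝ (Fin n)) {Ω : Type*} [MeasurableSpace Ω]
    {ξ : ℕ → Ω → Joint d} (hξ : ∀ t, Measurable (ξ t)) (t : ℕ) :
    Measurable fun ω => Γ.iterate γ ε σ z₀ (fun k => ξ k ω) t := by
  induction t with
  | zero => exact measurable_const
  | succ t ih =>
    exact (continuous_step_uncurry hJ (γ t) (ε t) (σ t)).measurable.comp (ih.prodMk (hξ t))

theorem iterate_congr {Γ : Game N n d} (γ ε σ : ℕ → ℝ)
    (z₀ : Joint d × EuclideanSpace ℝ (Fin n)) {ξ ξ' : ℕ → Joint d} {t : ℕ}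
    (h : ∀ k < t, ξ k = ξ' k) : Γ.iterate γ ε σ z₀ ξ t = Γ.iterate γ ε σ z₀ ξ' t := by
  induction t with
  | zero => rfl
  | succ t ih =>
    simp only [iterate]
    rw [ih fun k hk => h k (by omega), h t (by omega)]

theorem iterate_snd_nonneg {Γ : Game N n d} (γ ε σ : ℕ → ℝ)
    {z₀ : Joint d × EuclideanSpace ℝ (Fin n)} (hz₀ : ∀ k, 0 ≤ z₀.2 k) (ξ : ℕ → Joint d) (t : ℕ)
    (k : Fin n) : 0 ≤ (Γ.iterate γ ε σ z₀ ξ t).2 k := by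
  cases t with
  | zero => exact hz₀ k
  | succ t =>
    simp only [iterate, step, projNonneg_apply]
    exact le_max_right _ _

/-- The state at time `t` is a measurable function of the noises before `t`, which are jointly
independent of `ξ t`. -/
theorem indepFun_iterate {Γ : Game N n d} (hJ : ∀ i, Continuous (Γ.J i)) (γ ε σ : ℕ → ℝ)
    (z₀ : Joint d × EuclideanSpace ℝ (Fin n)) {Ω : Type*} [MeasurableSpace Ω] {P : Measure Ω}
    {ξ : ℕ → Ω → Joint d} (hξ : ∀ t, Measurable (ξ t)) (hind : iIndepFun ξ P) (t : ℕ) :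
    IndepFun (fun ω => Γ.iterate γ ε σ z₀ (fun k => ξ k ω) t) (ξ t) P := by
  have h := hind.indepFun_finset (Finset.range t) {t} (by simp) hξ
  -- Extension by zero turns the finitely many past noises into a full sequence; by `iterate_congr`
  -- the values from time `t` on are irrelevant.
  set ext : ℕ → (Finset.range t → Joint d) → Joint d := fun k v =>
    if hk : k ∈ Finset.range t then v ⟨k, hk⟩ else 0 with hext
  have hextm : ∀ k, Measurable (ext k) := by
    intro k
    by_cases hk : k ∈ Finset.range t
    · simp only [hext, hk, dif_pos]; exact measurable_pi_apply _
    · simp only [hext, hk, dif_neg, not_false_iff]; exact measurable_const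
  have h2 := h.comp (measurable_iterate hJ γ ε σ z₀ hextm t)
    (measurable_pi_apply (⟨t, Finset.mem_singleton_self t⟩ : ({t} : Finset ℕ)))
  convert h2 using 1
  · funext ω
    refine iterate_congr γ ε σ z₀ fun k hk => ?_
    simp [hext, hk]
  · rfl

end Game

end GNEP

/-! ### The equilibrium and the convergence rate -/

namespace GNEP.Game

variable {N n : ℕ} {d : Fin N → ℕ} {Γ : Game N n d}

theorem IsVGNE.unique (hmono : Γ.IsStronglyMonotone) {a b : Joint d} (ha : Γ.IsVGNE a)
    (hb : Γ.IsVGNE b) : a = b := by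
  obtain ⟨ν, hν, hm⟩ := hmono
  have h1 := ha.2 b hb.1
  have h2 := hb.2 a ha.1
  have h3 := hm a b
  have e : ⟪Γ.pseudoGradient a - Γ.pseudoGradient b, a - b⟫
      = -⟪Γ.pseudoGradient a, b - a⟫ - ⟪Γ.pseudoGradient b, a - b⟫ := by
    rw [inner_sub_left, ← inner_neg_right, neg_sub]
  have h4 : ‖a - b‖ ^ 2 ≤ 0 := by
    by_contra! h
    have := mul_pos hν h
    linarith
  have h5 : ‖a - b‖ = 0 := by
    have := sq_nonneg ‖a - b‖
    exact pow_eq_zero_iff two_ne_zero |>.1 (le_antisymm h4 this)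
  exact sub_eq_zero.1 (norm_eq_zero.1 h5)

/-- Stationarity turns `⟨M(a*), b - a*⟩` into `-⟨p₀, g(b)⟩ + ⟨p₀, g(a*)⟩`; complementarity removes
the second term and the first is nonnegative on the feasible set. -/
theorem Setup.isVGNE (S : Setup Γ) : Γ.IsVGNE S.a := by
  refine ⟨S.feas, fun b hb => ?_⟩
  have e1 : Γ.pseudoGradient S.a = -ContinuousLinearMap.adjoint Γ.linearPart S.p₀ :=
    eq_neg_of_add_eq_zero_left S.stat
  have e2 : Γ.linearPart (b - S.a) = Γ.constraint b - Γ.constraint S.a := by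
    rw [constraint_eq, constraint_eq, map_sub]; abel
  rw [e1, inner_neg_left, ContinuousLinearMap.adjoint_inner_left, e2, inner_sub_right,
    S.inner_multiplier S.p₀_mem, sub_zero, neg_nonneg, euclidean_inner_eq_sum]
  exact Finset.sum_nonpos fun k _ => mul_nonpos_of_nonneg_of_nonpos (S.p₀_nonneg k) (hb k)

theorem exists_setup (hconvex : Γ.IsConvex) (hmono : Γ.IsStronglyMonotone) (hslater : Γ.Slater)
    (hgrowth : Γ.HasQuadraticGrowth) (hlip : ∃ L : ℝ≥0, LipschitzWith L Γ.pseudoGradient)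
    {B : ℝ} (hB : 0 < B) : ∃ S : Setup Γ, S.B = B := by
  obtain ⟨C, hC, hest⟩ := Γ.exists_estimate_bounds (fun i => (hconvex i).1) hgrowth hlip hB.le
  obtain ⟨ν, hν, hm⟩ := hmono
  obtain ⟨L, hL⟩ := hlip
  obtain ⟨a₀, ha₀⟩ := hslater
  obtain ⟨a, p₀, h1, h2, h3, h4⟩ := exists_kkt hν L.2 hm (fun a b => hL.norm_sub_le a b)
    Γ.linearPart Γ.l (a₀ := a₀) (fun k => by rw [← constraint_eq]; exact ha₀ k)
  exact ⟨{ B := B, ν := ν, L := L, C := C, a := a, p₀ := p₀, B_pos := hB, ν_pos := hν,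
           L_nonneg := L.2, C_nonneg := hC, mono := hm, lip := fun a b => hL.norm_sub_le a b,
           feas := fun k => by rw [constraint_eq]; exact h1 k, p₀_nonneg := h2,
           compl := fun k => by rw [constraint_eq]; exact h3 k, stat := h4,
           cont := fun i => (hconvex i).1.continuous
           est_le := fun σ hσ hσB μ lam => (hest σ hσ hσB μ lam).1
           bias_le := fun σ hσ hσB μ lam => (hest σ hσ hσB μ lam).2 }, rfl⟩

namespace Setup

/-- Integration of a function of the next iterate. -/
theorem integral_iterate_succ_le (S : Setup Γ) {γ ε σ : ℕ → ℝ}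
    {z₀ : Joint d × EuclideanSpace ℝ (Fin n)} (hz₀ : ∀ k, 0 ≤ z₀.2 k) {Ω : Type*}
    [MeasurableSpace Ω] {P : Measure Ω}
    [IsProbabilityMeasure P] {ξ : ℕ → Ω → Joint d} (hξ : ∀ t, Measurable (ξ t))
    (hind : iIndepFun ξ P) (hlaw : ∀ t, P.map (ξ t) = stdGaussian (Joint d)) (t : ℕ)
    {f h : Joint d × EuclideanSpace ℝ (Fin n) → ℝ} (hf : Continuous f) (hf0 : ∀ z, 0 ≤ f z)
    (hh : Integrable (fun ω => h (Γ.iterate γ ε σ z₀ (fun k => ξ k ω) t)) P)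
    (hstep : ∀ z : Joint d × EuclideanSpace ℝ (Fin n), (∀ k, 0 ≤ z.2 k) →
      Integrable (fun x => f (Γ.step (γ t) (ε t) (σ t) (z.1 + σ t • x) z)) (stdGaussian (Joint d)) ∧
      ∫ x, f (Γ.step (γ t) (ε t) (σ t) (z.1 + σ t • x) z) ∂stdGaussian (Joint d) ≤ h z) :
    Integrable (fun ω => f (Γ.iterate γ ε σ z₀ (fun k => ξ k ω) (t + 1))) P ∧
    ∫ ω, f (Γ.iterate γ ε σ z₀ (fun k => ξ k ω) (t + 1)) ∂P
      ≤ ∫ ω, h (Γ.iterate γ ε σ z₀ (fun k => ξ k ω) t) ∂P :=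
  integral_next_le (f := fun p => f (Γ.step (γ t) (ε t) (σ t) (p.1.1 + σ t • p.2) p.1))
    (measurable_iterate S.cont γ ε σ z₀ hξ t) (hξ t) (indepFun_iterate S.cont γ ε σ z₀ hξ hind t)
    (hlaw t) (hf.comp (continuous_step_uncurry S.cont (γ t) (ε t) (σ t))).measurable
    (fun _ => hf0 _) hh
    (fun ω => hstep _ fun k => iterate_snd_nonneg γ ε σ hz₀ (fun k => ξ k ω) t k)

/-- Convergence rate of the payoff-based algorithm. -/
theorem integrable_and_isBigO (S : Setup Γ) {G E S' g e s : ℝ} (hG : 0 < G) (hE : 0 < E)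
    (he : 0 < e) (hsg : 1 < s + g) (hge : g + e < 1) (hg2 : 1 / 2 < g)
    {γ ε σ : ℕ → ℝ} (hadm : ∀ t, S.Admissible (γ t) (ε t) (σ t))
    (hγ : ∀ t : ℕ, 1 ≤ t → γ t = G / (t : ℝ) ^ g) (hε : ∀ t : ℕ, 1 ≤ t → ε t = E / (t : ℝ) ^ e)
    (hσ : ∀ t : ℕ, 1 ≤ t → σ t = S' / (t : ℝ) ^ s) {z₀ : Joint d × EuclideanSpace ℝ (Fin n)}
    (hz₀ : ∀ k, 0 ≤ z₀.2 k) {Ω : Type*} [MeasurableSpace Ω] {P : Measure Ω}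
    [IsProbabilityMeasure P] {ξ : ℕ → Ω → Joint d} (hξ : ∀ t, Measurable (ξ t))
    (hind : iIndepFun ξ P) (hlaw : ∀ t, P.map (ξ t) = stdGaussian (Joint d))
    {r : ℝ} (hr0 : 0 ≤ r) (hre : r ≤ 2 * e) (hrg : r ≤ g) :
    (∀ t, Integrable (fun ω => ‖(Γ.iterate γ ε σ z₀ (fun k => ξ k ω) t).1 - S.a‖ ^ 2) P) ∧
    (fun t : ℕ => ∫ ω, ‖(Γ.iterate γ ε σ z₀ (fun k => ξ k ω) t).1 - S.a‖ ^ 2 ∂P)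
      =O[atTop] fun t : ℕ => 1 / (t : ℝ) ^ r := by
  have hgpos : 0 < g := by linarith
  -- The moments decay like `t^(-(g-e)(q+1))`, and `g > 1/2` with `g + e < 1` forces `e < g`, so a
  -- large `q` reaches any required rate.
  obtain ⟨q, hq⟩ : ∃ q : ℕ, r ≤ (g - e) * ((q + 1 : ℕ) : ℝ) := by
    obtain ⟨q, hq⟩ := exists_nat_ge (r / (g - e))
    refine ⟨q, ?_⟩
    rw [div_le_iff₀ (by linarith)] at hq
    push_cast
    nlinarith
  obtain ⟨K₁, hK₁, hcrude⟩ := S.exists_excess_pow_crude (2 * q)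
  obtain ⟨K₂, hK₂, hexp⟩ := S.exists_excess_pow_step (2 * q)
  obtain ⟨K₃, η, hK₃, hη, hcontr⟩ := S.exists_excess_pow_contraction q
  obtain ⟨η', c, K, hc, hK, hlow, hlyap⟩ := S.exists_lyap_contraction (2 * q + 2) (by omega)
  have hlyap0 : ∀ z, 0 ≤ S.lyap η' z := fun z => by
    have := hlow z; linarith [sq_nonneg ‖z.1 - S.a‖]
  set ζ : ℕ → Ω → Joint d × EuclideanSpace ℝ (Fin n) := fun t ω =>
    Γ.iterate γ ε σ z₀ (fun k => ξ k ω) t with hζ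
  set Y : ℕ → Ω → ℝ := fun t ω => S.excess (ζ t ω) ^ (2 * q + 2) with hY
  set V : ℕ → Ω → ℝ := fun t ω => S.lyap η' (ζ t ω) with hV
  have hYc : Continuous fun z => S.excess z ^ (2 * q + 2) := S.continuous_excess.pow _
  have hY0 : ∀ z, 0 ≤ S.excess z ^ (2 * q + 2) := fun z => pow_nonneg (S.excess_nonneg z) _
  have hYi : ∀ t, Integrable (Y t) P := by
    intro t
    induction t with
    | zero => exact integrable_const (S.excess z₀ ^ (2 * q + 2))
    | succ t ih =>
      exact (S.integral_iterate_succ_le hz₀ hξ hind hlaw t hYc hY0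
        (h := fun z => K₁ * (1 + S.excess z ^ (2 * q + 2)))
        (((integrable_const 1).add ih).const_mul K₁) fun z _ =>
          ⟨(hexp _ _ _ (hadm t) z).1, hcrude _ _ _ (hadm t) z⟩).1
  have hVstep : ∀ t, Integrable (V t) P → Integrable (V (t + 1)) P ∧ ∫ ω, V (t + 1) ω ∂P ≤
      ∫ ω, ((1 - c * γ t) * V t ω + K * γ t * ((ε t ^ 2 + γ t) * (1 + Y t ω) + σ t ^ 2
        + Y t ω)) ∂P := by
    intro t ih
    refine S.integral_iterate_succ_le hz₀ hξ hind hlaw t (S.continuous_lyap η') hlyap0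
      (h := fun z => (1 - c * γ t) * S.lyap η' z + K * γ t * ((ε t ^ 2 + γ t)
        * (1 + S.excess z ^ (2 * q + 2)) + σ t ^ 2 + S.excess z ^ (2 * q + 2)))
      ?_ fun z hz => hlyap _ _ _ (hadm t) z hz
    exact (ih.const_mul _).add ((((((integrable_const 1).add (hYi t)).const_mul _).add
      (integrable_const _)).add (hYi t)).const_mul _)
  have hVi : ∀ t, Integrable (V t) P := by
    intro t
    induction t with
    | zero => exact integrable_const (S.lyap η' z₀)
    | succ t ih => exact (hVstep t ih).1
  -- Chung's lemma with step exponent `g + e < 1`. The smallness conditions of the contraction hold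
  -- eventually because `e > 0`, `e < 2s` (as `s > 1 - g > e`) and `e < g`.
  have hYO : (fun t => ∫ ω, Y t ω ∂P) =O[atTop] fun t : ℕ => 1 / (t : ℝ) ^ r := by
    refine isBigO_of_recursion (a := g + e) (c := G * E / 4)
      (C := K₃ * (G * E) * (G / E) ^ (q + 1)) (fun t => integral_nonneg fun ω => hY0 _)
      (by linarith) hge hr0 (by positivity) ?_
    have k1 := eventually_div_rpow_le he E hη
    have k2 := eventually_div_rpow_le (show e < s * 2 by linarith) (S' ^ 2) (mul_pos hη hE)
    have k3 := eventually_div_rpow_le (show e < g by linarith) G (mul_pos hη hE)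
    filter_upwards [k1, k2, k3, eventually_ge_atTop 1] with t h1 h2 h3 ht
    have ht1 : (1:ℝ) ≤ t := by exact_mod_cast ht
    have ht0 : (0:ℝ) < t := by linarith
    have e1 : γ t * ε t = G * E / (t:ℝ) ^ (g + e) := by
      rw [hγ t ht, hε t ht, Real.rpow_add ht0]; field_simp
    have e2 : (γ t / ε t) ^ (q + 1) ≤ (G / E) ^ (q + 1) * (1 / (t:ℝ) ^ r) := by
      have : γ t / ε t = G / E * (1 / (t:ℝ) ^ (g - e)) := by
        rw [hγ t ht, hε t ht, Real.rpow_sub ht0]; field_simp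
      rw [this, mul_pow]
      gcongr
      rw [one_div_pow, ← Real.rpow_natCast, ← Real.rpow_mul ht0.le]
      exact one_div_rpow_le ht1 hq
    have hc := hcontr _ _ _ (hadm t) (by rw [hε t ht]; simpa using h1)
      (by
        rw [hσ t ht, hε t ht, div_pow, ← Real.rpow_natCast ((t:ℝ) ^ s), ← Real.rpow_mul ht0.le,
          ← mul_div_assoc]
        exact_mod_cast h2)
      (by rw [hγ t ht, hε t ht, ← mul_div_assoc]; exact h3)
    have hm := (S.integral_iterate_succ_le hz₀ hξ hind hlaw t hYc hY0
      (h := fun z => (1 - γ t * ε t / 4) * S.excess z ^ (2 * q + 2)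
        + K₃ * (γ t * ε t) * (γ t / ε t) ^ (q + 1))
      (((hYi t).const_mul _).add (integrable_const _)) fun z hz =>
        ⟨(hexp _ _ _ (hadm t) z).1, hc z hz⟩).2
    rw [integral_add ((hYi t).const_mul _) (integrable_const _), integral_const_mul] at hm
    simp only [integral_const, probReal_univ, one_smul] at hm
    refine hm.trans ?_
    have e3 : G * E / 4 / (t:ℝ) ^ (g + e) = γ t * ε t / 4 := by rw [e1]; ring
    rw [e3]
    refine add_le_add le_rfl ?_
    have p1 : 0 ≤ γ t * ε t := (mul_pos (hadm t).γ_pos (hadm t).ε_pos).le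
    calc K₃ * (γ t * ε t) * (γ t / ε t) ^ (q + 1)
        ≤ K₃ * (γ t * ε t) * ((G / E) ^ (q + 1) * (1 / (t:ℝ) ^ r)) := by gcongr
      _ = _ := by rw [e1]; ring
  obtain ⟨Cy, hCy, hYb⟩ := hYO.exists_nonneg
  -- Chung's lemma again, now with step exponent `g`, the moments of the excess entering the forcing
  -- at rate `t^(-r)`.
  have hVO : (fun t => ∫ ω, V t ω ∂P) =O[atTop] fun t : ℕ => 1 / (t : ℝ) ^ r := by
    refine isBigO_of_recursion (a := g) (c := c * G)
      (C := K * G * ((E ^ 2 + G) * (1 + Cy) + S' ^ 2 + Cy))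
      (fun t => integral_nonneg fun ω => hlyap0 _) hgpos (by linarith) hr0 (by positivity) ?_
    filter_upwards [hYb.bound, eventually_ge_atTop 1] with t h1 ht
    have ht1 : (1:ℝ) ≤ t := by exact_mod_cast ht
    have ht0 : (0:ℝ) < t := by linarith
    have hEY0 : 0 ≤ ∫ ω, Y t ω ∂P := integral_nonneg fun ω => hY0 _
    rw [Real.norm_of_nonneg hEY0, Real.norm_of_nonneg (by positivity)] at h1
    have hm := (hVstep t (hVi t)).2
    have i1 : Integrable (fun ω => (ε t ^ 2 + γ t) * (1 + Y t ω) + σ t ^ 2) P :=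
      (((integrable_const 1).add (hYi t)).const_mul _).add (integrable_const _)
    have i2 : Integrable (fun ω => K * γ t * ((ε t ^ 2 + γ t) * (1 + Y t ω) + σ t ^ 2
        + Y t ω)) P := (i1.add (hYi t)).const_mul _
    have i3 : Integrable (fun ω => (ε t ^ 2 + γ t) * (1 + Y t ω)) P :=
      ((integrable_const 1).add (hYi t)).const_mul _
    rw [integral_add ((hVi t).const_mul _) i2, integral_const_mul, integral_const_mul,
      integral_add i1 (hYi t), integral_add i3 (integrable_const _), integral_const_mul,
      integral_add (integrable_const _) (hYi t)] at hm
    simp only [integral_const, probReal_univ, one_smul] at hm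
    refine hm.trans ?_
    set w := 1 / (t:ℝ) ^ r with hw
    have hw0 : 0 < w := by positivity
    have hw1 : w ≤ 1 := by
      rw [hw, div_le_one (by positivity)]
      exact Real.one_le_rpow ht1 hr0
    have hsq : ∀ (A p : ℝ), r ≤ p * 2 → (A / (t:ℝ) ^ p) ^ 2 ≤ A ^ 2 * w := by
      intro A p hp
      rw [div_pow, ← Real.rpow_natCast ((t:ℝ) ^ p), ← Real.rpow_mul ht0.le, ← mul_one_div]
      gcongr
      exact one_div_rpow_le ht1 (by exact_mod_cast hp)
    have g1 : ε t ^ 2 ≤ E ^ 2 * w := by rw [hε t ht]; exact hsq E e (by linarith)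
    have g2 : σ t ^ 2 ≤ S' ^ 2 * w := by rw [hσ t ht]; exact hsq S' s (by linarith)
    have g3 : γ t ≤ G * w := by
      rw [hγ t ht, ← mul_one_div]
      gcongr
      exact one_div_rpow_le ht1 hrg
    have g4 : ∫ ω, Y t ω ∂P ≤ Cy := h1.trans (by nlinarith)
    have g5 : (ε t ^ 2 + γ t) * (1 + ∫ ω, Y t ω ∂P) ≤ ((E ^ 2 + G) * w) * (1 + Cy) := by
      refine mul_le_mul (by linarith) (by linarith) (by linarith) (by positivity)
    have e3 : c * G / (t:ℝ) ^ g = c * γ t := by rw [hγ t ht]; ring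
    have e4 : K * G * ((E ^ 2 + G) * (1 + Cy) + S' ^ 2 + Cy) / (t:ℝ) ^ g
        = K * γ t * ((E ^ 2 + G) * (1 + Cy) + S' ^ 2 + Cy) := by rw [hγ t ht]; ring
    rw [e3, e4]
    refine add_le_add le_rfl ?_
    have p1 : 0 ≤ K * γ t := mul_nonneg hK (hadm t).γ_pos.le
    calc K * γ t * ((ε t ^ 2 + γ t) * (1 + ∫ ω, Y t ω ∂P) + σ t ^ 2 + ∫ ω, Y t ω ∂P)
        ≤ K * γ t * (((E ^ 2 + G) * w) * (1 + Cy) + S' ^ 2 * w + Cy * w) := by gcongr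
      _ = _ := by ring
  have hmeas : ∀ t, Measurable (ζ t) := measurable_iterate S.cont γ ε σ z₀ hξ
  have hθ : ∀ t, Integrable (fun ω => ‖(ζ t ω).1 - S.a‖ ^ 2) P := fun t =>
    ((hVi t).const_mul 2).mono'
      ((((hmeas t).fst.sub_const _).norm.pow_const 2).aestronglyMeasurable)
      (Eventually.of_forall fun ω => by
        rw [Real.norm_of_nonneg (sq_nonneg _)]; exact hlow _)
  refine ⟨hθ, IsBigO.trans (IsBigO.of_bound 2 (Eventually.of_forall fun t => ?_)) hVO⟩
  rw [Real.norm_of_nonneg (integral_nonneg fun ω => sq_nonneg _),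
    Real.norm_of_nonneg (integral_nonneg fun ω => hlyap0 _), ← integral_const_mul]
  exact integral_mono (hθ t) ((hVi t).const_mul 2) fun ω => hlow _

end Setup

end GNEP.Game

theorem theorem1 {N n : ℕ} {d : Fin N → ℕ} (Γ : GNEP.Game N n d)
    (hconvex : Γ.IsConvex)
    (hmono : Γ.IsStronglyMonotone)
    (hslater : Γ.Slater)
    (hgrowth : Γ.HasQuadraticGrowth)
    (hlip : ∃ L : ℝ≥0, LipschitzWith L Γ.pseudoGradient) :
    (∃! aStar : GNEP.Joint d, Γ.IsVGNE aStar) ∧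
    ∀ aStar : GNEP.Joint d, Γ.IsVGNE aStar →
      ∀ (G E S g e s : ℝ), 0 < G → 0 < E → 0 < S → 0 < g → 0 < e → 0 < s →
        1 < s + g → g + e < 1 → 1 / 2 < g →
      ∀ (γ ε σ : ℕ → ℝ), 0 < γ 0 → 0 < ε 0 → 0 < σ 0 →
        (∀ t : ℕ, 1 ≤ t → γ t = G / (t : ℝ) ^ g) →
        (∀ t : ℕ, 1 ≤ t → ε t = E / (t : ℝ) ^ e) →
        (∀ t : ℕ, 1 ≤ t → σ t = S / (t : ℝ) ^ s) →
      ∀ (μ₀ : GNEP.Joint d) (lam₀ : EuclideanSpace ℝ (Fin n)), (∀ k, 0 ≤ lam₀ k) →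
      ∀ {Ω : Type*} [MeasurableSpace Ω] (P : Measure Ω) [IsProbabilityMeasure P]
        (ξ : ℕ → Ω → GNEP.Joint d),
        (∀ t, Measurable (ξ t)) → iIndepFun ξ P →
        (∀ t, P.map (ξ t) = stdGaussian (GNEP.Joint d)) →
        (∀ t, Integrable
          (fun ω => ‖(Γ.iterate γ ε σ (μ₀, lam₀) (fun k => ξ k ω) t).1 - aStar‖ ^ 2) P) ∧
        (fun t : ℕ =>
          ∫ ω, ‖(Γ.iterate γ ε σ (μ₀, lam₀) (fun k => ξ k ω) t).1 - aStar‖ ^ 2 ∂P)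
          =O[atTop] fun t : ℕ =>
            1 / (t : ℝ) ^ min (2 * e) (min (2 - g - e) (min (g + s) (2 * g)) - g) := by
  constructor
  · obtain ⟨S, -⟩ := GNEP.Game.exists_setup hconvex hmono hslater hgrowth hlip one_pos
    exact ⟨S.a, S.isVGNE, fun b hb => GNEP.Game.IsVGNE.unique hmono hb S.isVGNE⟩
  intro aStar haStar G E S' g e s hG hE hS hg he hs hsg hge hg2 γ ε σ hγ0 hε0 hσ0 hγ hε hσ μ₀ lam₀
    hlam₀ Ω _ P _ ξ hξ hind hlaw
  -- The uniform parameter bound `B` is the sum of the arbitrary values at time `0` and of the three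
  -- constants, which dominate the parameters for `t ≥ 1`.
  obtain ⟨S, hSB⟩ := GNEP.Game.exists_setup hconvex hmono hslater hgrowth hlip
    (by positivity : 0 < γ 0 + ε 0 + σ 0 + G + E + S')
  obtain rfl : aStar = S.a := GNEP.Game.IsVGNE.unique hmono haStar S.isVGNE
  have hpos : ∀ {A p : ℝ} {t : ℕ}, 0 < A → 1 ≤ t → 0 < A / (t:ℝ) ^ p := fun hA ht =>
    div_pos hA (Real.rpow_pos_of_pos (by exact_mod_cast ht) _)
  have hle : ∀ {A p : ℝ} {t : ℕ}, 0 < A → 0 < p → 1 ≤ t → A / (t:ℝ) ^ p ≤ A := fun hA hp ht =>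
    div_le_self hA.le (Real.one_le_rpow (by exact_mod_cast ht) hp.le)
  have hadm : ∀ t, S.Admissible (γ t) (ε t) (σ t) := by
    intro t
    rcases Nat.eq_zero_or_pos t with rfl | ht
    · exact ⟨hγ0, by linarith, hε0, by linarith, hσ0, by linarith⟩
    · rw [hγ t ht, hε t ht, hσ t ht]
      have h1 := hle (t := t) hG hg ht
      have h2 := hle (t := t) hE he ht
      have h3 := hle (t := t) hS hs ht
      exact ⟨hpos hG ht, by linarith, hpos hE ht, by linarith, hpos hS ht, by linarith⟩
  have hmin1 : min (2 - g - e) (min (g + s) (2 * g)) ≤ g + s :=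
    (min_le_right _ _).trans (min_le_left _ _)
  have hmin2 : min (2 - g - e) (min (g + s) (2 * g)) ≤ 2 * g :=
    (min_le_right _ _).trans (min_le_right _ _)
  have hr := min_le_right (2 * e) (min (2 - g - e) (min (g + s) (2 * g)) - g)
  -- The general rate allows any exponent between `0` and `min (2e) g`. This inequality gives
  -- nonnegativity of the stated exponent; the entry `2g` of `h` gives `h - g ≤ g`.
  have hh : g ≤ min (2 - g - e) (min (g + s) (2 * g)) :=
    le_min (by linarith) (le_min (by linarith) (by linarith))
  exact S.integrable_and_isBigO hG hE he hsg hge hg2 hadm hγ hε hσ hlam₀ hξ hind hlaw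
    (le_min (by linarith) (by linarith)) (min_le_left _ _) (by linarith)
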